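/- Let $q$ be a power of an odd prime. For an integer $n$ put $[n]_{q^2}=\frac{q^{2n}-1}{q^2-1}$, and let $\mathcal R_{q^2}$ be the ring of polynomials $f\in\mathbb Q[x]$ with $f([n]_{q^2})\in\mathbb Z[q^2,q^{-2}]$ for all $n\in\mathbb Z$. Let $\Phi_q$ be the set of monic irreducible polynomials $r\neq t$ in $\mathbb F_q[t]$, and put $r^*(t)=t^{\deg r}r(t^{-1})/r(0)$. A multipartition is a finitely supported function $\boldsymbol\mu$ from $\Phi_q$ to partitions. A *symplectic* (respectively *orthogonal*) *signed partition* is a partition in which every odd (respectively even) part has even multiplicity, together with a sign for each even (respectively odd) part size that occurs. Let $Sp_{2n}(\mathbb F_q)$ be the isometry group of the standard alternating form $B$ on $\mathbb F_q^{2n}$. The conjugacy class of $g\in Sp_{2n}(\mathbb F_q)$ is labelled by the signed multipartition $\boldsymbol\mu$ such that * the multiplicity of $i$ in $\boldsymbol\mu(r)$ is the multiplicity of $r^i$ as an elementary divisor of the $\mathbb F_q[t]$-module $\mathbb F_q^{2n}$, where $t$ acts by $g$; then $\boldsymbol\mu(r)=\boldsymbol\mu(r^*)$; * $\boldsymbol\mu(t-1)$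 and $\boldsymbol\mu(t+1)$ are symplectic signed partitions: for $\varepsilon=\pm1$ and an even part size $i$ of $\boldsymbol\mu(t-\varepsilon)$, the sign is $+$ if the symmetric form $(u,v)\mapsto B(u,(g-\varepsilon)^{i-1}v)$ on $\ker (g-\varepsilon)^i$, taken modulo its radical, is an orthogonal sum of hyperbolic planes, or of hyperbolic planes and the one-dimensional form $xy$; otherwise the sign is $-$. The *symplectic modified type* of $g$ is the signed multipartition obtained from this label by subtracting $1$ from each part of $\boldsymbol\mu(t-1)$ and keeping the signs. Symplectic modified types are indexed by the signed multipartitions $\boldsymbol\mu$ with $\boldsymbol\mu(r)=\boldsymbol\mu(r^*)$ for all $r\in\Phi_q$, for which $\boldsymbol\mu(t-1)$ is an orthogonal signed partition and $\boldsymbol\mu(t+1)$ is a symplectic signed partition. Let $X_{\boldsymbol\mu,n}\in\mathbb Z Sp_{2n}(\mathbb F_q)$ be the sum of all elements of symplectic modified type $\boldsymbol\mu$ in $Sp_{2n}(\mathbb F_q)$. **Theorem.** For every $n\ge 0$ the nonzero $X_{\boldsymbol\mu,n}$ form a $\mathbb Z$-basis of $Z(\mathbb Z Sp_{2n}(\mathbb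 F_q))$. There is a family of elements $r_{\boldsymbol\mu,\boldsymbol\nu}^{\boldsymbol\lambda}\in\mathcal R_{q^2}$, indexed by triples of such signed multipartitions and independent of $n$, such that for given $\boldsymbol\mu,\boldsymbol\nu$ only finitely many $r_{\boldsymbol\mu,\boldsymbol\nu}^{\boldsymbol\lambda}$ are nonzero, and for all $\boldsymbol\mu,\boldsymbol\nu$ and all $n\ge 0$ $$X_{\boldsymbol\mu,n}X_{\boldsymbol\nu,n}=\sum_{\boldsymbol\lambda} r_{\boldsymbol\mu,\boldsymbol\nu}^{\boldsymbol\lambda}([n]_{q^2})\,X_{\boldsymbol\lambda,n}$$ (an identity in $\mathbb Q Sp_{2n}(\mathbb F_q)$). -/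

import Mathlib

open Polynomial
open scoped DirectSum

noncomputable section

namespace SpCentre

/-! ### Quantum integers and quantum integer-valued polynomials -/

/-- The quantum integer `[n]_Q = (Q ^ n - 1) / (Q - 1)`, for an integer `n` and a number `Q ≠ 0, 1`. -/
def qInt (Q : ℚ) (n : ℤ) : ℚ := (Q ^ n - 1) / (Q - 1)

/-- The ring `R_Q` of quantum integer-valued polynomials at the number `Q`: the polynomials
`f ∈ ℚ[x]` with `f([n]_Q) ∈ ℤ[Q, Q⁻¹]` for every integer `n`. -/
def quantumIntValued (Q : ℚ) : Subring ℚ[X] where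
  carrier := {f | ∀ n : ℤ, f.eval (qInt Q n) ∈ Algebra.adjoin ℤ ({Q, Q⁻¹} : Set ℚ)}
  mul_mem' := fun ha hb n => by
    rw [eval_mul]; exact mul_mem (ha n) (hb n)
  one_mem' := fun n => by
    rw [eval_one]; exact one_mem _
  add_mem' := fun ha hb n => by
    rw [eval_add]; exact add_mem (ha n) (hb n)
  zero_mem' := fun n => by
    rw [eval_zero]; exact zero_mem _
  neg_mem' := fun ha n => by
    rw [eval_neg]; exact neg_mem (ha n)

/-! ### Signed multipartitions -/

section Multipartitions

variable (F : Type*) [Field F]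

/-- The set `Φ` of monic irreducible polynomials over `F` different from `t`. -/
def Phi : Type _ := {r : F[X] // r.Monic ∧ Irreducible r ∧ r ≠ X}

variable {F}

/-- The polynomial `t - a` as an element of `Φ`, for `a ≠ 0`. -/
def Phi.linear (a : F) (ha : a ≠ 0) : Phi F :=
  ⟨X - C a, monic_X_sub_C a, irreducible_X_sub_C a, fun h => ha (by
    have := congrArg (eval 0) h
    simpa using this)⟩

variable (F)

/-- The element `t - 1` of `Φ`. -/
def Phi.tSubOne : Phi F := Phi.linear 1 one_ne_zero

/-- The element `t + 1` of `Φ`. -/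
def Phi.tAddOne : Phi F := Phi.linear (-1) (neg_ne_zero.mpr one_ne_zero)

variable {F}

/-- `r*(t) = t ^ deg r * r(t⁻¹) / r(0)`. -/
def starPoly (r : F[X]) : F[X] := C (r.coeff 0)⁻¹ * r.reverse

variable (F)

/-- A multipartition (a finitely supported function from `Φ` to partitions, a partition being the
multiset of its positive parts) with signs attached to some of the part sizes at `t - 1` and at
`t + 1`. The value `0` of a sign function means that no sign is attached to that part size. -/
@[ext]
structure SignedMultipartition where
  /-- The underlying multipartition. -/
  part : Phi F →₀ Multiset ℕ+
  /-- The signs attached to part sizes of the partition at `t - 1`. -/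
  signSubOne : ℕ+ → SignType
  /-- The signs attached to part sizes of the partition at `t + 1`. -/
  signAddOne : ℕ+ → SignType

/-- A symplectic signed partition: odd parts have even multiplicity, and a sign is given for
precisely the even part sizes that occur. -/
def IsSymplecticSigned (p : Multiset ℕ+) (ε : ℕ+ → SignType) : Prop :=
  (∀ i : ℕ+, Odd (i : ℕ) → Even (p.count i)) ∧
    ∀ i : ℕ+, ε i ≠ 0 ↔ Even (i : ℕ) ∧ 0 < p.count i

/-- An orthogonal signed partition: even parts have even multiplicity, and a sign is given for
precisely the odd part sizes that occur. -/
def IsOrthogonalSigned (p : Multiset ℕ+) (ε : ℕ+ → SignType) : Prop :=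
  (∀ i : ℕ+, Even (i : ℕ) → Even (p.count i)) ∧
    ∀ i : ℕ+, ε i ≠ 0 ↔ Odd (i : ℕ) ∧ 0 < p.count i

/-- The index set of symplectic modified types: signed multipartitions `μ` with `μ(r) = μ(r*)`,
such that `μ(t - 1)` is an orthogonal signed partition and `μ(t + 1)` is a symplectic signed
partition. -/
def SymplecticModifiedType : Type _ :=
  {μ : SignedMultipartition F //
    (∀ r s : Phi F, s.1 = starPoly r.1 → μ.part s = μ.part r) ∧
    IsOrthogonalSigned (μ.part (Phi.tSubOne F)) μ.signSubOne ∧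
    IsSymplecticSigned (μ.part (Phi.tAddOne F)) μ.signAddOne}

variable {F}

/-- Subtract `1` from each part of a partition (parts equal to `1` disappear). -/
def decrementParts (p : Multiset ℕ+) : Multiset ℕ+ :=
  (p.filter (fun i => 1 < i)).map (fun i => i - 1)

open Classical in
/-- Subtract `1` from each part of the partition at `t - 1`; each sign stays attached to the
parts that it was attached to. -/
def SignedMultipartition.modify (σ : SignedMultipartition F) : SignedMultipartition F where
  part := σ.part.update (Phi.tSubOne F) (decrementParts (σ.part (Phi.tSubOne F)))
  signSubOne := fun i => σ.signSubOne (i + 1)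
  signAddOne := σ.signAddOne

end Multipartitions

/-! ### Conjugacy invariants of symplectic matrices -/

section Symplectic

variable {F : Type*} [Field F] {n : ℕ}

/-- `φ` has type `τ`: for every `r ∈ Φ` and `i ≥ 1`, the multiplicity of `i` as a part of `τ(r)` is
the multiplicity of `r ^ i` as an elementary divisor of the `F[t]`-module on which `t` acts by
`φ`. -/
def HasType {V : Type*} [AddCommGroup V] [Module F V] (φ : V →ₗ[F] V)
    (τ : Phi F →₀ Multiset ℕ+) : Prop :=
  ∃ (k : ℕ) (r : Fin k → Phi F) (e : Fin k → ℕ+),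
    Nonempty (Module.AEval' φ ≃ₗ[F[X]]
      ⨁ j : Fin k, F[X] ⧸ Ideal.span {(r j).1 ^ (e j : ℕ)}) ∧
    ∀ (s : Phi F) (i : ℕ+), (τ s).count i = Nat.card {j : Fin k // r j = s ∧ e j = i}

/-- The standard alternating form `B(x, y) = ∑ i, (x_i y_i' - x_i' y_i)` on `F ^ (2n)`; the
coordinates `x_i`, `x_i'` are those with index `Sum.inl i`, `Sum.inr i`. It is the form preserved by
`Matrix.symplecticGroup (Fin n) F`. -/
def stdForm (x y : Fin n ⊕ Fin n → F) : F :=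
  ∑ i : Fin n, (x (Sum.inl i) * y (Sum.inr i) - x (Sum.inr i) * y (Sum.inl i))

/-- For `ε = ± 1` and even `i`, the bilinear form `(u, v) ↦ B(u, (g - ε) ^ (i - 1) v)` on
`ker (g - ε) ^ i` is symmetric, and modulo its radical it is a nondegenerate symmetric form of
dimension `m`, the multiplicity of `(t - ε) ^ i` as an elementary divisor of `g` (the Hermitian
invariant of `g` at `(t - ε) ^ i`). The predicate says that this form is of `+` type, i.e. that it
is an orthogonal sum of hyperbolic planes if `m` is even, and of hyperbolic planes and the form `xy`
if `m` is odd: in a suitable basis, its matrix has entries `1` on the antidiagonal and `0`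
elsewhere. -/
def IsPlusType (g : Matrix (Fin n ⊕ Fin n) (Fin n ⊕ Fin n) F) (ε : F) (i m : ℕ) : Prop :=
  ∃ w : Fin m → (Fin n ⊕ Fin n → F),
    (∀ a, ((g - Matrix.scalar _ ε) ^ i).mulVec (w a) = 0) ∧
    ∀ a b, stdForm (w a) (((g - Matrix.scalar _ ε) ^ (i - 1)).mulVec (w b)) =
      if b = Fin.rev a then 1 else 0

open Classical in
/-- The sign attached to the part size `i` at `t - ε`, where `p` is the partition at `t - ε` of the
type of `g`: there is none (value `0`) if `i` is odd or does not occur in `p`. -/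
def hermitianSign (g : Matrix (Fin n ⊕ Fin n) (Fin n ⊕ Fin n) F) (ε : F) (p : Multiset ℕ+)
    (i : ℕ+) : SignType :=
  if Even (i : ℕ) ∧ 0 < p.count i then (if IsPlusType g ε i (p.count i) then 1 else -1) else 0

/-- The conjugacy class of the symplectic matrix `g` is labelled by the signed multipartition
`σ`. -/
def HasLabel (g : Matrix.symplecticGroup (Fin n) F) (σ : SignedMultipartition F) : Prop :=
  HasType (Matrix.toLin' g.1) σ.part ∧
    (∀ i, σ.signSubOne i = hermitianSign g.1 1 (σ.part (Phi.tSubOne F)) i) ∧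
    ∀ i, σ.signAddOne i = hermitianSign g.1 (-1) (σ.part (Phi.tAddOne F)) i

/-- The symplectic matrix `g` has symplectic modified type `μ`. -/
def HasModifiedType (g : Matrix.symplecticGroup (Fin n) F) (μ : SymplecticModifiedType F) : Prop :=
  ∃ σ : SignedMultipartition F, HasLabel g σ ∧ σ.modify = μ.1

variable (F n)

open Classical in
/-- `X_{μ,n}`, the sum in `ℤ Sp_{2n}(F)` of all elements of symplectic modified type `μ`. -/
def classSum [Fintype F] (μ : SymplecticModifiedType F) :
    MonoidAlgebra ℤ (Matrix.symplecticGroup (Fin n) F) :=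
  ∑ g ∈ (Finset.univ : Finset (Matrix.symplecticGroup (Fin n) F)).filter
    (fun g => HasModifiedType g μ), MonoidAlgebra.of ℤ _ g

/-- `ℤ Sp_{2n}(F)` inside `ℚ Sp_{2n}(F)`. -/
def toRat : MonoidAlgebra ℤ (Matrix.symplecticGroup (Fin n) F) →+*
    MonoidAlgebra ℚ (Matrix.symplecticGroup (Fin n) F) :=
  MonoidAlgebra.mapRingHom _ (Int.castRingHom ℚ)

end Symplectic

end SpCentre

end

open Polynomial
open scoped DirectSum
universe u
noncomputable section
-- For fixed `n` the modified types that occur are exactly the conjugacy classes of the symplectic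
-- group, so the nonzero sums are the class sums and form a basis of the centre. The structure
-- constant at an element `g` is the number of factorizations `g = a b` with `a`, `b` of the given
-- types. It has to be shown that this number is a polynomial in `q ^ (2n)`, the same for all `n`,
-- for each type of `g`.
--
-- That a modified type determines a conjugacy class in given dimension is Wall's classification,
-- `exists_intertwining_isometry`. Equal elementary divisors give a linear map intertwining the two
-- isometries. The invariant forms induce nondegenerate forms on the multiplicity spaces of `(t ∓ 1)
-- ^ i`, alternating for odd `i` and symmetric for even `i`, and the signs say that these can be
-- matched. Pulling back the second form gives `B (·, T ·)` with `T` self-adjoint, commuting with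
-- `g`, and unipotent on the generalised eigenspaces at `1` and `-1` (`nilpotent_of_agree`). Then `T
-- = S* S` with `S` commuting with `g`, by a norm equation in a finite commutative ring
-- (`exists_adjoint_mul_self`), and `S` repairs the intertwining map.
--
-- Adding an identity summand does not change the modified type (`HasModifiedTypeOf.prodMap_one`),
-- so isometries of spaces of different dimension can be compared inside the orthogonal sum of the
-- spaces. If the independent family `w` spans a space containing the range of `g - 1`, then `g` is
-- `transv B w A` for a unique matrix `A`, and the type of `transv B w A` depends only on `A` and
-- the Gram matrix of `w` (`transv_congr`).
--
-- To count factorizations of `g`, let `U` be the sum of the ranges of `a - 1` and `b - 1`. It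
-- contains the range of `g - 1`, and its dimension is bounded in terms of the types. A pair
-- consisting of a factorization and a basis of `U` extending a fixed basis of the range of `g - 1`
-- amounts to a triple (Gram matrix, matrix of `a`, matrix of `b`), from a finite set independent of
-- the space, and a family of vectors with that Gram matrix. The number of such families is a
-- polynomial in the size of the space (`exists_extension_polynomial`), because the number of
-- one-vector extensions is (`card_extension`). Dividing by the number of bases, for each dimension
-- of `U`, gives the polynomial (`exists_factorization_polynomial`).
--
-- Its values at large powers of `q ^ 2` are cardinalities, hence integers, and periodicity of
-- powers modulo a denominator puts all other values in `ℤ[q ^ 2, q ^ (-2)]`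
-- (`eval_zpow_mem_adjoin`). Finiteness in the third index holds because a product `a b` has `a b -
-- 1` of bounded rank, and few types have bounded rank (`finite_setOf_rank_le`).
namespace SpCentre

/-! ### Cyclic decompositions of `F[t]`-modules and ranks of polynomials in an operator -/

section Generators

variable {F : Type*} [Field F] {V : Type*} [AddCommGroup V] [Module F V]

/-- The vectors `x j` generate `V` as an `F[t]`-module (`t` acting by `φ`), which is the direct sum
of the cyclic modules they generate, and `p j` generates the annihilator of `x j`. -/
structure Generates (φ : V →ₗ[F] V) {ι : Type*} [Fintype ι] (x : ι → V) (p : ι → F[X]) :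
    Prop where
  surj : ∀ v, ∃ y : ι → F[X], ∑ j, aeval φ (y j) (x j) = v
  ker_iff : ∀ y : ι → F[X], ∑ j, aeval φ (y j) (x j) = 0 ↔ ∀ j, p j ∣ y j

theorem generates_of_equiv {φ : V →ₗ[F] V} {ι : Type*} [Fintype ι] {p : ι → F[X]}
    (e : Module.AEval' φ ≃ₗ[F[X]] ⨁ j : ι, F[X] ⧸ Ideal.span {p j}) :
    ∃ x : ι → V, Generates φ x p := by
  classical
  let l : ∀ j : ι, ⨁ j : ι, F[X] ⧸ Ideal.span {p j} := fun j =>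
    DirectSum.lof F[X] ι (fun j => F[X] ⧸ Ideal.span {p j}) j (Ideal.Quotient.mk _ 1)
  have key : ∀ y : ι → F[X],
      (Module.AEval'.of φ) (∑ j, aeval φ (y j) ((Module.AEval'.of φ).symm (e.symm (l j)))) =
        e.symm (∑ j, y j • l j) := by
    intro y
    rw [map_sum, map_sum]
    refine Finset.sum_congr rfl fun j _ => ?_
    rw [map_smul]
    exact Module.AEval.of_aeval_smul _ _ _
  have comp : ∀ (y : ι → F[X]) (j : ι),
      (∑ i, y i • l i) j = Ideal.Quotient.mk (Ideal.span {p j}) (y j) := by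
    intro y j
    have h1 : ∀ i, y i • l i = DirectSum.lof F[X] ι (fun j => F[X] ⧸ Ideal.span {p j}) i
        (Ideal.Quotient.mk _ (y i)) := by
      intro i
      rw [← map_smul]
      congr 1
      rw [← Ideal.Quotient.mkₐ_eq_mk F[X], ← map_smul, smul_eq_mul, mul_one]
    simp only [h1]
    rw [DFinsupp.finsetSum_apply, Finset.sum_eq_single j]
    · exact DirectSum.lof_apply _ _ _
    · intro i _ hij
      exact DFinsupp.single_eq_of_ne hij.symm
    · simp
  refine ⟨fun j => (Module.AEval'.of φ).symm (e.symm (l j)), ⟨fun v => ?_, fun y => ?_⟩⟩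
  · choose y hy using fun j : ι => Ideal.Quotient.mk_surjective ((e (Module.AEval'.of φ v)) j)
    refine ⟨y, (Module.AEval'.of φ).injective ?_⟩
    rw [key, LinearEquiv.symm_apply_eq]
    ext j
    rw [comp, hy]
  · rw [← (Module.AEval'.of φ).map_eq_zero_iff, key, LinearEquiv.map_eq_zero_iff]
    constructor
    · intro h j
      have := congrArg (fun z => z j) h
      simp only [comp] at this
      rwa [DirectSum.zero_apply, Ideal.Quotient.eq_zero_iff_mem, Ideal.mem_span_singleton] at this
    · intro h
      ext j
      rw [comp, DirectSum.zero_apply, Ideal.Quotient.eq_zero_iff_mem, Ideal.mem_span_singleton]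
      exact h j

theorem Generates.equiv {φ : V →ₗ[F] V} {ι : Type*} [Fintype ι] {x : ι → V} {p : ι → F[X]}
    (h : Generates φ x p) :
    Nonempty (Module.AEval' φ ≃ₗ[F[X]] ⨁ j : ι, F[X] ⧸ Ideal.span {p j}) := by
  classical
  let Φ : (ι → F[X]) →ₗ[F[X]] Module.AEval' φ :=
    Fintype.linearCombination F[X] (fun j => Module.AEval'.of φ (x j))
  have hΦ : ∀ y, Φ y = Module.AEval'.of φ (∑ j, aeval φ (y j) (x j)) := by
    intro y
    rw [map_sum]
    rfl
  have hs : Function.Surjective Φ := by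
    intro v
    obtain ⟨y, hy⟩ := h.surj ((Module.AEval'.of φ).symm v)
    exact ⟨y, by rw [hΦ, hy, LinearEquiv.apply_symm_apply]⟩
  have hk : LinearMap.ker Φ = Submodule.pi Set.univ (fun j => Ideal.span {p j}) := by
    ext y
    rw [LinearMap.mem_ker, hΦ, LinearEquiv.map_eq_zero_iff, h.ker_iff]
    simp [Ideal.mem_span_singleton]
  exact ⟨(Φ.quotKerEquivOfSurjective hs).symm ≪≫ₗ Submodule.quotEquivOfEq _ _ hk ≪≫ₗ
    Submodule.quotientPi _ ≪≫ₗ (DirectSum.linearEquivFunOnFintype _ _ _).symm⟩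

/-- The map `L` and the reduction onto the product of the `F[t] / (q j)` have the same kernel, hence
isomorphic images, and each factor has dimension `deg (q j)`. -/
theorem finrank_range_of_ker_iff {ι : Type*} [Fintype ι] {q : ι → F[X]} (hq : ∀ j, q j ≠ 0)
    (L : (ι → F[X]) →ₗ[F] V) (hL : ∀ y, L y = 0 ↔ ∀ j, q j ∣ y j) :
    Module.finrank F (LinearMap.range L) = ∑ j, (q j).natDegree := by
  let M : (ι → F[X]) →ₗ[F] (∀ j, F[X] ⧸ Ideal.span {q j}) :=
    LinearMap.pi fun j => (Ideal.Quotient.mkₐ F (Ideal.span {q j})).toLinearMap ∘ₗ LinearMap.proj j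
  have hM : Function.Surjective M := by
    intro z
    choose y hy using fun j : ι => Ideal.Quotient.mk_surjective (z j)
    exact ⟨y, funext hy⟩
  have hk : LinearMap.ker L = LinearMap.ker M := by
    ext y
    rw [LinearMap.mem_ker, LinearMap.mem_ker, hL]
    constructor
    · intro h
      funext j
      exact Ideal.Quotient.eq_zero_iff_mem.mpr (Ideal.mem_span_singleton.mpr (h j))
    · intro h j
      exact Ideal.mem_span_singleton.mp (Ideal.Quotient.eq_zero_iff_mem.mp (congrFun h j))
  have : ∀ j, Module.Finite F (F[X] ⧸ Ideal.span {q j}) := fun j =>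
    Module.Finite.of_basis (AdjoinRoot.powerBasis (hq j)).basis
  rw [← (L.quotKerEquivRange).finrank_eq, (Submodule.quotEquivOfEq _ _ hk).finrank_eq,
    (M.quotKerEquivOfSurjective hM).finrank_eq, Module.finrank_pi_fintype]
  exact Finset.sum_congr rfl fun j _ => finrank_quotient_span_eq_natDegree

/-- The hypothesis `hqp` says that `q j` generates the annihilator of `f` applied to `x j`, and
these vectors generate the image of `f`. -/
theorem Generates.finrank_range {φ : V →ₗ[F] V} {ι : Type*} [Fintype ι] {x : ι → V}
    {p : ι → F[X]} (h : Generates φ x p) (f : F[X]) {q : ι → F[X]} (hq : ∀ j, q j ≠ 0)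
    (hqp : ∀ j y, p j ∣ f * y ↔ q j ∣ y) :
    Module.finrank F (LinearMap.range (aeval φ f)) = ∑ j, (q j).natDegree := by
  let L : (ι → F[X]) →ₗ[F] V :=
    { toFun := fun y => ∑ j, aeval φ (f * y j) (x j)
      map_add' := fun y z => by
        simp [mul_add, Finset.sum_add_distrib]
      map_smul' := fun c y => by
        simp [Finset.smul_sum] }
  have h1 := finrank_range_of_ker_iff hq L (fun y => by
    rw [← forall_congr' (fun j => hqp j (y j))]
    exact h.ker_iff (fun j => f * y j))
  rw [← h1]
  suffices hr : LinearMap.range (aeval φ f) = LinearMap.range L by rw [hr]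
  ext v
  constructor
  · rintro ⟨w, rfl⟩
    obtain ⟨y, rfl⟩ := h.surj w
    refine ⟨y, ?_⟩
    simp [L, map_sum]
  · rintro ⟨y, rfl⟩
    refine ⟨∑ j, aeval φ (y j) (x j), ?_⟩
    simp [L, map_sum]

end Generators

/-! ### Elementary divisors: existence, uniqueness, total degree -/

section Types

variable {F : Type*} [Field F] {V : Type*} [AddCommGroup V] [Module F V]

theorem Phi.ext_iff' {r s : Phi F} : r = s ↔ r.1 = s.1 := Subtype.ext_iff

theorem Phi.isCoprime {r s : Phi F} (h : r ≠ s) : IsCoprime r.1 s.1 := by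
  refine (r.2.2.1.coprime_iff_not_dvd).mpr fun hd => ?_
  have := r.2.2.1.associated_of_dvd s.2.2.1 hd
  exact h (Phi.ext_iff'.mpr (eq_of_monic_of_associated r.2.1 s.2.1 this))

theorem Phi.natDegree_pos (s : Phi F) : 0 < s.1.natDegree := s.2.2.1.natDegree_pos

theorem HasType.exists_generates {φ : V →ₗ[F] V} {τ : Phi F →₀ Multiset ℕ+} (h : HasType φ τ) :
    ∃ (k : ℕ) (r : Fin k → Phi F) (e : Fin k → ℕ+) (x : Fin k → V),
      Generates φ x (fun j => (r j).1 ^ (e j : ℕ)) ∧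
      ∀ (s : Phi F) (i : ℕ+), (τ s).count i = Nat.card {j : Fin k // r j = s ∧ e j = i} := by
  obtain ⟨k, r, e, ⟨l⟩, hc⟩ := h
  obtain ⟨x, hx⟩ := generates_of_equiv (p := fun j => (r j).1 ^ (e j : ℕ)) l
  exact ⟨k, r, e, x, hx, hc⟩

open Classical in
-- Multiplication by `s ^ i` has image `F[t] / (s ^ (e - i))` on a summand `F[t] / (s ^ e)`,
-- truncated subtraction covering `i ≥ e`, and is bijective on the summands at other primes by
-- coprimality.
theorem Generates.finrank_range_pow {φ : V →ₗ[F] V} {ι : Type*} [Fintype ι] {x : ι → V}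
    {r : ι → Phi F} {e : ι → ℕ} (h : Generates φ x (fun j => (r j).1 ^ (e j : ℕ)))
    (s : Phi F) (i : ℕ) :
    Module.finrank F (LinearMap.range (aeval φ (s.1 ^ i))) =
      ∑ j, if r j = s then s.1.natDegree * (e j - i) else (r j).1.natDegree * e j := by
  rw [h.finrank_range (s.1 ^ i) (q := fun j => if r j = s then s.1 ^ (e j - i) else (r j).1 ^ (e j))]
  · refine Finset.sum_congr rfl fun j _ => ?_
    split_ifs
    · rw [natDegree_pow, mul_comm]
    · rw [natDegree_pow, mul_comm]
  · intro j
    split_ifs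
    · exact pow_ne_zero _ s.2.1.ne_zero
    · exact pow_ne_zero _ (r j).2.1.ne_zero
  · intro j y
    split_ifs with hj
    · rw [hj]
      rcases le_total i (e j) with hi | hi
      · nth_rewrite 1 [← Nat.add_sub_of_le hi]
        rw [pow_add]
        exact mul_dvd_mul_iff_left (pow_ne_zero _ s.2.1.ne_zero)
      · rw [Nat.sub_eq_zero_of_le hi, pow_zero]
        exact ⟨fun _ => one_dvd _, fun _ => (pow_dvd_pow _ hi).mul_right _⟩
    · exact ⟨fun hd => ((Phi.isCoprime hj).pow).dvd_of_dvd_mul_left hd, fun hd => hd.mul_left _⟩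

/-- The multiplicity of `r ^ i` as an elementary divisor is a second difference of ranks. -/
theorem HasType.count_eq {φ : V →ₗ[F] V} {τ : Phi F →₀ Multiset ℕ+} (h : HasType φ τ)
    (s : Phi F) (i : ℕ+) :
    (Module.finrank F (LinearMap.range (aeval φ (s.1 ^ ((i : ℕ) - 1)))) : ℤ) -
      2 * Module.finrank F (LinearMap.range (aeval φ (s.1 ^ (i : ℕ)))) +
      Module.finrank F (LinearMap.range (aeval φ (s.1 ^ ((i : ℕ) + 1)))) =
    s.1.natDegree * (τ s).count i := by
  classical
  obtain ⟨k, r, e, x, hx, hc⟩ := h.exists_generates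
  rw [hc, Nat.card_eq_fintype_card, Fintype.card_subtype, Finset.card_filter]
  simp only [hx.finrank_range_pow]
  push_cast
  rw [Finset.mul_sum, Finset.mul_sum, ← Finset.sum_sub_distrib, ← Finset.sum_add_distrib]
  -- Summand by summand: the truncated difference `e - i`, as a function of `i`, has second
  -- difference `1` at `i = e` and `0` at other positive `i`, and the constant contributions of
  -- other primes cancel.
  refine Finset.sum_congr rfl fun j _ => ?_
  have hi := i.pos
  by_cases hj : r j = s
  · simp only [hj, if_true, true_and]
    by_cases he : e j = i
    · rw [if_pos he, he]
      have h1 : (i : ℕ) - (i - 1) = 1 := by omega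
      have h2 : (i : ℕ) - (i + 1) = 0 := by omega
      rw [h1, h2]
      simp
    · rw [if_neg he]
      have he' : (e j : ℕ) ≠ i := fun h => he (PNat.coe_injective h)
      rcases lt_or_gt_of_ne he' with h0 | h0
      · have h1 : (e j : ℕ) - (i - 1) = 0 := by omega
        have h2 : (e j : ℕ) - i = 0 := by omega
        have h3 : (e j : ℕ) - (i + 1) = 0 := by omega
        rw [h1, h2, h3]; simp
      · obtain ⟨m, hm⟩ : ∃ m, (e j : ℕ) = i + 1 + m := ⟨e j - (i + 1), by omega⟩
        have h1 : (e j : ℕ) - (i - 1) = m + 2 := by omega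
        have h2 : (e j : ℕ) - i = m + 1 := by omega
        have h3 : (e j : ℕ) - (i + 1) = m := by omega
        rw [h1, h2, h3]; push_cast; ring
  · simp only [hj, if_false, false_and]; ring

theorem HasType.unique {φ : V →ₗ[F] V} {τ τ' : Phi F →₀ Multiset ℕ+} (h : HasType φ τ)
    (h' : HasType φ τ') : τ = τ' := by
  ext s i
  have h1 := (h.count_eq s i).symm.trans (h'.count_eq s i)
  have := mul_left_cancel₀ (by exact_mod_cast s.natDegree_pos.ne') h1
  exact_mod_cast this

/-- Serves to recover the multiplicity of the part `1` at `t - 1` from the dimension; this is what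
the modified type forgets. -/
theorem HasType.finrank_eq {φ : V →ₗ[F] V} {τ : Phi F →₀ Multiset ℕ+} (h : HasType φ τ) :
    Module.finrank F V = τ.sum fun s m => s.1.natDegree * (m.map (fun i : ℕ+ => (i : ℕ))).sum := by
  classical
  obtain ⟨k, r, e, x, hx, hc⟩ := h.exists_generates
  have hτ : τ = ∑ j, Finsupp.single (r j) {e j} := by
    ext s i
    rw [hc, Finsupp.finsetSum_apply, Multiset.count_sum', Nat.card_eq_fintype_card,
      Fintype.card_subtype, Finset.card_filter]
    refine Finset.sum_congr rfl fun j _ => ?_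
    rw [Finsupp.single_apply]
    by_cases hj : r j = s
    · simp [hj, Multiset.count_singleton, eq_comm]
    · simp [hj]
  rw [hτ, ← Finsupp.sum_finsetSum_index (by simp) (by intros; simp [mul_add])]
  simp only [Finsupp.sum_single_index, Multiset.map_zero, Multiset.sum_zero, mul_zero,
    Multiset.map_singleton, Multiset.sum_singleton]
  have := hx.finrank_range (1 : F[X]) (q := fun j => (r j).1 ^ (e j : ℕ))
    (fun j => pow_ne_zero _ (r j).2.1.ne_zero) (fun j y => by rw [one_mul])
  rw [map_one, LinearMap.range_eq_top.mpr (fun v => ⟨v, rfl⟩), finrank_top] at this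
  rw [this]
  exact Finset.sum_congr rfl fun j _ => by rw [natDegree_pow, mul_comm]

theorem exists_hasType [FiniteDimensional F V] {φ : V →ₗ[F] V} (hφ : Function.Injective φ) :
    ∃ τ, HasType φ τ := by
  classical
  obtain ⟨ι, _, p, hp, e, ⟨l⟩⟩ := Module.equiv_directSum_of_isTorsion
    (R := F[X]) (M := Module.AEval' φ) (Module.AEval.isTorsion_of_finiteDimensional F V φ)
  obtain ⟨x, hx⟩ := generates_of_equiv (p := fun j => p j ^ e j) l
  -- If `p j` were associated to `t`, then `t` would kill the nonzero multiple `u * p j ^ (e j - 1)`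
  -- of `x j`, against injectivity of `φ`.
  have hX : ∀ j, e j ≠ 0 → normalize (p j) ≠ X := by
    intro j hj hX
    have h1 : p j ∣ X := by
      rw [← hX]; exact (dvd_normalize_iff).mpr dvd_rfl
    have h2 : X ∣ p j := by
      rw [← hX]; exact normalize_dvd_iff.mpr dvd_rfl
    obtain ⟨u, hu⟩ := h2
    have h3 := hx.ker_iff (Pi.single j (u * p j ^ (e j - 1)))
    have h4 := hx.ker_iff (Pi.single j (p j ^ e j))
    have hs : ∀ f : F[X], ∑ i, aeval φ ((Pi.single j f : ι → F[X]) i) (x i) = aeval φ f (x j) := by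
      intro f
      rw [Finset.sum_eq_single j]
      · simp
      · intro i _ hij; simp [Pi.single_eq_of_ne hij]
      · simp
    rw [hs] at h3 h4
    have h5 : aeval φ (p j ^ e j) (x j) = 0 := h4.mpr (fun i => by
      by_cases hij : i = j
      · subst hij; simp
      · simp [Pi.single_eq_of_ne hij])
    have h6 : p j ^ e j = X * (u * p j ^ (e j - 1)) := by
      rw [← mul_assoc, ← hu, ← pow_succ', Nat.sub_add_cancel (Nat.pos_of_ne_zero hj)]
    rw [h6, map_mul, aeval_X] at h5
    have h7 : aeval φ (u * p j ^ (e j - 1)) (x j) = 0 :=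
      hφ (by rw [map_zero]; exact h5)
    have h8 := h3.mp h7 j
    rw [Pi.single_eq_same, h6] at h8
    have hne : u * p j ^ (e j - 1) ≠ 0 := by
      intro h0
      rw [h0, mul_zero] at h6
      exact pow_ne_zero _ (hp j).ne_zero h6
    obtain ⟨c, hc⟩ := h8
    have h9 : (X : F[X]) * c = 1 := by
      refine mul_right_cancel₀ hne ?_
      rw [one_mul]; nth_rewrite 2 [hc]; ring
    exact not_isUnit_X (IsUnit.of_mul_eq_one _ h9)
  -- The structure theorem allows exponents `0`, that is, zero summands. They are dropped, since
  -- parts are positive, and the primes are made monic.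
  let J := {j : ι // e j ≠ 0}
  let r : J → Phi F := fun j => ⟨normalize (p j.1), monic_normalize (hp j.1).ne_zero,
    (associated_normalize (p j.1)).irreducible (hp j.1), hX j.1 j.2⟩
  have hdvd : ∀ (j : J) (y : F[X]), (r j).1 ^ (e j.1) ∣ y ↔ p j.1 ^ e j.1 ∣ y := fun j y =>
    ((normalize_associated (p j.1)).pow_pow).dvd_iff_dvd_left
  have hg : Generates φ (fun j : J => x j.1) (fun j : J => (r j).1 ^ (e j.1)) := by
    have hx0 : ∀ j, e j = 0 → x j = 0 := by
      intro j hj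
      have := (hx.ker_iff (Pi.single j 1)).mpr (fun i => by
        by_cases hij : i = j
        · subst hij; simp [hj]
        · simp [Pi.single_eq_of_ne hij])
      rw [Finset.sum_eq_single j] at this
      · simpa using this
      · intro i _ hij; simp [Pi.single_eq_of_ne hij]
      · simp
    have hsum : ∀ y : ι → F[X], ∑ j, aeval φ (y j) (x j) = ∑ j : J, aeval φ (y j.1) (x j.1) := by
      intro y
      refine (Fintype.sum_subtype_add_sum_subtype (fun j => e j ≠ 0)
        (fun j => aeval φ (y j) (x j))).symm.trans ?_
      rw [add_eq_left]
      refine Finset.sum_eq_zero fun j _ => ?_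
      rw [hx0 j.1 (not_not.mp j.2), map_zero]
    refine ⟨fun v => ?_, fun y => ?_⟩
    · obtain ⟨y, hy⟩ := hx.surj v
      exact ⟨fun j => y j.1, by rw [← hy, hsum]⟩
    · have := hsum (fun i => if h : e i ≠ 0 then y ⟨i, h⟩ else 0)
      have h2 : ∀ j : J, (if h : e j.1 ≠ 0 then y ⟨j.1, h⟩ else 0) = y j := fun j => by
        rw [dif_pos j.2]
      simp only [h2] at this
      rw [← this, hx.ker_iff]
      constructor
      · intro h j
        rw [hdvd, ← h2 j]; exact h j.1
      · intro h j
        by_cases hj : e j ≠ 0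
        · rw [dif_pos hj, ← hdvd ⟨j, hj⟩]; exact h ⟨j, hj⟩
        · rw [dif_neg hj]; exact dvd_zero _
  let σ := (Fintype.equivFin J).symm
  have hg' : Generates φ (fun j => x (σ j).1) (fun j => (r (σ j)).1 ^ (e (σ j).1)) := by
    refine ⟨fun v => ?_, fun y => ?_⟩
    · obtain ⟨y, hy⟩ := hg.surj v
      refine ⟨fun j => y (σ j), ?_⟩
      rw [← hy]
      exact Equiv.sum_comp σ (fun j => aeval φ (y j) (x j.1))
    · have := hg.ker_iff (fun j => y (σ.symm j))
      rw [← Equiv.sum_comp σ] at this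
      simp only [Equiv.symm_apply_apply] at this
      rw [this]
      exact ⟨fun h j => by simpa using h (σ j), fun h j => by simpa using h (σ.symm j)⟩
  let e' : Fin (Fintype.card J) → ℕ+ := fun j => ⟨e (σ j).1, Nat.pos_of_ne_zero (σ j).2⟩
  refine ⟨∑ j, Finsupp.single (r (σ j)) {e' j}, Fintype.card J, fun j => r (σ j), e', hg'.equiv, ?_⟩
  intro s i
  rw [Finsupp.finsetSum_apply, Multiset.count_sum', Nat.card_eq_fintype_card]
  refine Eq.trans ?_ (Fintype.card_subtype _).symm
  rw [Finset.card_filter]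
  refine Finset.sum_congr rfl fun j _ => ?_
  rw [Finsupp.single_apply]
  by_cases hj : r (σ j) = s
  · simp [hj, Multiset.count_singleton, eq_comm]
  · simp [hj]

end Types

/-! ### Symplectic spaces over finite fields: counting extensions, and Witt's theorem -/

section Witt

variable {F : Type*} [Field F] {V : Type*} [AddCommGroup V] [Module F V]
  {V' : Type*} [AddCommGroup V'] [Module F V']

/-- `B` is a symplectic form: alternating and nondegenerate. -/
structure IsSymplectic (B : LinearMap.BilinForm F V) : Prop where
  alt : ∀ x, B x x = 0
  nondeg : ∀ x, (∀ y, B x y = 0) → x = 0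

namespace IsSymplectic

variable {B : LinearMap.BilinForm F V} {B' : LinearMap.BilinForm F V'}

theorem neg (hB : IsSymplectic B) (x y : V) : B y x = -B x y := by
  have h := hB.alt (x + y)
  simp only [map_add, LinearMap.add_apply, hB.alt, zero_add, add_zero] at h
  exact eq_neg_of_add_eq_zero_left h

theorem nondeg_right (hB : IsSymplectic B) (y : V) (h : ∀ x, B x y = 0) : y = 0 :=
  hB.nondeg y fun x => by rw [hB.neg, h, neg_zero]

theorem ext_right (hB : IsSymplectic B) {y z : V} (h : ∀ x, B x y = B x z) : y = z := by
  rw [← sub_eq_zero]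
  exact hB.nondeg_right _ fun x => by rw [map_sub, h, sub_self]

/-- By nondegeneracy the functionals `B (w i)` are independent, and a linear form vanishing on the
image would be a linear relation between them. -/
theorem pairing_surjective [FiniteDimensional F V] (hB : IsSymplectic B) {ι : Type*} [Finite ι]
    {w : ι → V} (hw : LinearIndependent F w) :
    Function.Surjective (LinearMap.pi fun i => B (w i) : V →ₗ[F] (ι → F)) := by
  have hinj : Function.Injective B := by
    rw [injective_iff_map_eq_zero]
    intro x hx
    exact hB.nondeg x fun y => by rw [hx]; rfl
  have hd : LinearIndependent F fun i => B (w i) :=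
    hw.map' B (LinearMap.ker_eq_bot.mpr hinj)
  have := Fintype.ofFinite ι
  classical
  rw [← LinearMap.range_eq_top]
  by_contra hne
  obtain ⟨f, hf, hr⟩ := Submodule.exists_le_ker_of_lt_top _ (lt_top_iff_ne_top.mpr hne)
  refine hf ?_
  have hz : ∑ i, f (Pi.single i 1) • B (w i) = 0 := by
    ext x
    have : f (LinearMap.pi (fun i => B (w i)) x) = 0 := hr ⟨x, rfl⟩
    rw [LinearMap.pi_apply_eq_sum_univ] at this
    simp only [LinearMap.pi_apply, smul_eq_mul] at this
    simp only [LinearMap.sum_apply, LinearMap.smul_apply, smul_eq_mul, LinearMap.zero_apply]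
    rw [← this]
    refine Finset.sum_congr rfl fun i _ => ?_
    rw [mul_comm]
    congr 3
    ext j; simp [Pi.single_apply, eq_comm]
  have h0 := Fintype.linearIndependent_iff.mp hd _ hz
  refine LinearMap.pi_ext' fun i => LinearMap.ext_ring ?_
  simpa using h0 i

theorem card_fiber_mul [Finite F] [FiniteDimensional F V] (hB : IsSymplectic B) {ι : Type*}
    [Finite ι] {w : ι → V} (hw : LinearIndependent F w) (c : ι → F) :
    Nat.card {x : V // ∀ i, B (w i) x = c i} * Nat.card F ^ Nat.card ι = Nat.card V := by
  have : Finite V := Module.finite_of_finite F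
  have hs := hB.pairing_surjective hw
  set β : V →ₗ[F] (ι → F) := LinearMap.pi fun i => B (w i) with hβ
  obtain ⟨x₀, hx₀⟩ := hs c
  have e : {x : V // ∀ i, B (w i) x = c i} ≃ LinearMap.ker β :=
    { toFun := fun x => ⟨x.1 - x₀, by
        rw [LinearMap.mem_ker, map_sub, hx₀, sub_eq_zero]; exact funext x.2⟩
      invFun := fun x => ⟨x.1 + x₀, fun i => by
        have := congrFun (show β (x.1 + x₀) = c by
          rw [map_add, LinearMap.mem_ker.mp x.2, hx₀, zero_add]) i
        exact this⟩
      left_inv := fun x => by simp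
      right_inv := fun x => by simp }
  rw [Nat.card_congr e, Submodule.card_eq_card_quotient_mul_card (LinearMap.ker β),
    Nat.card_congr (β.quotKerEquivOfSurjective hs).toEquiv, Nat.card_fun, mul_comm]

/-- The solutions of `B (w i) x = c i` form a coset of a subspace of codimension `|ι|`, and those
inside the span of `w` solve a linear system whose matrix is the Gram matrix. So the number of
solutions outside the span depends only on `|V|`, the Gram matrix and `c`. Both Witt's theorem and
the polynomiality of the count of families rest on this. -/
theorem card_extension [Finite F] [FiniteDimensional F V] (hB : IsSymplectic B) {ι : Type*}
    [Fintype ι] {w : ι → V} (hw : LinearIndependent F w) (c : ι → F) :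
    (Nat.card {x : V // (∀ i, B (w i) x = c i) ∧ x ∉ Submodule.span F (Set.range w)} +
      Nat.card {y : ι → F // ∀ i, ∑ j, y j * B (w i) (w j) = c i}) * Nat.card F ^ Nat.card ι =
    Nat.card V := by
  have : Finite V := Module.finite_of_finite F
  rw [← hB.card_fiber_mul hw c]
  congr 1
  classical
  have e : {y : ι → F // ∀ i, ∑ j, y j * B (w i) (w j) = c i} ≃
      {x : V // (∀ i, B (w i) x = c i) ∧ x ∈ Submodule.span F (Set.range w)} :=
    Equiv.ofBijective (fun y => ⟨∑ j, y.1 j • w j, fun i => by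
        rw [map_sum, ← y.2 i]; simp, Submodule.sum_mem _ fun j _ =>
          Submodule.smul_mem _ _ (Submodule.subset_span ⟨j, rfl⟩)⟩) <| by
      constructor
      · intro y z h
        have h1 : ∑ j, y.1 j • w j = ∑ j, z.1 j • w j := congrArg Subtype.val h
        exact Subtype.ext (hw.fintypeLinearCombination_injective h1)
      · rintro ⟨x, hx, hxs⟩
        obtain ⟨y, rfl⟩ := (Submodule.mem_span_range_iff_exists_fun F).mp hxs
        exact ⟨⟨y, fun i => by rw [← hx i, map_sum]; simp⟩, rfl⟩
  rw [Nat.card_congr e, add_comm]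
  have e2 := Equiv.sumCompl (fun x : {x : V // ∀ i, B (w i) x = c i} =>
    x.1 ∈ Submodule.span F (Set.range w))
  rw [← Nat.card_congr e2, Nat.card_sum]
  congr 1
  · exact Nat.card_congr (Equiv.subtypeSubtypeEquivSubtypeInter _ _).symm
  · exact Nat.card_congr (Equiv.subtypeSubtypeEquivSubtypeInter (fun x => ∀ i, B (w i) x = c i)
      (fun x => x ∉ Submodule.span F (Set.range w))).symm

theorem gram_snoc (hB : IsSymplectic B) (hB' : IsSymplectic B') {s : ℕ} {w : Fin s → V}
    {w' : Fin s → V'} (hG : ∀ i j, B (w i) (w j) = B' (w' i) (w' j)) {x : V} {x' : V'}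
    (hx : ∀ i, B (w i) x = B' (w' i) x') (i j : Fin (s + 1)) :
    B ((Fin.snoc w x : Fin (s + 1) → V) i) ((Fin.snoc w x : Fin (s + 1) → V) j) =
      B' ((Fin.snoc w' x' : Fin (s + 1) → V') i) ((Fin.snoc w' x' : Fin (s + 1) → V') j) := by
  refine Fin.lastCases ?_ (fun i => ?_) i <;> refine Fin.lastCases ?_ (fun j => ?_) j
  · simp only [Fin.snoc_last, hB.alt, hB'.alt]
  · simp only [Fin.snoc_last, Fin.snoc_castSucc]
    rw [hB.neg, hB'.neg, hx]
  · simp only [Fin.snoc_last, Fin.snoc_castSucc, hx]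
  · simp only [Fin.snoc_castSucc, hG]

/-- **Witt's theorem** for symplectic spaces over finite fields. -/
theorem exists_isometry [Finite F] [FiniteDimensional F V] [FiniteDimensional F V']
    (hB : IsSymplectic B) (hB' : IsSymplectic B')
    (hd : Module.finrank F V = Module.finrank F V') {s : ℕ} {w : Fin s → V} {w' : Fin s → V'}
    (hw : LinearIndependent F w) (hw' : LinearIndependent F w')
    (hG : ∀ i j, B (w i) (w j) = B' (w' i) (w' j)) :
    ∃ f : V ≃ₗ[F] V', (∀ x y, B' (f x) (f y) = B x y) ∧ ∀ i, f (w i) = w' i := by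
  have : Finite V := Module.finite_of_finite F
  have : Finite V' := Module.finite_of_finite F
  obtain ⟨k, hk⟩ : ∃ k, s + k = Module.finrank F V :=
    ⟨_, Nat.add_sub_of_le (by simpa using hw.fintype_card_le_finrank)⟩
  induction k generalizing s with
  | zero =>
    let b := Module.Basis.mk hw (hw.span_eq_top_of_card_eq_finrank' (by simpa using hk)).ge
    let b' := Module.Basis.mk hw' (hw'.span_eq_top_of_card_eq_finrank' (by simpa [← hd] using hk)).ge
    have hb : ∀ i, b i = w i := fun i => by simp [b]
    have hb' : ∀ i, b' i = w' i := fun i => by simp [b']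
    let f := b.equiv b' (Equiv.refl _)
    have hf : ∀ i, f (w i) = w' i := fun i => by
      rw [← hb, ← hb']; simp [f]
    refine ⟨f, fun x y => ?_, hf⟩
    have : (B'.compl₁₂ f.toLinearMap f.toLinearMap) = B :=
      b.ext fun i => b.ext fun j => by
        rw [LinearMap.compl₁₂_apply, hb, hb, hG]
        change B' (f _) (f _) = _
        rw [hf, hf]
    exact LinearMap.congr_fun₂ this x y
  | succ k ih =>
    obtain ⟨x, hx⟩ : ∃ x, x ∉ Submodule.span F (Set.range w) := by
      by_contra! h
      have h1 : Submodule.span F (Set.range w) = ⊤ := by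
        rw [eq_top_iff]; exact fun x _ => h x
      have h2 := finrank_span_eq_card hw
      rw [h1, finrank_top, Fintype.card_fin] at h2
      omega
    -- The partial isometry is extended one vector at a time. The number of admissible new vectors
    -- is the same in `V` and in `V'`, and positive in `V` because of `x`, so some `x'` exists.
    have h1 := hB.card_extension hw (fun i => B (w i) x)
    have h2 := hB'.card_extension hw' (fun i => B (w i) x)
    simp only [hG] at h1
    have hcard : Nat.card V = Nat.card V' :=
      Nat.card_congr (LinearEquiv.ofFinrankEq V V' hd).toEquiv
    rw [hcard, ← h2] at h1
    have hq : Nat.card F ^ Nat.card (Fin s) ≠ 0 := pow_ne_zero _ Nat.card_pos.ne'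
    have h3 := Nat.add_right_cancel (mul_right_cancel₀ hq h1)
    have h4 : 0 < Nat.card {z : V // (∀ i, B (w i) z = B (w i) x) ∧
        z ∉ Submodule.span F (Set.range w)} :=
      have : Nonempty {z : V // (∀ i, B (w i) z = B (w i) x) ∧
        z ∉ Submodule.span F (Set.range w)} := ⟨⟨x, fun _ => rfl, hx⟩⟩
      Nat.card_pos
    rw [h3] at h4
    obtain ⟨x', hx', hx's⟩ := (Nat.card_pos_iff.mp h4).1
    obtain ⟨f, hf, hfw⟩ := ih (w := (Fin.snoc w x : Fin (s + 1) → V))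
      (w' := (Fin.snoc w' x' : Fin (s + 1) → V')) (hw.finSnoc hx) (hw'.finSnoc hx's)
      (hB.gram_snoc hB' hG fun i => (hx' i).symm) (by omega)
    refine ⟨f, hf, fun i => ?_⟩
    simpa using hfw i.castSucc

end IsSymplectic

end Witt

/-! ### Norm equations in finite commutative rings -/

section NormEquation

/-- Newton's method for `X ^ 2 - u` starting at `1`: the value there is nilpotent and the derivative
`2` is a unit. -/
theorem exists_sq_of_isNilpotent {R : Type*} [CommRing R] (h2 : IsUnit (2 : R)) {u : R}
    (hu : IsNilpotent (1 - u)) : ∃ c, c ^ 2 = u := by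
  obtain ⟨c, ⟨_, hc⟩, _⟩ := existsUnique_nilpotent_sub_and_aeval_eq_zero (R := R)
    (P := X ^ 2 - C u) (x := (1 : R)) (by simpa using hu) (by simpa [derivative_X_pow, one_add_one_eq_two] using h2)
  exact ⟨c, by simpa [sub_eq_zero] using hc⟩

/-- Pigeonhole: with `q` elements in `K`, the values of `a ^ 2` and of `T + D * b ^ 2` form two sets
of `(q + 1) / 2` elements, which must meet. -/
theorem _root_.FiniteField.exists_sq_sub_mul_sq {K : Type*} [Field K] [Finite K] (h2 : (2 : K) ≠ 0)
    {D : K} (hD : D ≠ 0) (T : K) : ∃ a b : K, a ^ 2 - D * b ^ 2 = T := by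
  have := Fintype.ofFinite K
  have hodd : Fintype.card K % 2 = 1 :=
    FiniteField.odd_card_of_char_ne_two fun h => h2 (by
      have := ringChar.Nat.cast_ringChar (R := K)
      rw [h] at this
      exact_mod_cast this)
  obtain ⟨a, b, h⟩ := FiniteField.exists_root_sum_quadratic (f := (X ^ 2 : K[X]))
    (g := C (-D) * X ^ 2 + C 0 * X + C (-T)) (degree_X_pow 2)
    (degree_quadratic (neg_ne_zero.mpr hD)) hodd
  refine ⟨a, b, ?_⟩
  simp at h
  linear_combination h

/-- A norm equation for a quadratic extension of a finite commutative ring. -/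
theorem exists_sq_sub_mul_sq {R : Type*} [CommRing R] [Finite R] (h2 : IsUnit (2 : R)) {D T : R}
    (hT : IsUnit T) (h : ∀ m : Ideal R, m.IsMaximal → D ∈ m → T - 1 ∈ m) :
    ∃ a b : R, a ^ 2 - D * b ^ 2 = T := by
  -- The equation is first solved in each residue field. If `D` vanishes there, then `T` becomes `1`
  -- by hypothesis and `(1, 0)` is a solution.
  have hloc : ∀ m : MaximalSpectrum R, ∃ z : (R ⧸ m.asIdeal) × (R ⧸ m.asIdeal),
      z.1 ^ 2 - Ideal.Quotient.mk m.asIdeal D * z.2 ^ 2 = Ideal.Quotient.mk m.asIdeal T := by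
    intro m
    have hm := m.isMaximal
    by_cases hD : D ∈ m.asIdeal
    · refine ⟨(1, 0), ?_⟩
      have := h _ m.isMaximal hD
      rw [← Ideal.Quotient.eq_zero_iff_mem, map_sub, map_one, sub_eq_zero] at this
      simp [this]
    · have h2' : IsUnit (2 : R ⧸ m.asIdeal) := by
        have := h2.map (Ideal.Quotient.mk m.asIdeal)
        rwa [map_ofNat] at this
      let _ := Ideal.Quotient.field m.asIdeal
      have : Finite (R ⧸ m.asIdeal) := Quotient.finite _
      obtain ⟨a, b, hab⟩ := FiniteField.exists_sq_sub_mul_sq h2'.ne_zero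
        (D := Ideal.Quotient.mk m.asIdeal D) (fun h0 => hD (Ideal.Quotient.eq_zero_iff_mem.mp h0))
        (Ideal.Quotient.mk m.asIdeal T)
      exact ⟨(a, b), hab⟩
  choose z hz using hloc
  -- Chinese remainder theorem: a finite ring modulo its nilradical is the product of its residue
  -- fields.
  have hlift : ∀ y : (∀ m : MaximalSpectrum R, R ⧸ m.asIdeal),
      ∃ a : R, ∀ m, Ideal.Quotient.mk m.asIdeal a = y m := by
    intro y
    obtain ⟨a', ha'⟩ := (IsArtinianRing.quotNilradicalEquivPi R).surjective y
    obtain ⟨a, rfl⟩ := Ideal.Quotient.mk_surjective a'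
    refine ⟨a, fun m => ?_⟩
    rw [← ha']
    rfl
  obtain ⟨a, ha⟩ := hlift fun m => (z m).1
  obtain ⟨b, hb⟩ := hlift fun m => (z m).2
  obtain ⟨t, rfl⟩ := hT
  -- The lifted solution is correct modulo nilpotents, so `a ^ 2 - D * b ^ 2 = T * c ^ 2` with `c` a
  -- unit, and dividing `a` and `b` by `c` corrects it.
  have hnil : IsNilpotent (1 - (↑t⁻¹ * (a ^ 2 - D * b ^ 2) : R)) := by
    rw [← mem_nilradical, IsArtinianRing.nilradical_eq_iInf, Ideal.mem_iInf]
    intro m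
    rw [← Ideal.Quotient.eq_zero_iff_mem, map_sub, map_mul, map_sub, map_mul, map_pow, map_pow,
      ha, hb, hz, ← map_mul, Units.inv_mul, sub_self]
  obtain ⟨c, hc⟩ := exists_sq_of_isNilpotent h2 hnil
  have hcu : IsUnit c := by
    rw [← isUnit_pow_iff (two_ne_zero), hc]
    simpa using hnil.isUnit_one_sub
  obtain ⟨c, rfl⟩ := hcu
  refine ⟨a * ↑c⁻¹, b * ↑c⁻¹, ?_⟩
  have h3 : a ^ 2 - D * b ^ 2 = t * c ^ 2 := by
    rw [hc, Units.mul_inv_cancel_left]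
  have h4 : (c : R) * ↑c⁻¹ = 1 := c.mul_inv
  calc (a * ↑c⁻¹) ^ 2 - D * (b * ↑c⁻¹) ^ 2 = (a ^ 2 - D * b ^ 2) * (↑c⁻¹ : R) ^ 2 := by ring
    _ = t * (c * ↑c⁻¹ : R) ^ 2 := by rw [h3]; ring
    _ = t := by rw [h4]; ring

end NormEquation

/-! ### Self-adjoint automorphisms in the centraliser of an isometry -/

section SelfAdjoint

variable {F : Type*} [Field F] [Finite F] {V : Type*} [AddCommGroup V] [Module F V]
  [FiniteDimensional F V]

/-- A self-adjoint automorphism commuting with an isometry `g` is of the form `S* S` with `S`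
commuting with `g`, provided that it is unipotent where `g - g⁻¹` is nilpotent. -/
theorem IsSymplectic.exists_adjoint_mul_self (hF : (2 : F) ≠ 0) {B : LinearMap.BilinForm F V}
    (hB : IsSymplectic B) {g g' T : Module.End F V} (hg : ∀ x y, B (g x) (g y) = B x y)
    (hgg' : g * g' = 1) (hg'g : g' * g = 1) (hT : ∀ x y, B (T x) y = B x (T y))
    (hTg : Commute T g) (hTu : IsUnit T) (a : ℕ)
    (hTn : ∀ (k : ℕ) (v : V), (((g - g') ^ 2) ^ k) v = 0 → ((T - 1) ^ a) v = 0) :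
    ∃ S : V ≃ₗ[F] V, (∀ x, S (g x) = g (S x)) ∧ ∀ x y, B (S x) (S y) = B x (T y) := by
  have hgadj : ∀ x y, B (g x) y = B x (g' y) := fun x y => by
    rw [← hg x (g' y), ← Module.End.mul_apply, hgg', Module.End.one_apply]
  have hg'adj : ∀ x y, B (g' x) y = B x (g y) := fun x y => by
    rw [← hg (g' x) y, ← Module.End.mul_apply, hgg', Module.End.one_apply]
  have hTg' : Commute T g' := by
    have h1 : g' * (T * g) * g' = g' * (g * T) * g' := by rw [hTg.eq]
    have h2 : g' * (T * g) * g' = g' * T := by rw [mul_assoc, mul_assoc, hgg', mul_one]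
    have h3 : g' * (g * T) * g' = T * g' := by rw [← mul_assoc, hg'g, one_mul]
    rw [h2, h3] at h1
    exact h1.symm
  have hgg'c : Commute g g' := by rw [commute_iff_eq, hgg', hg'g]
  -- Since `c = g + g⁻¹` and `T` are commuting self-adjoint operators, all of `R = F[c, T]` is
  -- self-adjoint, whereas `δ = g - g⁻¹` is skew-adjoint and `δ ^ 2 = c ^ 2 - 4` lies in `R`. For
  -- `p, r ∈ R` the operator `S = p + r * δ` has adjoint `p - δ * r`, and `S* S = p ^ 2 - δ ^ 2 * r
  -- ^ 2`. So `S* S = T` is a norm equation in the finite commutative ring `R`.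
  set c := g + g' with hc
  have hcomm : ∀ x ∈ ({c, T} : Set (Module.End F V)), ∀ y ∈ ({c, T} : Set (Module.End F V)),
      x * y = y * x := by
    have : Commute T c := hTg.add_right hTg'
    rintro x (rfl | rfl) y (rfl | rfl)
    · rfl
    · exact this.symm
    · exact this
    · rfl
  let R := Algebra.adjoin F ({c, T} : Set (Module.End F V))
  let _ : CommRing R :=
    { (inferInstance : Ring R) with
      mul_comm := (Algebra.isMulCommutative_adjoin F hcomm).is_comm.comm }
  have : Finite (Module.End F V) := Module.finite_of_finite F
  have : Finite R := Subtype.finite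
  have hRcomm : ∀ x ∈ R, ∀ y ∈ R, x * y = y * x := fun x hx y hy =>
    congrArg Subtype.val (mul_comm (⟨x, hx⟩ : R) ⟨y, hy⟩)
  have hRg : ∀ x ∈ R, Commute x g := by
    intro x hx
    have hle : R ≤ Subalgebra.centralizer F {g} := by
      refine Algebra.adjoin_le ?_
      rintro y (rfl | rfl)
      · rintro z rfl
        exact (Commute.refl z).add_right hgg'c
      · rintro z rfl
        exact hTg.symm
    exact (hle hx g rfl).symm
  have hRg' : ∀ x ∈ R, Commute x g' := by
    intro x hx
    have hle : R ≤ Subalgebra.centralizer F {g'} := by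
      refine Algebra.adjoin_le ?_
      rintro y (rfl | rfl)
      · rintro z rfl
        exact hgg'c.symm.add_right (Commute.refl z)
      · rintro z rfl
        exact hTg'.symm
    exact (hle hx g' rfl).symm
  have hRadj : ∀ x ∈ R, ∀ u v, B (x u) v = B u (x v) := by
    intro x hx
    induction hx using Algebra.adjoin_induction with
    | mem x hx =>
      rcases hx with rfl | rfl
      · intro u v
        rw [LinearMap.add_apply, map_add, LinearMap.add_apply, LinearMap.add_apply, map_add,
          hgadj, hg'adj, add_comm]
      · exact hT
    | algebraMap r => intro u v; simp [Module.algebraMap_end_apply]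
    | add x y _ _ hx hy => intro u v; simp [hx, hy]
    | mul x y hxR hyR hx hy =>
      intro u v
      rw [Module.End.mul_apply, hx, hy, ← Module.End.mul_apply, hRcomm y hyR x hxR]
  have hcR : c ∈ R := Algebra.subset_adjoin (Or.inl rfl)
  have hTR : T ∈ R := Algebra.subset_adjoin (Or.inr rfl)
  set δ := g - g' with hδ
  have hDR : δ ^ 2 ∈ R := by
    have : δ ^ 2 = c ^ 2 - algebraMap F _ 4 := by
      have h4 : algebraMap F (Module.End F V) 4 = (4 : ℕ) • 1 := by
        rw [nsmul_one]; exact map_ofNat _ 4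
      rw [h4, pow_two, pow_two, hc, hδ, sub_mul, mul_sub, mul_sub, add_mul, mul_add, mul_add, hgg',
        hg'g]
      noncomm_ring
    rw [this]
    exact R.sub_mem (R.pow_mem hcR 2) (R.algebraMap_mem 4)
  have h2R : IsUnit (2 : R) := by
    have h := (IsUnit.mk0 (2 : F) hF).map (algebraMap F (Algebra.adjoin F ({c, T} : Set (Module.End F V))))
    rw [map_ofNat] at h
    obtain ⟨⟨u, v, huv, hvu⟩, hu⟩ := h
    exact ⟨⟨u, v, huv, hvu⟩, hu⟩
  -- In the finite ring `R` an element that is not a zero divisor is a unit, so the inverse of `T`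
  -- already lies in `R`.
  have hTuR : IsUnit (⟨T, hTR⟩ : R) := by
    refine IsArtinianRing.isUnit_of_mem_nonZeroDivisors ?_
    rw [mem_nonZeroDivisors_iff_right]
    rintro ⟨x, hx⟩ h
    refine Subtype.ext ?_
    have : x * T = 0 := congrArg Subtype.val h
    exact (hTu.mul_left_eq_zero).mp this
  obtain ⟨⟨p, hp⟩, ⟨r, hr⟩, hpr⟩ := exists_sq_sub_mul_sq h2R (D := ⟨δ ^ 2, hDR⟩) hTuR (by
    intro m hm hD
    -- Two powers of `d = δ ^ 2` coincide, so `d ^ i * (1 - d ^ (k + 1)) = 0`. Hence `1 - d ^ (k +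
    -- 1)` maps into the kernel of `d ^ i`, on which `(T - 1) ^ a` vanishes. A maximal ideal
    -- containing `d` does not contain `1 - d ^ (k + 1)`, so it contains `T - 1`.
    obtain ⟨i, j, hij, he⟩ := Finite.exists_ne_map_eq_of_infinite
      (fun n : ℕ => (⟨δ ^ 2, hDR⟩ : R) ^ n)
    wlog hlt : i < j generalizing i j
    · exact this j i hij.symm he.symm (lt_of_le_of_ne (not_lt.mp hlt) hij.symm)
    obtain ⟨k, rfl⟩ := Nat.exists_eq_add_of_lt hlt
    set d : R := ⟨δ ^ 2, hDR⟩ with hd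
    have h1 : d ^ i * (1 - d ^ (k + 1)) = 0 := by
      have : d ^ i = d ^ (i + k + 1) := he
      rw [mul_sub, mul_one, ← pow_add, ← add_assoc, ← this, sub_self]
    have h2 : ((⟨T, hTR⟩ : R) - 1) ^ a * (1 - d ^ (k + 1)) = 0 := by
      refine Subtype.ext (LinearMap.ext fun v => ?_)
      have h3 := congrArg (fun z : R => z.1 v) h1
      exact hTn i (((1 - d ^ (k + 1) : R) : Module.End F V) v) h3
    have h3 : ((⟨T, hTR⟩ : R) - 1) ^ a * (1 - d ^ (k + 1)) ∈ m := by rw [h2]; exact m.zero_mem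
    rcases hm.isPrime.mem_or_mem h3 with h4 | h4
    · exact hm.isPrime.mem_of_pow_mem _ h4
    · exfalso
      have h5 : d ^ (k + 1) ∈ m := Ideal.pow_mem_of_mem m hD _ k.succ_pos
      have h6 := m.add_mem h4 h5
      rw [sub_add_cancel] at h6
      exact hm.ne_top ((Ideal.eq_top_iff_one m).mpr h6))
  have hprE : p ^ 2 - δ ^ 2 * r ^ 2 = T := congrArg Subtype.val hpr
  have hpδ : Commute p δ := (hRg p hp).sub_right (hRg' p hp)
  have hrδ : Commute r δ := (hRg r hr).sub_right (hRg' r hr)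
  have hprc : Commute p r := hRcomm p hp r hr
  let S : Module.End F V := p + r * δ
  have hSS : (p - δ * r) * S = T := by
    rw [← hprE]
    have e1 : (p - δ * r) * (p + r * δ) = p * p + (p * (r * δ) - δ * r * p) - δ * r * r * δ := by
      noncomm_ring
    have e2 : p * (r * δ) - δ * r * p = 0 := by
      rw [sub_eq_zero, hrδ.eq, ← mul_assoc, hpδ.eq, mul_assoc, hprc.eq, mul_assoc]
    have e3 : δ * r * r * δ = δ ^ 2 * r ^ 2 := by
      rw [mul_assoc (δ * r), hrδ.eq, pow_two, pow_two, mul_assoc, ← mul_assoc r, hrδ.eq]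
      simp only [mul_assoc]
    rw [e1, e2, e3, add_zero, pow_two p]
  have hδadj : ∀ x y, B (δ x) y = -B x (δ y) := fun x y => by
    rw [LinearMap.sub_apply, map_sub, LinearMap.sub_apply, LinearMap.sub_apply, map_sub, hgadj,
      hg'adj, neg_sub]
  have hSB : ∀ x y, B (S x) (S y) = B x (T y) := by
    intro x y
    rw [← hSS, Module.End.mul_apply]
    simp only [S, LinearMap.add_apply, LinearMap.sub_apply, Module.End.mul_apply, map_add, map_sub,
      hRadj p hp, hRadj r hr, hδadj]
    ring
  have hinj : Function.Injective S := by
    rw [injective_iff_map_eq_zero]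
    intro y hy
    have h1 : T y = 0 := hB.nondeg_right _ fun x => by rw [← hSB, hy, map_zero]
    obtain ⟨t, rfl⟩ := hTu
    have h2 : ((↑t⁻¹ : Module.End F V) * ↑t) y = 0 := by
      rw [Module.End.mul_apply, h1, map_zero]
    rwa [Units.inv_mul] at h2
  refine ⟨LinearEquiv.ofInjectiveEndo S hinj, fun x => ?_, fun x y => hSB x y⟩
  have : Commute S g := (hRg p hp).add_left ((hRg r hr).mul_left
    ((Commute.refl g).sub_left hgg'c.symm))
  exact LinearMap.congr_fun this.eq x

end SelfAdjoint

/-! ### Symmetric bilinear forms over finite fields of odd characteristic -/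

section Symmetric

variable {F : Type*} [Field F]

/-- `h` is a nondegenerate symmetric bilinear form. -/
structure IsInner {U : Type*} [AddCommGroup U] [Module F U] (h : LinearMap.BilinForm F U) :
    Prop where
  symm : ∀ x y, h x y = h y x
  nondeg : ∀ x, (∀ y, h x y = 0) → x = 0

/-- There is an isometric linear map from `h` to `h'`. -/
def IsometricTo {U U' : Type*} [AddCommGroup U] [Module F U] [AddCommGroup U'] [Module F U']
    (h : LinearMap.BilinForm F U) (h' : LinearMap.BilinForm F U') : Prop :=
  ∃ f : U →ₗ[F] U', ∀ x y, h' (f x) (f y) = h x y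

namespace IsInner

variable {U U' : Type*} [AddCommGroup U] [Module F U] [AddCommGroup U'] [Module F U']
  {h : LinearMap.BilinForm F U} {h' : LinearMap.BilinForm F U'}

theorem exists_self_ne_zero (h2 : (2 : F) ≠ 0) (hh : IsInner h) (hU : 0 < Module.finrank F U) :
    ∃ x, h x x ≠ 0 := by
  by_contra! h0
  have hz : ∀ x y, h x y = 0 := by
    intro x y
    have h1 := h0 (x + y)
    simp only [map_add, LinearMap.add_apply, h0, zero_add, add_zero] at h1
    rw [hh.symm y x, ← two_mul] at h1
    exact (mul_eq_zero.mp h1).resolve_left h2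
  have : Nontrivial U := Module.nontrivial_of_finrank_pos hU
  obtain ⟨x, hx⟩ := exists_ne (0 : U)
  exact hx (hh.nondeg x fun y => hz x y)

theorem restrict (hh : IsInner h) {x : U} (hx : h x x ≠ 0) :
    IsInner (h.restrict (LinearMap.ker (h x))) := by
  refine ⟨fun y z => hh.symm y z, fun y hy => Subtype.ext (hh.nondeg _ fun z => ?_)⟩
  have hz : z - (h x z / h x x) • x ∈ LinearMap.ker (h x) := by
    rw [LinearMap.mem_ker, map_sub, map_smul, smul_eq_mul, div_mul_cancel₀ _ hx, sub_self]
  have h1 : h y.1 (z - (h x z / h x x) • x) = 0 := hy ⟨_, hz⟩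
  rwa [map_sub, map_smul, hh.symm y.1 x, LinearMap.mem_ker.mp y.2, smul_zero, sub_zero] at h1

theorem finrank_ker [FiniteDimensional F U] {x : U} (hx : h x x ≠ 0) :
    Module.finrank F (LinearMap.ker (h x)) + 1 = Module.finrank F U :=
  Module.Dual.finrank_ker_add_one_of_ne_zero (f := h x) fun h0 => hx (by rw [h0]; rfl)

/-- Both forms split off the line spanned by a non-isotropic vector, and an isometry of the
orthogonal complements is extended by `x ↦ x'`. -/
theorem isometricTo_of_restrict (hh : IsInner h) (hh' : IsInner h') {x : U} {x' : U'}
    (hx : h x x ≠ 0) (hxx' : h x x = h' x' x')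
    (hr : IsometricTo (h.restrict (LinearMap.ker (h x))) (h'.restrict (LinearMap.ker (h' x')))) :
    IsometricTo h h' := by
  obtain ⟨f, hf⟩ := hr
  let π : U →ₗ[F] LinearMap.ker (h x) :=
    (LinearMap.id - (h x).smulRight ((h x x)⁻¹ • x)).codRestrict _ fun y => by
      rw [LinearMap.mem_ker]
      simp only [LinearMap.sub_apply, LinearMap.id_apply, LinearMap.smulRight_apply, map_sub,
        map_smul, smul_eq_mul]
      rw [inv_mul_cancel₀ hx, mul_one, sub_self]
  have hπ : ∀ y, ((π y : LinearMap.ker (h x)) : U) = y - h x y • (h x x)⁻¹ • x := fun y => rfl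
  refine ⟨(LinearMap.ker (h' x')).subtype ∘ₗ f ∘ₗ π + (h x).smulRight ((h x x)⁻¹ • x'),
    fun y z => ?_⟩
  have h1 : ∀ u : LinearMap.ker (h' x'), h' x' u = 0 := fun u => u.2
  have h2 : ∀ u : LinearMap.ker (h' x'), h' u x' = 0 := fun u => by rw [hh'.symm, h1]
  have h3 : h' (f (π y)) (f (π z)) = h (π y) (π z) := hf _ _
  simp only [LinearMap.add_apply, LinearMap.comp_apply, Submodule.subtype_apply,
    LinearMap.smulRight_apply, map_add, map_smul, LinearMap.smul_apply, h1, h2, h3, ← hxx',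
    smul_eq_mul, hπ, map_sub, LinearMap.sub_apply]
  rw [hh.symm y x]
  field_simp
  ring

/-- Two orthogonal non-isotropic vectors give a binary diagonal form, and such a form represents
every element of a finite field. -/
theorem exists_self_eq_one [Finite F] (h2 : (2 : F) ≠ 0) [FiniteDimensional F U] (hh : IsInner h)
    (hU : 2 ≤ Module.finrank F U) : ∃ x, h x x = 1 := by
  obtain ⟨x, hx⟩ := hh.exists_self_ne_zero h2 (by omega)
  have := finrank_ker hx
  obtain ⟨y, hy⟩ := (hh.restrict hx).exists_self_ne_zero h2 (by omega)
  have hy' : h y.1 y.1 ≠ 0 := hy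
  obtain ⟨a, b, hab⟩ := FiniteField.exists_sq_sub_mul_sq h2
    (D := -(h y.1 y.1 / h x x)) (neg_ne_zero.mpr (div_ne_zero hy' hx)) (h x x)⁻¹
  refine ⟨a • x + b • y.1, ?_⟩
  have h3 : h x y.1 = 0 := y.2
  have h4 : h y.1 x = 0 := by rw [hh.symm, h3]
  simp only [map_add, map_smul, LinearMap.add_apply, LinearMap.smul_apply, h3, h4, smul_eq_mul]
  have h5 : h x x * (a ^ 2 - -(h y.1 y.1 / h x x) * b ^ 2) = 1 := by
    rw [hab, mul_inv_cancel₀ hx]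
  field_simp at h5
  linear_combination h5

/-- There are at most two isometry classes of nondegenerate symmetric forms of a given dimension
over a finite field of odd characteristic. -/
theorem isometric_trichotomy [Finite F] (h2 : (2 : F) ≠ 0) (m : ℕ)
    {U₁ U₂ U₃ : Type*} [AddCommGroup U₁] [Module F U₁] [AddCommGroup U₂] [Module F U₂]
    [AddCommGroup U₃] [Module F U₃] [FiniteDimensional F U₁] [FiniteDimensional F U₂]
    [FiniteDimensional F U₃] {h₁ : LinearMap.BilinForm F U₁} {h₂ : LinearMap.BilinForm F U₂}
    {h₃ : LinearMap.BilinForm F U₃} (hh₁ : IsInner h₁) (hh₂ : IsInner h₂) (hh₃ : IsInner h₃)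
    (hm₁ : Module.finrank F U₁ = m) (hm₂ : Module.finrank F U₂ = m)
    (hm₃ : Module.finrank F U₃ = m) :
    IsometricTo h₁ h₂ ∨ IsometricTo h₁ h₃ ∨ IsometricTo h₂ h₃ := by
  induction m generalizing U₁ U₂ U₃ with
  | zero =>
    have : Subsingleton U₁ := Module.finrank_zero_iff.mp hm₁
    refine Or.inl ⟨0, fun x y => ?_⟩
    rw [Subsingleton.elim x 0]; simp
  | succ m ih =>
    -- In dimension at least two all three forms represent `1`, so the same one-dimensional form
    -- splits off each. In dimension one a form is a square class, of which there are two, so two of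
    -- the three agree up to rescaling the vectors.
    have key : ∃ (x₁ : U₁) (x₂ : U₂) (x₃ : U₃), h₁ x₁ x₁ ≠ 0 ∧ h₂ x₂ x₂ ≠ 0 ∧ h₃ x₃ x₃ ≠ 0 ∧
        ((h₁ x₁ x₁ = h₂ x₂ x₂ ∧ h₁ x₁ x₁ = h₃ x₃ x₃ ∧ h₂ x₂ x₂ = h₃ x₃ x₃) ∨
          (m = 0 ∧ (h₁ x₁ x₁ = h₂ x₂ x₂ ∨ h₁ x₁ x₁ = h₃ x₃ x₃ ∨ h₂ x₂ x₂ = h₃ x₃ x₃))) := by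
      rcases Nat.eq_zero_or_pos m with rfl | hm
      · obtain ⟨x₁, hx₁⟩ := hh₁.exists_self_ne_zero h2 (by omega)
        obtain ⟨x₂, hx₂⟩ := hh₂.exists_self_ne_zero h2 (by omega)
        obtain ⟨x₃, hx₃⟩ := hh₃.exists_self_ne_zero h2 (by omega)
        have := Fintype.ofFinite F
        classical
        have hsq : ∀ {a b : F}, a ≠ 0 → b ≠ 0 → quadraticChar F a = quadraticChar F b →
            ∃ c : F, c * c * b = a := by
          intro a b ha hb hab
          have h1 : quadraticChar F (a * b) = 1 := by
            rw [map_mul, hab, ← pow_two, quadraticChar_sq_one hb]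
          obtain ⟨c, hc⟩ := (quadraticChar_one_iff_isSquare (mul_ne_zero ha hb)).mp h1
          refine ⟨c / b, ?_⟩
          field_simp
          rw [pow_two, ← hc, mul_comm]
        have h3 : ∀ {a : F}, a ≠ 0 → quadraticChar F a = 1 ∨ quadraticChar F a = -1 :=
          fun ha => quadraticChar_dichotomy ha
        have h4 : quadraticChar F (h₁ x₁ x₁) = quadraticChar F (h₂ x₂ x₂) ∨
            quadraticChar F (h₁ x₁ x₁) = quadraticChar F (h₃ x₃ x₃) ∨
            quadraticChar F (h₂ x₂ x₂) = quadraticChar F (h₃ x₃ x₃) := by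
          rcases h3 hx₁ with e1 | e1 <;> rcases h3 hx₂ with e2 | e2 <;>
            rcases h3 hx₃ with e3 | e3 <;> simp [e1, e2, e3]
        rcases h4 with h4 | h4 | h4
        · obtain ⟨c, hc⟩ := hsq hx₁ hx₂ h4
          refine ⟨x₁, c • x₂, x₃, hx₁, ?_, hx₃, Or.inr ⟨rfl, Or.inl ?_⟩⟩
          · simpa [← mul_assoc, hc] using hx₁
          · simp [← mul_assoc, hc]
        · obtain ⟨c, hc⟩ := hsq hx₁ hx₃ h4
          refine ⟨x₁, x₂, c • x₃, hx₁, hx₂, ?_, Or.inr ⟨rfl, Or.inr (Or.inl ?_)⟩⟩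
          · simpa [← mul_assoc, hc] using hx₁
          · simp [← mul_assoc, hc]
        · obtain ⟨c, hc⟩ := hsq hx₂ hx₃ h4
          refine ⟨x₁, x₂, c • x₃, hx₁, hx₂, ?_, Or.inr ⟨rfl, Or.inr (Or.inr ?_)⟩⟩
          · simpa [← mul_assoc, hc] using hx₂
          · simp [← mul_assoc, hc]
      · obtain ⟨x₁, hx₁⟩ := hh₁.exists_self_eq_one h2 (by omega)
        obtain ⟨x₂, hx₂⟩ := hh₂.exists_self_eq_one h2 (by omega)
        obtain ⟨x₃, hx₃⟩ := hh₃.exists_self_eq_one h2 (by omega)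
        refine ⟨x₁, x₂, x₃, ?_⟩
        simp [hx₁, hx₂, hx₃]
    obtain ⟨x₁, x₂, x₃, hx₁, hx₂, hx₃, hc⟩ := key
    have f₁ := finrank_ker hx₁
    have f₂ := finrank_ker hx₂
    have f₃ := finrank_ker hx₃
    have hr₁ := hh₁.restrict hx₁
    have hr₂ := hh₂.restrict hx₂
    have hr₃ := hh₃.restrict hx₃
    rcases hc with ⟨h12, h13, h23⟩ | ⟨rfl, hc⟩
    · rcases ih hr₁ hr₂ hr₃ (by omega) (by omega) (by omega) with hi | hi | hi
      · exact Or.inl (hh₁.isometricTo_of_restrict hh₂ hx₁ h12 hi)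
      · exact Or.inr (Or.inl (hh₁.isometricTo_of_restrict hh₃ hx₁ h13 hi))
      · exact Or.inr (Or.inr (hh₂.isometricTo_of_restrict hh₃ hx₂ h23 hi))
    · have triv₁ : Subsingleton (LinearMap.ker (h₁ x₁)) := (Module.finrank_zero_iff (R := F)).mp (by omega)
      have triv₂ : Subsingleton (LinearMap.ker (h₂ x₂)) := (Module.finrank_zero_iff (R := F)).mp (by omega)
      rcases hc with hc | hc | hc
      · exact Or.inl (hh₁.isometricTo_of_restrict hh₂ hx₁ hc
          ⟨0, fun x y => by rw [Subsingleton.elim x 0]; simp⟩)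
      · exact Or.inr (Or.inl (hh₁.isometricTo_of_restrict hh₃ hx₁ hc
          ⟨0, fun x y => by rw [Subsingleton.elim x 0]; simp⟩))
      · exact Or.inr (Or.inr (hh₂.isometricTo_of_restrict hh₃ hx₂ hc
          ⟨0, fun x y => by rw [Subsingleton.elim x 0]; simp⟩))

end IsInner
end Symmetric

/-! ### The nilpotent operator `g - ε` for `ε = ± 1` and the forms it defines -/

section Unipotent

variable {F : Type*} [Field F] {V : Type*} [AddCommGroup V] [Module F V]

theorem IsSymplectic.exists_apply_eq [FiniteDimensional F V] {B : LinearMap.BilinForm F V}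
    (hB : IsSymplectic B) (f : V →ₗ[F] F) : ∃ u, ∀ v, B u v = f v := by
  have hinj : Function.Injective B := by
    rw [injective_iff_map_eq_zero]
    intro x hx
    exact hB.nondeg x fun y => by rw [hx]; rfl
  have hs : Function.Surjective B :=
    (LinearMap.injective_iff_surjective_of_finrank_eq_finrank
      (Subspace.dual_finrank_eq (K := F) (V := V)).symm).mp hinj
  obtain ⟨u, hu⟩ := hs f
  exact ⟨u, fun v => by rw [hu]⟩

/-- The range of the adjoint is the orthogonal complement of the kernel: a functional vanishing on
the range of `f'` is `B u` for some `u` in the kernel of `f`. -/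
theorem IsSymplectic.exists_adjoint_apply_eq [FiniteDimensional F V]
    {B : LinearMap.BilinForm F V} (hB : IsSymplectic B) {f f' : Module.End F V}
    (hf : ∀ x y, B (f x) y = B x (f' y)) {w : V} (hw : ∀ u, f u = 0 → B u w = 0) :
    ∃ y, f' y = w := by
  by_contra h
  obtain ⟨l, hl, hr⟩ := Submodule.exists_le_ker_of_notMem (p := LinearMap.range f') (v := w) h
  obtain ⟨u, hu⟩ := hB.exists_apply_eq l
  refine hl ?_
  rw [← hu]
  refine hw u (hB.nondeg _ fun y => ?_)
  rw [hf, hu]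
  exact hr ⟨y, rfl⟩

/-- `g` is an isometry of `B` with inverse `g'`. -/
structure IsIsometryPair (B : LinearMap.BilinForm F V) (g g' : Module.End F V) : Prop where
  isom : ∀ x y, B (g x) (g y) = B x y
  mul_inv : g * g' = 1
  inv_mul : g' * g = 1

namespace IsIsometryPair

variable {B : LinearMap.BilinForm F V} {g g' : Module.End F V}

theorem adj (h : IsIsometryPair B g g') (x y : V) : B (g x) y = B x (g' y) := by
  rw [← h.isom x (g' y), ← Module.End.mul_apply, h.mul_inv, Module.End.one_apply]

theorem commute (h : IsIsometryPair B g g') : Commute g g' := by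
  rw [commute_iff_eq, h.mul_inv, h.inv_mul]

theorem commute_shift (h : IsIsometryPair B g g') (ε : F) :
    Commute (-(algebraMap F (Module.End F V) ε * g')) (g - algebraMap F _ ε) := by
  refine Commute.neg_left (Commute.mul_left ?_ ?_)
  · exact Algebra.commute_algebraMap_left _ _
  · exact h.commute.symm.sub_right (Algebra.commute_algebraMap_right _ _)

theorem inv_sub (h : IsIsometryPair B g g') {ε : F} (hε : ε * ε = 1) :
    g' - algebraMap F _ ε =
      (g - algebraMap F _ ε) * -(algebraMap F (Module.End F V) ε * g') := by
  have h1 : algebraMap F (Module.End F V) ε * algebraMap F (Module.End F V) ε = 1 := by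
    rw [← map_mul, hε, map_one]
  have h2 : g * (algebraMap F (Module.End F V) ε * g') = algebraMap F (Module.End F V) ε := by
    rw [← mul_assoc, (Algebra.commute_algebraMap_right ε g).eq, mul_assoc, h.mul_inv, mul_one]
  rw [mul_neg, sub_mul, h2, ← mul_assoc, h1, one_mul, neg_sub]

/-- The adjoint of `g - ε` is `g⁻¹ - ε = (g - ε) * (-ε g⁻¹)`, that is, `g - ε` itself up to a
commuting unit. -/
theorem shift_pow_adj (h : IsIsometryPair B g g') {ε : F} (hε : ε * ε = 1) (i : ℕ) (x y : V) :
    B (((g - algebraMap F _ ε) ^ i) x) y =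
      B x (((g - algebraMap F _ ε) ^ i) (((-(algebraMap F (Module.End F V) ε * g')) ^ i) y)) := by
  have h1 : ∀ x y, B ((g - algebraMap F _ ε) x) y = B x ((g' - algebraMap F _ ε) y) := by
    intro x y
    simp [h.adj, Module.algebraMap_end_apply]
  rw [← Module.End.mul_apply, ← (h.commute_shift ε).symm.mul_pow, ← h.inv_sub hε]
  induction i generalizing x y with
  | zero => rfl
  | succ i ih => rw [pow_succ, Module.End.mul_apply, ih, h1, pow_succ', Module.End.mul_apply]

/-- On `ker (g - ε)`, the unit `-ε g⁻¹` acts by `-1`. -/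
theorem unit_pow_apply (h : IsIsometryPair B g g') {ε : F} {v : V}
    (hv : (g - algebraMap F (Module.End F V) ε) v = 0) (i : ℕ) :
    ((-(algebraMap F (Module.End F V) ε * g')) ^ i) v = (-1 : F) ^ i • v := by
  have h1 : (-(algebraMap F (Module.End F V) ε * g')) v = (-1 : F) • v := by
    have h2 : g v = ε • v := by
      rwa [LinearMap.sub_apply, Module.algebraMap_end_apply, sub_eq_zero] at hv
    have h3 : g' (g v) = v := by rw [← Module.End.mul_apply, h.inv_mul]; rfl
    rw [h2, map_smul] at h3
    rw [LinearMap.neg_apply, Module.End.mul_apply, Module.algebraMap_end_apply, h3, neg_one_smul]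
  induction i with
  | zero => simp
  | succ i ih => rw [pow_succ, Module.End.mul_apply, h1, map_smul, ih, smul_smul, pow_succ']

/-- The form `(u, v) ↦ B (u, (g - ε) ^ i v)` is `(-1) ^ (i + 1)`-symmetric on
`ker (g - ε) ^ (i + 1)`. -/
theorem form_symm (hB : IsSymplectic B) (h : IsIsometryPair B g g') {ε : F} (hε : ε * ε = 1)
    {i : ℕ} {u : V} (hu : ((g - algebraMap F (Module.End F V) ε) ^ (i + 1)) u = 0) (v : V) :
    B v (((g - algebraMap F (Module.End F V) ε) ^ i) u) =
      (-1 : F) ^ (i + 1) * B u (((g - algebraMap F (Module.End F V) ε) ^ i) v) := by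
  -- The vector `(g - ε) ^ i u` lies in the kernel of `g - ε`, where the unit from the adjoint
  -- contributes `(-1) ^ i`; the last sign comes from `B` being alternating.
  have h1 : (g - algebraMap F (Module.End F V) ε) (((g - algebraMap F _ ε) ^ i) u) = 0 := by
    rw [← Module.End.mul_apply, ← pow_succ', hu]
  have h2 : Commute ((-(algebraMap F (Module.End F V) ε * g')) ^ i) ((g - algebraMap F _ ε) ^ i) :=
    (h.commute_shift ε).pow_pow _ _
  rw [hB.neg (((g - algebraMap F (Module.End F V) ε) ^ i) v) u, h.shift_pow_adj hε,
    ← Module.End.mul_apply, ← h2.eq, Module.End.mul_apply, h.unit_pow_apply h1, map_smul,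
    smul_eq_mul]
  have h3 : (-1 : F) ^ i * (-1 : F) ^ i = 1 := by rw [← mul_pow]; simp
  rw [pow_succ]
  linear_combination (-B v (((g - algebraMap F (Module.End F V) ε) ^ i) u)) * h3

/-- On `ker (g - ε) ^ i` the inner power vanishes; on `(g - ε) z` the total power is `i + 1`, which
moves to the other argument up to a unit and kills `u`. So the form descends to the multiplicity
space of `(t - ε) ^ (i + 1)`. -/
theorem form_eq_zero_of_mem (h : IsIsometryPair B g g') {ε : F} (hε : ε * ε = 1)
    {i : ℕ} {u v : V} (hu : ((g - algebraMap F (Module.End F V) ε) ^ (i + 1)) u = 0)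
    (hv : v ∈ LinearMap.ker ((g - algebraMap F (Module.End F V) ε) ^ i) ⊔
      (LinearMap.ker ((g - algebraMap F (Module.End F V) ε) ^ (i + 2))).map
        (g - algebraMap F (Module.End F V) ε)) :
    B u (((g - algebraMap F (Module.End F V) ε) ^ i) v) = 0 := by
  obtain ⟨a, ha, _, ⟨z, hz, rfl⟩, rfl⟩ := Submodule.mem_sup.mp hv
  rw [map_add, LinearMap.mem_ker.mp ha, zero_add, ← Module.End.mul_apply, ← pow_succ]
  obtain ⟨z', rfl⟩ : ∃ z', ((-(algebraMap F (Module.End F V) ε * g')) ^ (i + 1)) z' = z := by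
    have : (-(algebraMap F (Module.End F V) ε * g')) * (-(algebraMap F (Module.End F V) ε * g)) = 1 := by
      rw [neg_mul_neg, mul_assoc, ← mul_assoc g', ← (Algebra.commute_algebraMap_left ε g').eq,
        mul_assoc, h.inv_mul, mul_one, ← map_mul, hε, map_one]
    have hc : Commute (-(algebraMap F (Module.End F V) ε * g'))
        (-(algebraMap F (Module.End F V) ε * g)) :=
      Commute.neg_left (Commute.neg_right (Commute.mul_left
        (Algebra.commute_algebraMap_left _ _)
        (Commute.mul_right (Algebra.commute_algebraMap_right _ _) h.commute.symm)))
    refine ⟨((-(algebraMap F (Module.End F V) ε * g)) ^ (i + 1)) z, ?_⟩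
    rw [← Module.End.mul_apply, ← hc.mul_pow, this, one_pow, Module.End.one_apply]
  rw [← h.shift_pow_adj hε, hu, map_zero, LinearMap.zero_apply]

/-- The range of `(g - ε) ^ i` is the orthogonal complement of its kernel, because its adjoint is
itself times a unit. -/
theorem exists_shift_pow_eq [FiniteDimensional F V] (hB : IsSymplectic B)
    (h : IsIsometryPair B g g') {ε : F}
    (hε : ε * ε = 1) {i : ℕ} {w : V}
    (hw : ∀ u, ((g - algebraMap F (Module.End F V) ε) ^ i) u = 0 → B u w = 0) :
    ∃ z, ((g - algebraMap F (Module.End F V) ε) ^ i) z = w := by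
  obtain ⟨y, hy⟩ := hB.exists_adjoint_apply_eq (f := (g - algebraMap F (Module.End F V) ε) ^ i)
    (f' := (g - algebraMap F (Module.End F V) ε) ^ i * (-(algebraMap F (Module.End F V) ε * g')) ^ i)
    (h.shift_pow_adj hε i) hw
  exact ⟨_, hy⟩

/-- If two invariant forms `B` and `B (·, T ·)` induce the same forms `B (u, (g - ε) ^ (i - 1) v)`
on all the spaces `ker (g - ε) ^ i`, then `T` is unipotent on the generalised eigenspace. -/
theorem nilpotent_of_agree [FiniteDimensional F V] (hB : IsSymplectic B)
    (h : IsIsometryPair B g g') {ε : F} (hε : ε * ε = 1) {T : Module.End F V}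
    (hT : Commute T g)
    (hagree : ∀ (i : ℕ) (u v : V), ((g - algebraMap F (Module.End F V) ε) ^ (i + 1)) u = 0 →
      ((g - algebraMap F (Module.End F V) ε) ^ (i + 1)) v = 0 →
      B u (T (((g - algebraMap F (Module.End F V) ε) ^ i) v)) =
        B u (((g - algebraMap F (Module.End F V) ε) ^ i) v)) :
    ∃ a : ℕ, ∀ (k : ℕ) (v : V), ((g - algebraMap F (Module.End F V) ε) ^ k) v = 0 →
      ((T - 1) ^ a) v = 0 := by
  set N := g - algebraMap F (Module.End F V) ε with hN
  set E := T - 1 with hE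
  have hEN : Commute E N :=
    (hT.sub_left (Commute.one_left _)).sub_right (Algebra.commute_algebraMap_right _ _)
  -- Fitting decomposition `V = K ⊕ I` for `E = T - 1`, nilpotent on `K` and bijective on `I`; both
  -- parts are stable under `N`. The exponent `n = n₀ + 1` has a predecessor beyond which the
  -- decomposition is still available, so that `E ^ n = E * E ^ n₀` gives preimages under `E`. The
  -- aim is that `I` contains no nonzero vector killed by a power of `N`.
  obtain ⟨n₀, hn₀⟩ := Filter.eventually_atTop.mp (LinearMap.eventually_isCompl_ker_pow_range_pow E)
  obtain ⟨n, hn⟩ : ∃ n, n = n₀ + 1 := ⟨_, rfl⟩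
  refine ⟨n, ?_⟩
  have hcompl := hn₀ n (by omega)
  set K := LinearMap.ker (E ^ n)
  set I := LinearMap.range (E ^ n)
  have hNK : ∀ j x, x ∈ K → (N ^ j) x ∈ K := fun j x hx => by
    rw [LinearMap.mem_ker, ← Module.End.mul_apply, (hEN.pow_pow n j).eq, Module.End.mul_apply,
      LinearMap.mem_ker.mp hx, map_zero]
  have hNI : ∀ j x, x ∈ I → (N ^ j) x ∈ I := by
    rintro j _ ⟨x, rfl⟩
    exact ⟨(N ^ j) x, by rw [← Module.End.mul_apply, (hEN.pow_pow n j).eq, Module.End.mul_apply]⟩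
  have hKI : ∀ x, x ∈ K → x ∈ I → x = 0 := fun x hK hI =>
    Submodule.disjoint_def.mp hcompl.disjoint x hK hI
  have hEker : ∀ x ∈ I, E x = 0 → x = 0 := by
    intro x hx h0
    refine hKI x ?_ hx
    rw [LinearMap.mem_ker, hn, pow_succ, Module.End.mul_apply, h0, map_zero]
  have hroot : ∀ v ∈ I, ∃ v' ∈ I, E v' = v := by
    intro v hv
    obtain ⟨x, rfl⟩ := hv
    obtain ⟨y, hy, _, ⟨z, rfl⟩, rfl⟩ : ∃ y ∈ K, ∃ z ∈ I, y + z = x :=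
      Submodule.mem_sup.mp (by rw [hcompl.sup_eq_top]; trivial)
    refine ⟨(E ^ n) ((E ^ n₀) z), ⟨_, rfl⟩, ?_⟩
    rw [map_add, LinearMap.mem_ker.mp hy, zero_add]
    simp only [← Module.End.mul_apply, ← pow_add, ← pow_succ']
    congr 2
    omega
  -- Descent on the power of `N` that kills the `N`-torsion of `I`. Suppose `N ^ (i + 1)` does, and
  -- write `v = E v'` with `v'` in `I`. Agreement of the forms makes `N ^ i v` orthogonal to `ker N
  -- ^ (i + 1)`, so it equals `N ^ (i + 1) z` with `z` replaceable by its component in `I`. That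
  -- component is torsion, so `N ^ (i + 1)` kills it and `N ^ i v = 0`.
  have key : ∀ m i, (∀ v ∈ I, ∀ k, (N ^ k) v = 0 → (N ^ (i + m)) v = 0) →
      (∀ v ∈ I, ∀ k, (N ^ k) v = 0 → (N ^ i) v = 0) := by
    intro m
    induction m with
    | zero => intro i hi; exact hi
    | succ m ih =>
      intro i hi
      have hQ := ih (i + 1) (fun v hv k hk => by
        have := hi v hv k hk
        rwa [show i + 1 + m = i + (m + 1) by ring])
      intro v hv k hk
      obtain ⟨v', hv', rfl⟩ := hroot v hv
      have hk' : (N ^ k) v' = 0 := by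
        refine hEker _ (hNI k v' hv') ?_
        rw [← Module.End.mul_apply, (hEN.pow_right k).eq, Module.End.mul_apply, hk]
      have h1 := hQ v' hv' k hk'
      have h2 : ∀ u, (N ^ (i + 1)) u = 0 → B u ((N ^ i) (E v')) = 0 := by
        intro u hu
        have := hagree i u v' hu h1
        rw [← Module.End.mul_apply, ← (hEN.pow_right i).eq, Module.End.mul_apply, hE,
          LinearMap.sub_apply, map_sub, this, Module.End.one_apply, sub_self]
      obtain ⟨z, hz⟩ := h.exists_shift_pow_eq hB hε h2
      obtain ⟨zK, hzK, zI, hzI, rfl⟩ : ∃ zK ∈ K, ∃ zI ∈ I, zK + zI = z :=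
        Submodule.mem_sup.mp (by rw [hcompl.sup_eq_top]; trivial)
      rw [map_add] at hz
      have h3 : (N ^ (i + 1)) zK = 0 := by
        refine hKI _ (hNK _ _ hzK) ?_
        rw [eq_sub_of_add_eq hz]
        exact I.sub_mem (hNI _ _ hv) (hNI _ _ hzI)
      rw [h3, zero_add] at hz
      have h4 : (N ^ (i + 1 + 1)) zI = 0 := by
        rw [pow_succ', Module.End.mul_apply, hz, ← Module.End.mul_apply, ← pow_succ',
          ]
        exact hQ _ hv k hk
      rw [← hz]
      exact hQ zI hzI _ h4
  have hI0 : ∀ v ∈ I, ∀ k, (N ^ k) v = 0 → v = 0 := by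
    intro v hv k hk
    refine key (Module.finrank F V) 0 (fun v _ k hk => ?_) v hv k hk
    rw [zero_add]
    exact LinearMap.mem_ker.mp (Module.End.ker_pow_le_ker_pow_finrank N k hk)
  intro k v hk
  obtain ⟨vK, hvK, vI, hvI, rfl⟩ : ∃ zK ∈ K, ∃ zI ∈ I, zK + zI = v :=
    Submodule.mem_sup.mp (by rw [hcompl.sup_eq_top]; trivial)
  rw [map_add] at hk
  have h3 : (N ^ k) vI = 0 := by
    refine hKI _ ?_ (hNI _ _ hvI)
    rw [eq_neg_of_add_eq_zero_right hk]
    exact K.neg_mem (hNK _ _ hvK)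
  rw [hI0 vI hvI k h3, add_zero]
  exact hvK

end IsIsometryPair
end Unipotent

/-! ### Changing generators within blocks of equal annihilator -/

section Blocks

variable {F : Type*} [Field F]

/-- The automorphism of `F ^ ι` that acts on each fibre of `bl` by a given automorphism. -/
def blockEquiv {ι β : Type*} (bl : ι → β)
    (L : ∀ b, ({j // bl j = b} → F) ≃ₗ[F] ({j // bl j = b} → F)) : (ι → F) ≃ₗ[F] (ι → F) where
  toFun c j := L (bl j) (fun l => c l.1) ⟨j, rfl⟩
  map_add' c d := by
    funext j
    exact congrFun ((L (bl j)).map_add (fun l => c l.1) (fun l => d l.1)) ⟨j, rfl⟩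
  map_smul' a c := by
    funext j
    exact congrFun ((L (bl j)).map_smul a (fun l => c l.1)) ⟨j, rfl⟩
  invFun c j := (L (bl j)).symm (fun l => c l.1) ⟨j, rfl⟩
  left_inv c := by
    funext j
    have : (fun l : {l // bl l = bl j} => L (bl l.1) (fun m => c m.1) ⟨l.1, rfl⟩) =
        L (bl j) (fun m => c m.1) := by
      funext ⟨l, hl⟩
      generalize bl j = b at hl
      subst hl
      rfl
    change (L (bl j)).symm (fun l : {l // bl l = bl j} => L (bl l.1) (fun m => c m.1) ⟨l.1, rfl⟩)
      ⟨j, rfl⟩ = c j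
    rw [this, LinearEquiv.symm_apply_apply]
  right_inv c := by
    funext j
    have : (fun l : {l // bl l = bl j} => (L (bl l.1)).symm (fun m => c m.1) ⟨l.1, rfl⟩) =
        (L (bl j)).symm (fun m => c m.1) := by
      funext ⟨l, hl⟩
      generalize bl j = b at hl
      subst hl
      rfl
    change L (bl j) (fun l : {l // bl l = bl j} => (L (bl l.1)).symm (fun m => c m.1) ⟨l.1, rfl⟩)
      ⟨j, rfl⟩ = c j
    rw [this, LinearEquiv.apply_symm_apply]

variable {V : Type*} [AddCommGroup V] [Module F V]

theorem Generates.reindex {φ : V →ₗ[F] V} {ι κ : Type*} [Fintype ι] [Fintype κ] {x : ι → V}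
    {p : ι → F[X]} (h : Generates φ x p) (σ : κ ≃ ι) :
    Generates φ (fun j => x (σ j)) (fun j => p (σ j)) := by
  refine ⟨fun v => ?_, fun y => ?_⟩
  · obtain ⟨y, hy⟩ := h.surj v
    refine ⟨fun j => y (σ j), ?_⟩
    rw [← hy]
    exact Equiv.sum_comp σ (fun j => aeval φ (y j) (x j))
  · have := h.ker_iff (fun j => y (σ.symm j))
    rw [← Equiv.sum_comp σ] at this
    simp only [Equiv.symm_apply_apply] at this
    rw [this]
    exact ⟨fun h j => by simpa using h (σ j), fun h j => by simpa using h (σ.symm j)⟩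

/-- An invertible constant matrix preserves the direct sum decomposition if it and its inverse mix
only generators with the same annihilator. -/
theorem Generates.change {φ : V →ₗ[F] V} {ι : Type*} [Fintype ι] [DecidableEq ι] {x : ι → V}
    {p : ι → F[X]} (h : Generates φ x p) (Λ : (ι → F) ≃ₗ[F] (ι → F))
    (hΛ : ∀ j l, Λ (Pi.single l 1) j ≠ 0 → p j = p l)
    (hΛ' : ∀ j l, Λ.symm (Pi.single l 1) j ≠ 0 → p j = p l) :
    Generates φ (fun l => ∑ j, Λ (Pi.single l 1) j • x j) p := by
  have hmul : ∀ (Λ Λ' : (ι → F) →ₗ[F] (ι → F)) (hh : Λ ∘ₗ Λ' = LinearMap.id) (j l : ι),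
      ∑ m, Λ (Pi.single m 1) j * Λ' (Pi.single l 1) m = if j = l then 1 else 0 := by
    intro Λ Λ' hh j l
    have h1 := congrFun (LinearMap.congr_fun hh (Pi.single l 1)) j
    rw [LinearMap.comp_apply, LinearMap.pi_apply_eq_sum_univ Λ] at h1
    have h2 : ∀ m : ι, (fun j : ι => if m = j then (1 : F) else 0) = Pi.single m 1 := by
      intro m; funext j; simp [Pi.single_apply, eq_comm]
    simp only [h2, Finset.sum_apply, Pi.smul_apply, smul_eq_mul, LinearMap.id_apply] at h1
    simp only [mul_comm (Λ _ _)]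
    rw [h1]
    simp [Pi.single_apply]
  have h1 := hmul Λ.toLinearMap Λ.symm.toLinearMap (by ext; simp)
  have h2 := hmul Λ.symm.toLinearMap Λ.toLinearMap (by ext; simp)
  simp only [LinearEquiv.coe_coe] at h1 h2
  have key : ∀ y : ι → F[X], ∑ l, aeval φ (y l) (∑ j, Λ (Pi.single l 1) j • x j) =
      ∑ j, aeval φ (∑ l, C (Λ (Pi.single l 1) j) * y l) (x j) := by
    intro y
    simp only [map_sum, map_mul, aeval_C, LinearMap.sum_apply, Module.End.mul_apply,
      Module.algebraMap_end_apply, map_smul]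
    exact Finset.sum_comm
  refine ⟨fun v => ?_, fun y => ?_⟩
  · obtain ⟨y, rfl⟩ := h.surj v
    refine ⟨fun l => ∑ m, C (Λ.symm (Pi.single m 1) l) * y m, ?_⟩
    rw [key]
    refine Finset.sum_congr rfl fun j _ => ?_
    congr 2
    simp only [Finset.mul_sum, ← mul_assoc, ← C_mul]
    rw [Finset.sum_comm]
    simp only [← Finset.sum_mul, ← map_sum, h1]
    simp
  · rw [key, h.ker_iff]
    constructor
    · intro hd l
      have : y l = ∑ j, C (Λ.symm (Pi.single j 1) l) * ∑ m, C (Λ (Pi.single m 1) j) * y m := by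
        simp only [Finset.mul_sum, ← mul_assoc, ← C_mul]
        rw [Finset.sum_comm]
        simp only [← Finset.sum_mul, ← map_sum, h2]
        simp
      rw [this]
      refine Finset.dvd_sum fun j _ => ?_
      by_cases h0 : Λ.symm (Pi.single j 1) l = 0
      · rw [h0]; simp
      · rw [hΛ' _ _ h0]; exact (hd j).mul_left _
    · intro hd j
      refine Finset.dvd_sum fun l _ => ?_
      by_cases h0 : Λ (Pi.single l 1) j = 0
      · rw [h0]; simp
      · rw [hΛ _ _ h0]; exact (hd l).mul_left _

/-- Both modules are quotients of the free module `F[t] ^ ι` by the same submodule. -/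
theorem Generates.exists_equiv {V' : Type*} [AddCommGroup V'] [Module F V'] {φ : V →ₗ[F] V}
    {φ' : V' →ₗ[F] V'} {ι : Type*} [Fintype ι] {x : ι → V} {x' : ι → V'} {p : ι → F[X]}
    (h : Generates φ x p) (h' : Generates φ' x' p) :
    ∃ f : V ≃ₗ[F] V', (∀ v, f (φ v) = φ' (f v)) ∧ ∀ j, f (x j) = x' j := by
  classical
  let Φ : ∀ {W : Type _} [AddCommGroup W] [Module F W] (φ : W →ₗ[F] W) (x : ι → W),
      (ι → F[X]) →ₗ[F] W := fun φ x =>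
    { toFun := fun y => ∑ j, aeval φ (y j) (x j)
      map_add' := fun y z => by simp [Finset.sum_add_distrib]
      map_smul' := fun c y => by simp [Finset.smul_sum] }
  let Φ' : (ι → F[X]) →ₗ[F] V' :=
    { toFun := fun y => ∑ j, aeval φ' (y j) (x' j)
      map_add' := fun y z => by simp [Finset.sum_add_distrib]
      map_smul' := fun c y => by simp [Finset.smul_sum] }
  have hk : LinearMap.ker (Φ φ x) = LinearMap.ker Φ' := by
    ext y
    rw [LinearMap.mem_ker, LinearMap.mem_ker]
    exact (h.ker_iff y).trans (h'.ker_iff y).symm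
  let f := ((Φ φ x).quotKerEquivOfSurjective h.surj).symm ≪≫ₗ Submodule.quotEquivOfEq _ _ hk ≪≫ₗ
    (Φ'.quotKerEquivOfSurjective h'.surj)
  have hf : ∀ y, f (Φ φ x y) = Φ' y := by
    intro y
    have : ((Φ φ x).quotKerEquivOfSurjective h.surj).symm (Φ φ x y) = Submodule.Quotient.mk y := by
      rw [LinearEquiv.symm_apply_eq]; rfl
    simp only [f, LinearEquiv.trans_apply, this]
    rfl
  refine ⟨f, fun v => ?_, fun j => ?_⟩
  · obtain ⟨y, rfl⟩ := h.surj v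
    have h1 : φ (∑ j, aeval φ (y j) (x j)) = Φ φ x (fun j => X * y j) := by
      simp [Φ, map_sum]
    have h2 : φ' (Φ' y) = Φ' (fun j => X * y j) := by
      simp [Φ', map_sum]
    rw [h1, hf, ← h2, ← hf]
    rfl
  · have h1 : Φ φ x (Pi.single j 1) = x j := by
      change ∑ i, aeval φ ((Pi.single j 1 : ι → F[X]) i) (x i) = x j
      rw [Finset.sum_eq_single j]
      · simp
      · intro i _ hij; simp [Pi.single_eq_of_ne hij]
      · simp
    have h2 : Φ' (Pi.single j 1) = x' j := by
      change ∑ i, aeval φ' ((Pi.single j 1 : ι → F[X]) i) (x' i) = x' j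
      rw [Finset.sum_eq_single j]
      · simp
      · intro i _ hij; simp [Pi.single_eq_of_ne hij]
      · simp
    rw [← h1, hf, h2]

open Classical in
/-- The generators of annihilator `(t - ε) ^ (i + 1)` span `ker (g - ε) ^ (i + 1)` modulo the
common radical of all forms `B (u, (g - ε) ^ i v)`. -/
theorem Generates.exists_ker_decomp {g : Module.End F V} {ι : Type*} [Fintype ι] {x : ι → V}
    {r : ι → Phi F} {e : ι → ℕ+} (h : Generates g x (fun j => (r j).1 ^ (e j : ℕ))) {ε : F}
    {s : Phi F} (hs : s.1 = X - C ε) {i : ℕ+} {u : V}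
    (hu : ((g - algebraMap F (Module.End F V) ε) ^ (i : ℕ)) u = 0) :
    ∃ c : {j // (r j, e j) = (s, i)} → F,
      u - Fintype.linearCombination F (fun j : {j // (r j, e j) = (s, i)} => x j.1) c ∈
        LinearMap.ker ((g - algebraMap F (Module.End F V) ε) ^ ((i : ℕ) - 1)) ⊔
          (LinearMap.ker ((g - algebraMap F (Module.End F V) ε) ^ ((i : ℕ) + 1))).map
            (g - algebraMap F (Module.End F V) ε) := by
  set N := g - algebraMap F (Module.End F V) ε with hN
  have hNa : ∀ k : ℕ, N ^ k = aeval g ((X - C ε) ^ k) := fun k => by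
    rw [map_pow, map_sub, aeval_X, aeval_C]
  obtain ⟨y, rfl⟩ := h.surj u
  have hann : ∀ j f, (r j).1 ^ (e j : ℕ) ∣ f → aeval g f (x j) = 0 := by
    intro j f hf
    have := (h.ker_iff (Pi.single j f)).mpr (fun i => by
      by_cases hij : i = j
      · subst hij; simpa using hf
      · simp [Pi.single_eq_of_ne hij])
    rw [Finset.sum_eq_single j] at this
    · simpa using this
    · intro i _ hij; simp [Pi.single_eq_of_ne hij]
    · simp
  have hd : ∀ j, (r j).1 ^ (e j : ℕ) ∣ (X - C ε) ^ (i : ℕ) * y j := by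
    refine (h.ker_iff _).mp ?_
    simp only [map_mul, Module.End.mul_apply, ← map_sum, ← hNa]
    exact hu
  set R := LinearMap.ker (N ^ ((i : ℕ) - 1)) ⊔ (LinearMap.ker (N ^ ((i : ℕ) + 1))).map N with hR
  -- A generator of exponent below `i` is killed by `N ^ (i - 1)`. For an exponent `e > i`, being
  -- killed by `N ^ i` forces the coefficient to be divisible by `(t - ε) ^ (e - i)`, so the term is
  -- `N` of a vector killed by `N ^ (i + 1)`. Terms at other primes vanish.
  have hterm : ∀ j, (r j, e j) ≠ (s, i) → aeval g (y j) (x j) ∈ R := by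
    intro j hj
    by_cases hrj : r j = s
    · have hej : e j ≠ i := fun he => hj (by rw [hrj, he])
      have hej' : (e j : ℕ) ≠ i := fun he => hej (PNat.coe_injective he)
      have hdj := hd j
      rw [hrj, hs] at hdj
      rcases lt_or_gt_of_ne hej' with hlt | hlt
      · refine Submodule.mem_sup_left ?_
        rw [LinearMap.mem_ker, hNa, ← Module.End.mul_apply, ← map_mul]
        refine hann _ _ ?_
        rw [hrj, hs]
        exact (pow_dvd_pow _ (by omega)).mul_right _
      · obtain ⟨m, hm⟩ : ∃ m, (e j : ℕ) = i + (m + 1) := ⟨e j - i - 1, by omega⟩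
        rw [hm, pow_add, mul_dvd_mul_iff_left (pow_ne_zero _ (X_sub_C_ne_zero ε))] at hdj
        obtain ⟨z, hz⟩ := hdj
        refine Submodule.mem_sup_right ⟨aeval g ((X - C ε) ^ m * z) (x j), ?_, ?_⟩
        · rw [SetLike.mem_coe, LinearMap.mem_ker, hNa, ← Module.End.mul_apply, ← map_mul]
          refine hann _ _ ?_
          rw [hrj, hs, hm]
          exact ⟨z, by ring⟩
        · have h1 := hNa 1
          rw [pow_one, pow_one] at h1
          rw [h1, ← Module.End.mul_apply, ← map_mul, hz]
          congr 2; ring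
    · have : (r j).1 ^ (e j : ℕ) ∣ y j := by
        refine IsCoprime.dvd_of_dvd_mul_left ?_ (hd j)
        rw [← hs]
        exact (Phi.isCoprime hrj).pow
      rw [hann _ _ this]
      exact R.zero_mem
  -- On a generator of exponent exactly `i` only the value of the coefficient at `ε` matters: the
  -- rest is a multiple of `t - ε`.
  refine ⟨fun j => (y j.1).eval ε, ?_⟩
  have hsplit : ∑ j, aeval g (y j) (x j) =
      ∑ j : {j // (r j, e j) = (s, i)}, aeval g (y j.1) (x j.1) +
        ∑ j : {j // ¬(r j, e j) = (s, i)}, aeval g (y j.1) (x j.1) :=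
    (Fintype.sum_subtype_add_sum_subtype (fun j => (r j, e j) = (s, i))
      (fun j => aeval g (y j) (x j))).symm
  rw [hsplit, Fintype.linearCombination_apply, add_sub_right_comm, ← Finset.sum_sub_distrib]
  refine R.add_mem (R.sum_mem fun j _ => ?_) (R.sum_mem fun j _ => hterm j.1 j.2)
  obtain ⟨z, hz⟩ := X_sub_C_dvd_sub_C_eval (p := y j.1) (a := ε)
  have hrj : r j.1 = s := congrArg Prod.fst j.2
  have hej : e j.1 = i := congrArg Prod.snd j.2
  refine Submodule.mem_sup_right ⟨aeval g z (x j.1), ?_, ?_⟩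
  · rw [SetLike.mem_coe, LinearMap.mem_ker, hNa, ← Module.End.mul_apply, ← map_mul]
    refine hann _ _ ?_
    rw [hrj, hs, hej]
    exact (pow_dvd_pow _ (by omega)).mul_right _
  · have h1 := hNa 1
    rw [pow_one, pow_one] at h1
    rw [h1, ← Module.End.mul_apply, ← map_mul, ← hz, map_sub, aeval_C, LinearMap.sub_apply,
      Module.algebraMap_end_apply]

open Classical in
-- At a generator of exponent `i`, the relation says that `(t - ε) ^ i` divides `(t - ε) ^ i * y -
-- (t - ε) ^ (i - 1) * c`, and cancelling shows that `t - ε` divides the constant `c`.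
theorem Generates.eq_zero_of_mem {g : Module.End F V} {ι : Type*} [Fintype ι] {x : ι → V}
    {r : ι → Phi F} {e : ι → ℕ+} (h : Generates g x (fun j => (r j).1 ^ (e j : ℕ))) {ε : F}
    {s : Phi F} (hs : s.1 = X - C ε) {i : ℕ+} (c : {j // (r j, e j) = (s, i)} → F)
    (hc : ∃ z, ((g - algebraMap F (Module.End F V) ε) ^ (i : ℕ)) z =
      ((g - algebraMap F (Module.End F V) ε) ^ ((i : ℕ) - 1))
        (Fintype.linearCombination F (fun j : {j // (r j, e j) = (s, i)} => x j.1) c)) :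
    c = 0 := by
  set N := g - algebraMap F (Module.End F V) ε with hN
  have hNa : ∀ k : ℕ, N ^ k = aeval g ((X - C ε) ^ k) := fun k => by
    rw [map_pow, map_sub, aeval_X, aeval_C]
  obtain ⟨z, hz⟩ := hc
  obtain ⟨y, rfl⟩ := h.surj z
  let c' : ι → F := fun j => if hj : (r j, e j) = (s, i) then c ⟨j, hj⟩ else 0
  have hcc' : Fintype.linearCombination F (fun j : {j // (r j, e j) = (s, i)} => x j.1) c =
      ∑ j, aeval g (C (c' j)) (x j) := by
    rw [← Fintype.sum_subtype_add_sum_subtype (fun j => (r j, e j) = (s, i))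
      (fun j => aeval g (C (c' j)) (x j)), Fintype.linearCombination_apply]
    refine (left_eq_add.mpr (Finset.sum_eq_zero fun j _ => ?_)).trans (congrArg₂ _ ?_ rfl)
    · simp only [c', dif_neg j.2, map_zero, LinearMap.zero_apply]
    · refine Finset.sum_congr rfl fun j _ => ?_
      simp only [c', dif_pos j.2, aeval_C, Module.algebraMap_end_apply]
  have h0 : ∑ j, aeval g ((X - C ε) ^ (i : ℕ) * y j - (X - C ε) ^ ((i : ℕ) - 1) * C (c' j)) (x j) =
      0 := by
    rw [hcc', hNa, hNa, map_sum, map_sum, ← sub_eq_zero, ← Finset.sum_sub_distrib] at hz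
    simpa only [map_sub, map_mul, LinearMap.sub_apply, Module.End.mul_apply] using hz
  funext j
  have hj := (h.ker_iff _).mp h0 j.1
  have hrj : r j.1 = s := congrArg Prod.fst j.2
  have hej : e j.1 = i := congrArg Prod.snd j.2
  have hi := i.pos
  have hpow : (X - C ε) ^ (i : ℕ) = (X - C ε) ^ ((i : ℕ) - 1) * (X - C ε) := by
    rw [← pow_succ, Nat.sub_add_cancel hi]
  rw [hrj, hej, hs, hpow, mul_assoc, ← mul_sub,
    mul_dvd_mul_iff_left (pow_ne_zero _ (X_sub_C_ne_zero ε)), dvd_iff_isRoot] at hj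
  simpa [c', hrj, hej] using hj

end Blocks

/-! ### Forms with antidiagonal Gram matrix -/

section PlusForms

variable {F : Type*} [Field F]

/-- In suitable coordinates on an `m`-dimensional subspace, `h` has the antidiagonal Gram matrix. -/
def HasAntidiagonal {U : Type*} [AddCommGroup U] [Module F U] (h : LinearMap.BilinForm F U)
    (m : ℕ) : Prop :=
  ∃ w : Fin m → U, ∀ a b, h (w a) (w b) = if b = Fin.rev a then 1 else 0

/-- The bilinear form with antidiagonal Gram matrix. -/
def antidiagonalForm (F : Type*) [Field F] (m : ℕ) : LinearMap.BilinForm F (Fin m → F) :=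
  LinearMap.mk₂ F (fun c d => ∑ a, c a * d (Fin.rev a))
    (fun c c' d => by simp [add_mul, Finset.sum_add_distrib])
    (fun s c d => by simp [Finset.mul_sum, mul_assoc])
    (fun c d d' => by simp [mul_add, Finset.sum_add_distrib])
    (fun s c d => by simp [Finset.mul_sum, mul_left_comm])

theorem antidiagonalForm_apply (m : ℕ) (c d : Fin m → F) :
    antidiagonalForm F m c d = ∑ a, c a * d (Fin.rev a) := rfl

theorem isInner_antidiagonalForm (m : ℕ) : IsInner (antidiagonalForm F m) := by
  refine ⟨fun c d => ?_, fun c hc => ?_⟩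
  · rw [antidiagonalForm_apply, antidiagonalForm_apply, ← Equiv.sum_comp Fin.revPerm]
    simp [mul_comm]
  · funext a
    have := hc (Pi.single (Fin.rev a) 1)
    rw [antidiagonalForm_apply, Finset.sum_eq_single a] at this
    · simpa using this
    · intro b _ hb
      simp [Fin.rev_inj, hb]
    · simp

variable {U : Type*} [AddCommGroup U] [Module F U] {h : LinearMap.BilinForm F U} {U' : Type*}
  [AddCommGroup U'] [Module F U'] {h' : LinearMap.BilinForm F U'}

theorem hasAntidiagonal_iff {m : ℕ} :
    HasAntidiagonal h m ↔ IsometricTo (antidiagonalForm F m) h := by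
  constructor
  · rintro ⟨w, hw⟩
    refine ⟨Fintype.linearCombination F w, fun c d => ?_⟩
    simp only [Fintype.linearCombination_apply, map_sum, map_smul, LinearMap.sum_apply,
      LinearMap.smul_apply, smul_eq_mul, hw, antidiagonalForm_apply]
    simp only [Finset.mul_sum]
    rw [Finset.sum_comm]
    refine Finset.sum_congr rfl fun a _ => ?_
    simp [mul_comm]
  · rintro ⟨f, hf⟩
    refine ⟨fun a => f (Pi.single a 1), fun a b => ?_⟩
    rw [hf, antidiagonalForm_apply, Finset.sum_eq_single a]
    · simp [Pi.single_apply, eq_comm]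
    · intro i _ hi; simp [Pi.single_eq_of_ne hi]
    · simp

theorem IsometricTo.exists_equiv [FiniteDimensional F U] [FiniteDimensional F U']
    (hn : ∀ x, (∀ y, h x y = 0) → x = 0) (hd : Module.finrank F U = Module.finrank F U')
    (hi : IsometricTo h h') : ∃ f : U ≃ₗ[F] U', ∀ x y, h' (f x) (f y) = h x y := by
  obtain ⟨f, hf⟩ := hi
  have hinj : Function.Injective f := by
    rw [injective_iff_map_eq_zero]
    intro x hx
    exact hn x fun y => by rw [← hf, hx, map_zero, LinearMap.zero_apply]
  exact ⟨LinearEquiv.ofBijective f ⟨hinj,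
    (LinearMap.injective_iff_surjective_of_finrank_eq_finrank hd).mp hinj⟩, hf⟩

theorem IsometricTo.symm [FiniteDimensional F U] [FiniteDimensional F U']
    (hn : ∀ x, (∀ y, h x y = 0) → x = 0) (hd : Module.finrank F U = Module.finrank F U')
    (hi : IsometricTo h h') : IsometricTo h' h := by
  obtain ⟨f, hf⟩ := hi.exists_equiv hn hd
  exact ⟨f.symm.toLinearMap, fun x y => by rw [← hf]; simp⟩

theorem IsometricTo.trans {U'' : Type*} [AddCommGroup U''] [Module F U'']
    {h'' : LinearMap.BilinForm F U''} (h₁ : IsometricTo h h') (h₂ : IsometricTo h' h'') :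
    IsometricTo h h'' := by
  obtain ⟨f, hf⟩ := h₁
  obtain ⟨f', hf'⟩ := h₂
  exact ⟨f' ∘ₗ f, fun x y => by rw [LinearMap.comp_apply, LinearMap.comp_apply, hf', hf]⟩

/-- Among `h`, `h'` and the antidiagonal form two are isometric. If the antidiagonal form is one of
them, the equivalence makes it isometric to the third as well. -/
theorem IsInner.isometricTo_of_antidiagonal_iff [Finite F] (h2 : (2 : F) ≠ 0)
    [FiniteDimensional F U] [FiniteDimensional F U'] (hh : IsInner h) (hh' : IsInner h') {m : ℕ}
    (hm : Module.finrank F U = m) (hm' : Module.finrank F U' = m)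
    (hiff : HasAntidiagonal h m ↔ HasAntidiagonal h' m) : IsometricTo h h' := by
  have ha := isInner_antidiagonalForm (F := F) m
  have hda : Module.finrank F (Fin m → F) = m := by simp
  rw [hasAntidiagonal_iff, hasAntidiagonal_iff] at hiff
  rcases hh.isometric_trichotomy h2 m hh' ha hm hm' hda with h1 | h1 | h1
  · exact h1
  · exact h1.trans (hiff.mp (h1.symm hh.nondeg (hm.trans hda.symm)))
  · exact ((hiff.mpr (h1.symm hh'.nondeg (hm'.trans hda.symm))).symm ha.nondeg
      (hda.trans hm.symm)).trans (h1.symm hh'.nondeg (hm'.trans hda.symm))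

end PlusForms

/-! ### The forms on the multiplicity spaces, in coordinates -/

section BlockForms

variable {F : Type*} [Field F] {V : Type*} [AddCommGroup V] [Module F V]

/-- The form `(u, v) ↦ B (u, N ^ i v)` in the coordinates given by a family of vectors. -/
def blockForm (B : LinearMap.BilinForm F V) (N : Module.End F V) (i : ℕ) {J : Type*} [Fintype J]
    (x : J → V) : LinearMap.BilinForm F (J → F) :=
  B.compl₁₂ (Fintype.linearCombination F x) ((N ^ i) ∘ₗ Fintype.linearCombination F x)

theorem blockForm_apply (B : LinearMap.BilinForm F V) (N : Module.End F V) (i : ℕ) {J : Type*}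
    [Fintype J] (x : J → V) (c d : J → F) :
    blockForm B N i x c d = B (Fintype.linearCombination F x c)
      ((N ^ i) (Fintype.linearCombination F x d)) := rfl

variable {B : LinearMap.BilinForm F V} {g g' : Module.End F V} {ι : Type*} [Fintype ι] {x : ι → V}
  {r : ι → Phi F} {e : ι → ℕ+} {ε : F} {s : Phi F} {i : ℕ+}

open Classical in
theorem Generates.linearCombination_mem_ker
    (h : Generates g x (fun j => (r j).1 ^ (e j : ℕ))) (hs : s.1 = X - C ε)
    (c : {j // (r j, e j) = (s, i)} → F) :
    ((g - algebraMap F (Module.End F V) ε) ^ (i : ℕ))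
      (Fintype.linearCombination F (fun j : {j // (r j, e j) = (s, i)} => x j.1) c) = 0 := by
  rw [Fintype.linearCombination_apply, map_sum]
  refine Finset.sum_eq_zero fun j _ => ?_
  have hNa : (g - algebraMap F (Module.End F V) ε) ^ (i : ℕ) = aeval g ((X - C ε) ^ (i : ℕ)) := by
    rw [map_pow, map_sub, aeval_X, aeval_C]
  have := (h.ker_iff (Pi.single j.1 ((X - C ε) ^ (i : ℕ)))).mpr (fun l => by
    by_cases hl : l = j.1
    · subst hl
      have hrj : r j.1 = s := congrArg Prod.fst j.2
      have hej : e j.1 = i := congrArg Prod.snd j.2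
      rw [hrj, hej, hs, Pi.single_eq_same]
    · simp [Pi.single_eq_of_ne hl])
  rw [Finset.sum_eq_single j.1] at this
  · rw [Pi.single_eq_same] at this
    rw [map_smul, hNa, this, smul_zero]
  · intro l _ hl; simp [Pi.single_eq_of_ne hl]
  · simp

open Classical in
-- Both `u` and `v` differ from their block components by elements of the radical. The error in `v`
-- drops out directly, the one in `u` after exchanging the arguments.
theorem Generates.form_eq_blockForm (hB : IsSymplectic B) (hg : IsIsometryPair B g g')
    (hε : ε * ε = 1) (h : Generates g x (fun j => (r j).1 ^ (e j : ℕ))) (hs : s.1 = X - C ε)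
    {u v : V} (hu : ((g - algebraMap F (Module.End F V) ε) ^ (i : ℕ)) u = 0)
    {c d : {j // (r j, e j) = (s, i)} → F}
    (hc : u - Fintype.linearCombination F (fun j : {j // (r j, e j) = (s, i)} => x j.1) c ∈
        LinearMap.ker ((g - algebraMap F (Module.End F V) ε) ^ ((i : ℕ) - 1)) ⊔
          (LinearMap.ker ((g - algebraMap F (Module.End F V) ε) ^ ((i : ℕ) + 1))).map
            (g - algebraMap F (Module.End F V) ε))
    (hd : v - Fintype.linearCombination F (fun j : {j // (r j, e j) = (s, i)} => x j.1) d ∈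
        LinearMap.ker ((g - algebraMap F (Module.End F V) ε) ^ ((i : ℕ) - 1)) ⊔
          (LinearMap.ker ((g - algebraMap F (Module.End F V) ε) ^ ((i : ℕ) + 1))).map
            (g - algebraMap F (Module.End F V) ε)) :
    B u (((g - algebraMap F (Module.End F V) ε) ^ ((i : ℕ) - 1)) v) =
      blockForm B (g - algebraMap F (Module.End F V) ε) ((i : ℕ) - 1)
        (fun j : {j // (r j, e j) = (s, i)} => x j.1) c d := by
  have hkd := h.linearCombination_mem_ker hs d
  rw [blockForm_apply]
  obtain ⟨k, hk⟩ : ∃ k, (i : ℕ) = k + 1 := ⟨i - 1, (Nat.sub_add_cancel i.pos).symm⟩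
  rw [hk] at hu hc hd hkd ⊢
  rw [Nat.add_sub_cancel] at hc hd ⊢
  have h1 := hg.form_eq_zero_of_mem hε hu hd
  have h2 := hg.form_eq_zero_of_mem hε hkd hc
  rw [map_sub, map_sub, sub_eq_zero] at h1
  rw [h1]
  have h3 := hg.form_symm hB hε hkd
    (u - Fintype.linearCombination F (fun j : {j // (r j, e j) = (s, i)} => x j.1) c)
  rw [h2, mul_zero, map_sub, LinearMap.sub_apply, sub_eq_zero] at h3
  exact h3

open Classical in
theorem Generates.blockForm_symm (hB : IsSymplectic B) (hg : IsIsometryPair B g g')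
    (hε : ε * ε = 1) (h : Generates g x (fun j => (r j).1 ^ (e j : ℕ))) (hs : s.1 = X - C ε)
    (c d : {j // (r j, e j) = (s, i)} → F) :
    blockForm B (g - algebraMap F (Module.End F V) ε) ((i : ℕ) - 1)
        (fun j : {j // (r j, e j) = (s, i)} => x j.1) c d =
      (-1 : F) ^ (i : ℕ) * blockForm B (g - algebraMap F (Module.End F V) ε) ((i : ℕ) - 1)
        (fun j : {j // (r j, e j) = (s, i)} => x j.1) d c := by
  have hkd := h.linearCombination_mem_ker hs d
  rw [blockForm_apply, blockForm_apply]
  obtain ⟨k, hk⟩ : ∃ k, (i : ℕ) = k + 1 := ⟨i - 1, (Nat.sub_add_cancel i.pos).symm⟩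
  rw [hk] at hkd ⊢
  rw [Nat.add_sub_cancel]
  exact hg.form_symm hB hε hkd _

open Classical in
-- If the combination with coefficients `c` pairs to zero with the block, then its image under `(g -
-- ε) ^ (i - 1)` is orthogonal to `ker (g - ε) ^ i`, hence lies in the range of `(g - ε) ^ i`, which
-- forces `c = 0`.
theorem Generates.blockForm_nondeg [FiniteDimensional F V] (hB : IsSymplectic B)
    (hg : IsIsometryPair B g g')
    (hε : ε * ε = 1) (h : Generates g x (fun j => (r j).1 ^ (e j : ℕ))) (hs : s.1 = X - C ε)
    (c : {j // (r j, e j) = (s, i)} → F)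
    (hc : ∀ d, blockForm B (g - algebraMap F (Module.End F V) ε) ((i : ℕ) - 1)
        (fun j : {j // (r j, e j) = (s, i)} => x j.1) c d = 0) : c = 0 := by
  refine h.eq_zero_of_mem hs c (hg.exists_shift_pow_eq hB hε fun u hu => ?_)
  obtain ⟨d, hd⟩ := h.exists_ker_decomp hs hu
  rw [h.form_eq_blockForm hB hg hε hs hu hd (d := c)]
  · rw [h.blockForm_symm hB hg hε hs, hc, mul_zero]
  · rw [sub_self]; exact Submodule.zero_mem _

/-- The abstract version of `IsPlusType`. -/
def IsPlusTypeOf (B : LinearMap.BilinForm F V) (g : Module.End F V) (ε : F) (i m : ℕ) : Prop :=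
  ∃ w : Fin m → V, (∀ a, ((g - algebraMap F (Module.End F V) ε) ^ i) (w a) = 0) ∧
    ∀ a b, B (w a) (((g - algebraMap F (Module.End F V) ε) ^ (i - 1)) (w b)) =
      if b = Fin.rev a then 1 else 0

open Classical in
-- The form sees a vector of the kernel only through its block coordinates, so witnesses in `V` and
-- witnesses in coordinates can be exchanged.
theorem Generates.isPlusTypeOf_iff (hB : IsSymplectic B) (hg : IsIsometryPair B g g')
    (hε : ε * ε = 1) (h : Generates g x (fun j => (r j).1 ^ (e j : ℕ))) (hs : s.1 = X - C ε)
    (m : ℕ) :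
    IsPlusTypeOf B g ε i m ↔
      HasAntidiagonal (blockForm B (g - algebraMap F (Module.End F V) ε) ((i : ℕ) - 1)
        (fun j : {j // (r j, e j) = (s, i)} => x j.1)) m := by
  constructor
  · rintro ⟨w, hw, hG⟩
    choose c hc using fun a => h.exists_ker_decomp hs (hw a)
    exact ⟨c, fun a b => by rw [← hG, h.form_eq_blockForm hB hg hε hs (hw a) (hc a) (hc b)]⟩
  · rintro ⟨c, hc⟩
    exact ⟨fun a => Fintype.linearCombination F
      (fun j : {j // (r j, e j) = (s, i)} => x j.1) (c a),
      fun a => h.linearCombination_mem_ker hs _, fun a b => by rw [← hc, blockForm_apply]⟩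

end BlockForms

/-! ### Isometries with the same invariants are conjugate -/

section Classification

variable {F : Type*} [Field F] {V : Type*} [AddCommGroup V] [Module F V]
  {B : LinearMap.BilinForm F V}

/-- Since `g - g⁻¹ = g⁻¹ (g - 1)(g + 1)` and `2 ≠ 0`, the generalised kernel of `g - g⁻¹` is the sum
of those of `g - 1` and `g + 1`. -/
theorem IsIsometryPair.nilpotent_of_sq_sub {g g' : Module.End F V} (hg : IsIsometryPair B g g')
    (h2 : (2 : F) ≠ 0) {E : Module.End F V}
    {a₁ a₂ : ℕ} (h₁ : ∀ (k : ℕ) (v : V), ((g - algebraMap F (Module.End F V) 1) ^ k) v = 0 →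
      (E ^ a₁) v = 0)
    (h₂ : ∀ (k : ℕ) (v : V), ((g - algebraMap F (Module.End F V) (-1)) ^ k) v = 0 →
      (E ^ a₂) v = 0) (k : ℕ) (v : V) (hv : (((g - g') ^ 2) ^ k) v = 0) :
    (E ^ (a₁ + a₂)) v = 0 := by
  have hcop : IsCoprime ((X - C (1 : F)) ^ (2 * k)) ((X - C (-1 : F)) ^ (2 * k)) :=
    (isCoprime_X_sub_C_of_isUnit_sub (by
      rw [sub_neg_eq_add, one_add_one_eq_two]; exact IsUnit.mk0 _ h2)).pow
  have hN : ∀ ε : F, aeval g ((X - C ε) ^ (2 * k)) =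
      (g - algebraMap F (Module.End F V) ε) ^ (2 * k) := fun ε => by
    rw [map_pow, map_sub, aeval_X, aeval_C]
  have hfac : g - g' = g' * (aeval g ((X - C (1 : F)) * (X - C (-1 : F)))) := by
    simp only [map_mul, map_sub, aeval_X, map_one, map_neg]
    have : g' * ((g - 1) * (g - -1)) = g' * g * g - g' := by noncomm_ring
    rw [this, hg.inv_mul, one_mul]
  have hc : Commute g' (aeval g ((X - C (1 : F)) * (X - C (-1 : F)))) := by
    refine Algebra.adjoin_induction (R := F) (s := {g}) (p := fun x _ => Commute g' x) ?_ ?_ ?_ ?_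
      (Polynomial.aeval_mem_adjoin_singleton F g)
    · rintro x rfl; exact hg.commute.symm
    · intro a; exact Algebra.commute_algebraMap_right _ _
    · intro x y _ _ hx hy; exact hx.add_right hy
    · intro x y _ _ hx hy; exact hx.mul_right hy
  have h0 : aeval g (((X - C (1 : F)) * (X - C (-1 : F))) ^ (2 * k)) v = 0 := by
    rw [← pow_mul, hfac, hc.mul_pow] at hv
    have : (g ^ (2 * k)) ((g' ^ (2 * k) *
        (aeval g ((X - C (1 : F)) * (X - C (-1 : F)))) ^ (2 * k)) v) = 0 := by
      rw [hv, map_zero]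
    rw [← Module.End.mul_apply, ← mul_assoc, ← hg.commute.mul_pow, hg.mul_inv, one_pow, one_mul]
      at this
    rw [map_pow]
    exact this
  rw [mul_pow] at h0
  obtain ⟨α, β, hαβ⟩ := hcop
  have hv : v = aeval g (α * (X - C (1 : F)) ^ (2 * k)) v +
      aeval g (β * (X - C (-1 : F)) ^ (2 * k)) v := by
    rw [← LinearMap.add_apply, ← map_add, hαβ, map_one]; rfl
  rw [hv, map_add]
  have e1 : (E ^ a₂) (aeval g (α * (X - C (1 : F)) ^ (2 * k)) v) = 0 := by
    refine h₂ (2 * k) _ ?_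
    rw [← hN, ← Module.End.mul_apply, ← map_mul]
    have : (X - C (-1 : F)) ^ (2 * k) * (α * (X - C 1) ^ (2 * k)) =
      α * ((X - C 1) ^ (2 * k) * (X - C (-1)) ^ (2 * k)) := by ring
    rw [this, map_mul, Module.End.mul_apply, h0, map_zero]
  have e2 : (E ^ a₁) (aeval g (β * (X - C (-1 : F)) ^ (2 * k)) v) = 0 := by
    refine h₁ (2 * k) _ ?_
    rw [← hN, ← Module.End.mul_apply, ← map_mul]
    have : (X - C (1 : F)) ^ (2 * k) * (β * (X - C (-1)) ^ (2 * k)) =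
      β * ((X - C 1) ^ (2 * k) * (X - C (-1)) ^ (2 * k)) := by ring
    rw [this, map_mul, Module.End.mul_apply, h0, map_zero]
  rw [pow_add, Module.End.mul_apply, e1, map_zero, zero_add, ← pow_add, add_comm, pow_add,
    Module.End.mul_apply, e2, map_zero]

variable [Finite F] [FiniteDimensional F V] {V' : Type*} [AddCommGroup V'] [Module F V']
  [FiniteDimensional F V'] {B' : LinearMap.BilinForm F V'}

/-- Two invariant symplectic forms with the same forms on the multiplicity spaces at `t - 1` and
`t + 1` are equivalent under the centraliser. -/
theorem exists_commuting_isometry (h2 : (2 : F) ≠ 0) {B₂ : LinearMap.BilinForm F V}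
    (hB : IsSymplectic B) (hB₂ : IsSymplectic B₂) {g g' : Module.End F V}
    (hg : IsIsometryPair B g g') (hg₂ : IsIsometryPair B₂ g g')
    (hagree : ∀ ε : F, ε * ε = 1 → ∀ (i : ℕ) (u v : V),
      ((g - algebraMap F (Module.End F V) ε) ^ (i + 1)) u = 0 →
      ((g - algebraMap F (Module.End F V) ε) ^ (i + 1)) v = 0 →
      B₂ u (((g - algebraMap F (Module.End F V) ε) ^ i) v) =
        B u (((g - algebraMap F (Module.End F V) ε) ^ i) v)) :
    ∃ S : V ≃ₗ[F] V, (∀ x, S (g x) = g (S x)) ∧ ∀ x y, B (S x) (S y) = B₂ x y := by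
  have hinj : Function.Injective B := by
    rw [injective_iff_map_eq_zero]
    intro x hx
    exact hB.nondeg x fun y => by rw [hx]; rfl
  let b : V ≃ₗ[F] Module.Dual F V := LinearEquiv.ofBijective B ⟨hinj,
    (LinearMap.injective_iff_surjective_of_finrank_eq_finrank
      (Subspace.dual_finrank_eq (K := F) (V := V)).symm).mp hinj⟩
  -- `T` measures `B₂` against `B`. It is self-adjoint because both forms are alternating, and
  -- commutes with `g` because both are invariant. The required `S` is a solution of `S* S = T` in
  -- the centraliser.
  let T : Module.End F V := b.symm.toLinearMap ∘ₗ B₂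
  have hT : ∀ x y, B (T x) y = B₂ x y := fun x y => by
    have : b (T x) = B₂ x := by simp [T]
    exact LinearMap.congr_fun this y
  have hT' : ∀ x y, B x (T y) = B₂ x y := fun x y => by
    rw [hB.neg, hT, hB₂.neg, neg_neg]
  have hTg : Commute T g := by
    refine LinearMap.ext fun x => hB.ext_right fun y => ?_
    have hy : g (g' y) = y := by rw [← Module.End.mul_apply, hg.mul_inv]; rfl
    rw [Module.End.mul_apply, Module.End.mul_apply, hT', ← hy, hg₂.isom, hg.isom, hT']
  have hTu : IsUnit T := by
    rw [LinearMap.isUnit_iff_ker_eq_bot, LinearMap.ker_eq_bot']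
    intro x hx
    exact hB₂.nondeg x fun y => by rw [← hT, hx, map_zero, LinearMap.zero_apply]
  have hnil : ∀ ε : F, ε * ε = 1 → ∃ a : ℕ, ∀ (k : ℕ) (v : V),
      ((g - algebraMap F (Module.End F V) ε) ^ k) v = 0 → ((T - 1) ^ a) v = 0 := fun ε hε =>
    hg.nilpotent_of_agree hB hε hTg fun i u v hu hv => by rw [hT', hagree ε hε i u v hu hv]
  obtain ⟨a₁, h₁⟩ := hnil 1 (by ring)
  obtain ⟨a₂, h₂⟩ := hnil (-1) (by ring)
  obtain ⟨S, hS, hSB⟩ := hB.exists_adjoint_mul_self h2 hg.isom hg.mul_inv hg.inv_mul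
    (fun x y => by rw [hT, hT']) hTg hTu (a₁ + a₂) (hg.nilpotent_of_sq_sub h2 h₁ h₂)
  exact ⟨S, hS, fun x y => by rw [hSB, hT']⟩

open Classical in
-- For even `i` the block forms are symmetric, and plus type separates the at most two isometry
-- classes. For odd `i` they are alternating, and Witt's theorem for empty families makes them
-- isometric without further condition.
theorem exists_blockForm_equiv (h2 : (2 : F) ≠ 0) (hB : IsSymplectic B) (hB' : IsSymplectic B')
    {g g' : Module.End F V} {k k' : Module.End F V'} (hg : IsIsometryPair B g g')
    (hk : IsIsometryPair B' k k') {ι : Type*} [Fintype ι] {x : ι → V} {x' : ι → V'}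
    {r : ι → Phi F} {e : ι → ℕ+} (h : Generates g x (fun j => (r j).1 ^ (e j : ℕ)))
    (h' : Generates k x' (fun j => (r j).1 ^ (e j : ℕ)))
    {ε : F} (hε : ε * ε = 1) {s : Phi F} (hs : s.1 = X - C ε) {i : ℕ+}
    (hsign : Even (i : ℕ) →
      (IsPlusTypeOf B g ε i (Fintype.card {j // (r j, e j) = (s, i)}) ↔
        IsPlusTypeOf B' k ε i (Fintype.card {j // (r j, e j) = (s, i)}))) :
    ∃ L : ({j // (r j, e j) = (s, i)} → F) ≃ₗ[F] ({j // (r j, e j) = (s, i)} → F), ∀ c d,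
      blockForm B' (k - algebraMap F (Module.End F V') ε) ((i : ℕ) - 1)
        (fun j : {j // (r j, e j) = (s, i)} => x' j.1) (L c) (L d) =
      blockForm B (g - algebraMap F (Module.End F V) ε) ((i : ℕ) - 1)
        (fun j : {j // (r j, e j) = (s, i)} => x j.1) c d := by
  have hn := h.blockForm_nondeg hB hg hε hs (i := i)
  have hn' := h'.blockForm_nondeg hB' hk hε hs (i := i)
  have hsy := h.blockForm_symm hB hg hε hs (i := i)
  have hsy' := h'.blockForm_symm hB' hk hε hs (i := i)
  rcases Nat.even_or_odd (i : ℕ) with hi | hi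
  · rw [hi.neg_one_pow] at hsy hsy'
    simp only [one_mul] at hsy hsy'
    refine IsometricTo.exists_equiv hn rfl
      (IsInner.isometricTo_of_antidiagonal_iff h2 ⟨hsy, hn⟩ ⟨hsy', hn'⟩
        (m := Fintype.card {j // (r j, e j) = (s, i)}) (by simp) (by simp) ?_)
    rw [← h.isPlusTypeOf_iff hB hg hε hs, ← h'.isPlusTypeOf_iff hB' hk hε hs]
    exact hsign hi
  · rw [hi.neg_one_pow] at hsy hsy'
    have halt : ∀ {a : F}, a = -1 * a → a = 0 := by
      intro a ha
      have : 2 * a = 0 := by linear_combination ha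
      exact (mul_eq_zero.mp this).resolve_left h2
    obtain ⟨f, hf, -⟩ := IsSymplectic.exists_isometry (s := 0)
      ⟨fun c => halt (hsy c c), hn⟩ ⟨fun c => halt (hsy' c c), hn'⟩ rfl
      (w := Fin.elim0) (w' := Fin.elim0)
      (linearIndependent_empty_type) (linearIndependent_empty_type) (fun i => i.elim0)
    exact ⟨f, hf⟩

open Classical in
/-- Isometries with the same elementary divisors and the same types of forms at even powers of
`t - 1` and `t + 1` are conjugate. -/
theorem exists_intertwining_isometry (h2 : (2 : F) ≠ 0) (hB : IsSymplectic B)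
    (hB' : IsSymplectic B')
    {g g' : Module.End F V} {k k' : Module.End F V'} (hg : IsIsometryPair B g g')
    (hk : IsIsometryPair B' k k') {ι : Type*} [Fintype ι] {x : ι → V} {x' : ι → V'}
    {r : ι → Phi F} {e : ι → ℕ+} (h : Generates g x (fun j => (r j).1 ^ (e j : ℕ)))
    (h' : Generates k x' (fun j => (r j).1 ^ (e j : ℕ)))
    (hsign : ∀ (ε : F) (s : Phi F) (i : ℕ+), ε * ε = 1 → s.1 = X - C ε → Even (i : ℕ) →
      (IsPlusTypeOf B g ε i (Fintype.card {j // (r j, e j) = (s, i)}) ↔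
        IsPlusTypeOf B' k ε i (Fintype.card {j // (r j, e j) = (s, i)}))) :
    ∃ f : V ≃ₗ[F] V', (∀ u v, B' (f u) (f v) = B u v) ∧ ∀ v, f (g v) = k (f v) := by
  have hL : ∀ b : Phi F × ℕ+, ∃ L : ({j // (r j, e j) = b} → F) ≃ₗ[F] ({j // (r j, e j) = b} → F),
      ∀ ε : F, ε * ε = 1 → b.1.1 = X - C ε → ∀ c d,
      blockForm B' (k - algebraMap F (Module.End F V') ε) ((b.2 : ℕ) - 1)
        (fun j : {j // (r j, e j) = b} => x' j.1) (L c) (L d) =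
      blockForm B (g - algebraMap F (Module.End F V) ε) ((b.2 : ℕ) - 1)
        (fun j : {j // (r j, e j) = b} => x j.1) c d := by
    rintro ⟨s, i⟩
    by_cases hex : ∃ ε : F, ε * ε = 1 ∧ s.1 = X - C ε
    · obtain ⟨ε, hε, hs⟩ := hex
      obtain ⟨L, hL⟩ := exists_blockForm_equiv h2 hB hB' hg hk h h' hε hs (hsign ε s i hε hs)
      refine ⟨L, fun ε' _ hs' => ?_⟩
      have : ε' = ε := by
        have := hs'.symm.trans hs
        exact sub_eq_zero.mp (by simpa using (congrArg (eval ε') this).symm)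
      subst this
      exact hL
    -- Away from `t - 1` and `t + 1` nothing has to be matched.
    · exact ⟨LinearEquiv.refl _ _, fun ε hε hs => absurd ⟨ε, hε, hs⟩ hex⟩
  choose L hL using hL
  let bl : ι → Phi F × ℕ+ := fun j => (r j, e j)
  let Λ := blockEquiv bl L
  have hΛ : ∀ j l, Λ (Pi.single l 1) j ≠ 0 → bl j = bl l := by
    intro j l hne
    by_contra hjl
    refine hne ?_
    have : (fun m : {m // bl m = bl j} => (Pi.single l (1 : F) : ι → F) m.1) = 0 := by
      funext ⟨m, hm⟩
      exact Pi.single_eq_of_ne (fun hml => hjl (hm.symm.trans (congrArg bl hml))) _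
    change L (bl j) (fun m : {m // bl m = bl j} => (Pi.single l (1 : F) : ι → F) m.1) ⟨j, rfl⟩ = 0
    rw [this, map_zero]; rfl
  have hΛ' : ∀ j l, Λ.symm (Pi.single l 1) j ≠ 0 → bl j = bl l := by
    intro j l hne
    by_contra hjl
    refine hne ?_
    have : (fun m : {m // bl m = bl j} => (Pi.single l (1 : F) : ι → F) m.1) = 0 := by
      funext ⟨m, hm⟩
      exact Pi.single_eq_of_ne (fun hml => hjl (hm.symm.trans (congrArg bl hml))) _
    change (L (bl j)).symm (fun m : {m // bl m = bl j} => (Pi.single l (1 : F) : ι → F) m.1)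
      ⟨j, rfl⟩ = 0
    rw [this, map_zero]; rfl
  have hp : ∀ j l, bl j = bl l → (r j).1 ^ (e j : ℕ) = (r l).1 ^ (e l : ℕ) := by
    intro j l hjl
    rw [show r j = r l from congrArg Prod.fst hjl, show e j = e l from congrArg Prod.snd hjl]
  -- After this change of generators in `V'`, the map `f` carries the block forms of `B` to those of
  -- `B'`, so the pulled back form `B₂` agrees with `B` on the multiplicity spaces.
  have h'' := h'.change Λ (fun j l hne => hp j l (hΛ j l hne)) (fun j l hne => hp j l (hΛ' j l hne))
  obtain ⟨f, hf, hfx⟩ := h.exists_equiv h''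
  have hfk : ∀ v, f.symm (k v) = g (f.symm v) := fun v => by
    rw [LinearEquiv.symm_apply_eq, hf, LinearEquiv.apply_symm_apply]
  let B₂ : LinearMap.BilinForm F V := B'.compl₁₂ f.toLinearMap f.toLinearMap
  have hB₂a : ∀ u v, B₂ u v = B' (f u) (f v) := fun u v => rfl
  have hB₂ : IsSymplectic B₂ := ⟨fun u => hB'.alt _, fun u hu => by
    have := hB'.nondeg (f u) fun v => by
      have := hu (f.symm v)
      rwa [hB₂a, LinearEquiv.apply_symm_apply] at this
    simpa using this⟩
  have hg₂ : IsIsometryPair B₂ g g' := ⟨fun u v => by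
    rw [hB₂a, hB₂a, hf, hf, hk.isom], hg.mul_inv, hg.inv_mul⟩
  have hfN : ∀ (ε : F) (i : ℕ) (v : V), f (((g - algebraMap F (Module.End F V) ε) ^ i) v) =
      ((k - algebraMap F (Module.End F V') ε) ^ i) (f v) := by
    intro ε i
    induction i with
    | zero => intro v; rfl
    | succ i ih =>
      intro v
      rw [pow_succ, Module.End.mul_apply, ih, pow_succ, Module.End.mul_apply]
      simp [hf, Module.algebraMap_end_apply]
  have hfl : ∀ (b : Phi F × ℕ+) (c : {j // (r j, e j) = b} → F),
      f (Fintype.linearCombination F (fun j : {j // (r j, e j) = b} => x j.1) c) =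
      Fintype.linearCombination F (fun j : {j // (r j, e j) = b} => x' j.1) (L b c) := by
    intro b c
    suffices hm : f.toLinearMap ∘ₗ
        Fintype.linearCombination F (fun j : {j // (r j, e j) = b} => x j.1) =
        Fintype.linearCombination F (fun j : {j // (r j, e j) = b} => x' j.1) ∘ₗ
          (L b).toLinearMap from LinearMap.congr_fun hm c
    refine LinearMap.pi_ext' fun l => LinearMap.ext_ring ?_
    simp only [LinearMap.comp_apply, LinearMap.single_apply, LinearEquiv.coe_coe]
    rw [Fintype.linearCombination_apply_single, one_smul, hfx, Fintype.linearCombination_apply]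
    rw [← Fintype.sum_subtype_add_sum_subtype (fun j => (r j, e j) = b)
      (fun j => Λ (Pi.single l.1 1) j • x' j)]
    rw [add_eq_left.mpr (Finset.sum_eq_zero fun j _ => ?_)]
    · refine Finset.sum_congr rfl fun j _ => ?_
      congr 1
      obtain ⟨j, rfl⟩ := j
      change L (bl j) (fun m : {m // bl m = bl j} => (Pi.single l.1 (1 : F) : ι → F) m.1)
        ⟨j, rfl⟩ = L (bl j) (Pi.single l 1) ⟨j, rfl⟩
      refine congrFun (congrArg (L (bl j)) (funext fun m => ?_)) ⟨j, rfl⟩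
      simp only [Pi.single_apply, Subtype.ext_iff]
    · by_cases h0 : Λ (Pi.single l.1 1) j.1 = 0
      · rw [h0, zero_smul]
      · exact absurd ((hΛ _ _ h0).trans l.2) j.2
  obtain ⟨S, hS, hSB⟩ := exists_commuting_isometry h2 hB hB₂ hg hg₂ (by
    intro ε hε i u v hu hv
    by_cases hex : ∃ s : Phi F, s.1 = X - C ε
    · obtain ⟨s, hs⟩ := hex
      obtain ⟨c, hc⟩ := h.exists_ker_decomp hs (i := i.succPNat) hu
      obtain ⟨d, hd⟩ := h.exists_ker_decomp hs (i := i.succPNat) hv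
      have e1 := h.form_eq_blockForm hB hg hε hs (i := i.succPNat) hu hc hd
      have e2 := h.form_eq_blockForm hB₂ hg₂ hε hs (i := i.succPNat) hu hc hd
      have e3 := hL (s, i.succPNat) ε hε hs c d
      refine e2.trans (Eq.trans ?_ e1.symm)
      rw [← e3, blockForm_apply, blockForm_apply, hB₂a, hfN, ← hfl, ← hfl]
    · refine absurd ⟨Phi.linear ε (fun h0 => ?_), rfl⟩ hex
      rw [h0, zero_mul] at hε
      exact zero_ne_one hε)
  -- `S` takes `B₂` to `B` within the centraliser of `g`, so precomposing `f` with its inverse gives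
  -- an isometry that still intertwines.
  refine ⟨S.symm ≪≫ₗ f, fun u v => ?_, fun v => ?_⟩
  · rw [LinearEquiv.trans_apply, LinearEquiv.trans_apply, ← hB₂a, ← hSB,
      LinearEquiv.apply_symm_apply, LinearEquiv.apply_symm_apply]
  · rw [LinearEquiv.trans_apply, LinearEquiv.trans_apply, ← hf]
    congr 1
    rw [LinearEquiv.symm_apply_eq, hS, LinearEquiv.apply_symm_apply]

end Classification

/-! ### Ranks of self-adjoint operators and of adjoints -/

section SelfAdjointRank

variable {F : Type*} [Field F] {V : Type*} [AddCommGroup V] [Module F V]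

/-- A skew-symmetric matrix of odd size is singular when `2 ≠ 0`. -/
theorem IsSymplectic.even_finrank [FiniteDimensional F V] (h2 : (2 : F) ≠ 0)
    {B : LinearMap.BilinForm F V} (hB : IsSymplectic B) : Even (Module.finrank F V) := by
  by_contra hodd
  rw [Nat.not_even_iff_odd] at hodd
  let b := Module.finBasis F V
  let A : Matrix (Fin (Module.finrank F V)) (Fin (Module.finrank F V)) F :=
    Matrix.of fun i j => B (b i) (b j)
  have hA : A.transpose = -A := by
    ext i j
    exact hB.neg (b i) (b j)
  have hdet : A.det = 0 := by
    have h1 := A.det_transpose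
    rw [hA, Matrix.det_neg, Fintype.card_fin, hodd.neg_one_pow] at h1
    have : 2 * A.det = 0 := by linear_combination -h1
    exact (mul_eq_zero.mp this).resolve_left h2
  obtain ⟨c, hc, hAc⟩ := Matrix.exists_mulVec_eq_zero_iff.mpr hdet
  refine hc ?_
  have hz : ∑ j, c j • b j = 0 := by
    refine hB.nondeg_right _ fun x => ?_
    have : ∀ i, B (b i) (∑ j, c j • b j) = 0 := fun i => by
      rw [map_sum]
      simpa [Matrix.mulVec, dotProduct, A, mul_comm] using congrFun hAc i
    have h0 : B.flip (∑ j, c j • b j) = 0 := b.ext fun i => this i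
    exact LinearMap.congr_fun h0 x
  exact funext fun j => Fintype.linearIndependent_iff.mp b.linearIndependent c hz j

/-- The form `B (x, f y)` is alternating with radical `ker f`, so it is symplectic on a complement
of `ker f`, whose dimension is the rank of `f`. -/
theorem IsSymplectic.even_finrank_range [FiniteDimensional F V] (h2 : (2 : F) ≠ 0)
    {B : LinearMap.BilinForm F V} (hB : IsSymplectic B) {f : Module.End F V}
    (hf : ∀ x y, B (f x) y = B x (f y)) : Even (Module.finrank F (LinearMap.range f)) := by
  obtain ⟨W, hW⟩ := (LinearMap.ker f).exists_isCompl
  have hd : Module.finrank F (LinearMap.range f) = Module.finrank F W := by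
    have h1 := f.finrank_range_add_finrank_ker
    have h3 := Submodule.finrank_add_eq_of_isCompl hW
    omega
  rw [hd]
  let β : LinearMap.BilinForm F W := B.compl₁₂ W.subtype (f ∘ₗ W.subtype)
  have hβ : ∀ x y : W, β x y = B x (f y) := fun x y => rfl
  refine IsSymplectic.even_finrank h2 (B := β) ⟨fun x => ?_, fun x hx => ?_⟩
  · have h1 : B x.1 (f x.1) = -B x.1 (f x.1) := by
      nth_rewrite 1 [hB.neg, hf]; rfl
    have : 2 * B x.1 (f x.1) = 0 := by linear_combination h1
    exact (mul_eq_zero.mp this).resolve_left h2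
  · have h1 : f x.1 = 0 := by
      refine hB.nondeg _ fun y => ?_
      obtain ⟨k, hk, w, hw, rfl⟩ : ∃ k ∈ LinearMap.ker f, ∃ w ∈ W, k + w = y :=
        Submodule.mem_sup.mp (by rw [hW.sup_eq_top]; trivial)
      rw [hf, map_add, LinearMap.mem_ker.mp hk, zero_add]
      exact hx ⟨w, hw⟩
    exact Subtype.ext (Submodule.disjoint_def.mp hW.disjoint x.1 h1 x.2)

/-- Under the identification of `V` with its dual by `B`, the operator `f` becomes the transpose of
`f'`. -/
theorem IsSymplectic.finrank_range_adjoint [FiniteDimensional F V]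
    {B : LinearMap.BilinForm F V} (hB : IsSymplectic B) {f f' : Module.End F V}
    (hf : ∀ x y, B (f x) y = B x (f' y)) :
    Module.finrank F (LinearMap.range f) = Module.finrank F (LinearMap.range f') := by
  have hinj : Function.Injective B := by
    rw [injective_iff_map_eq_zero]
    intro x hx
    exact hB.nondeg x fun y => by rw [hx]; rfl
  have hs : Function.Surjective B :=
    (LinearMap.injective_iff_surjective_of_finrank_eq_finrank
      (Subspace.dual_finrank_eq (K := F) (V := V)).symm).mp hinj
  have h1 : B ∘ₗ f = f'.dualMap ∘ₗ B := by
    ext x y; exact hf x y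
  rw [← LinearMap.finrank_range_dualMap_eq_finrank_range f',
    ← LinearMap.range_comp_of_range_eq_top f'.dualMap (LinearMap.range_eq_top.mpr hs), ← h1,
    LinearMap.range_comp]
  exact (LinearEquiv.finrank_eq (Submodule.equivMapOfInjective B hinj _))

end SelfAdjointRank

/-! ### Constraints on the elementary divisors of an isometry -/

section Constraints

variable {F : Type*} [Field F] {V : Type*} [AddCommGroup V] [Module F V]
  {B : LinearMap.BilinForm F V} {g g' : Module.End F V}

theorem IsIsometryPair.symm (h : IsIsometryPair B g g') : IsIsometryPair B g' g := by
  refine ⟨fun x y => ?_, h.inv_mul, h.mul_inv⟩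
  rw [← h.isom (g' x), ← Module.End.mul_apply, ← Module.End.mul_apply, h.mul_inv]; rfl

theorem IsIsometryPair.aeval_adj (h : IsIsometryPair B g g') (f : F[X]) (x y : V) :
    B (aeval g f x) y = B x (aeval g' f y) := by
  induction f using Polynomial.induction_on generalizing x y with
  | C a => simp [Module.algebraMap_end_apply]
  | add p q hp hq => simp [hp, hq]
  | monomial n a ih =>
    have e1 : aeval g (C a * X ^ (n + 1)) x = aeval g (C a * X ^ n) (g x) := by
      rw [pow_succ, ← mul_assoc, map_mul, aeval_X]; rfl
    have e2 : aeval g' (C a * X ^ (n + 1)) y = g' (aeval g' (C a * X ^ n) y) := by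
      rw [pow_succ', mul_left_comm, map_mul, aeval_X]; rfl
    rw [e1, e2, ih, h.adj]

theorem aeval_reverse_of_inv (h : IsIsometryPair B g g') (f : F[X]) :
    aeval g f.reverse = aeval g' f * g ^ f.natDegree := by
  have hle : f.reverse.natDegree < f.natDegree + 1 := Nat.lt_succ_of_le f.reverse_natDegree_le
  rw [aeval_eq_sum_range' hle, aeval_eq_sum_range, Finset.sum_mul,
    ← Finset.sum_range_reflect]
  refine Finset.sum_congr rfl fun j hj => ?_
  have hj' : j ≤ f.natDegree := Nat.lt_succ_iff.mp (Finset.mem_range.mp hj)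
  rw [Nat.add_sub_cancel, coeff_reverse, revAt_le (Nat.sub_le _ _), Nat.sub_sub_self hj',
    smul_mul_assoc]
  congr 1
  nth_rewrite 2 [← Nat.add_sub_of_le hj']
  rw [pow_add, ← mul_assoc, ← h.commute.symm.mul_pow, h.inv_mul, one_pow, one_mul]

theorem Phi.coeff_zero_ne_zero (r : Phi F) : r.1.coeff 0 ≠ 0 := by
  intro h0
  have hd : X ∣ r.1 := X_dvd_iff.mpr h0
  exact r.2.2.2 (eq_of_monic_of_associated r.2.1 monic_X
    (irreducible_X.associated_of_dvd r.2.2.1 hd).symm)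

/-- Up to an invertible operator `r*(g)` is `r(g⁻¹)`, and this is the adjoint of `r(g)`. -/
theorem IsIsometryPair.finrank_range_star [FiniteDimensional F V] (hB : IsSymplectic B)
    (h : IsIsometryPair B g g') {r s : Phi F} (hs : s.1 = starPoly r.1) (i : ℕ) :
    Module.finrank F (LinearMap.range (aeval g (s.1 ^ i))) =
      Module.finrank F (LinearMap.range (aeval g (r.1 ^ i))) := by
  rw [hB.finrank_range_adjoint (h.aeval_adj (r.1 ^ i))]
  have hc : Commute (aeval g' r.1) g := by
    refine Algebra.adjoin_induction (R := F) (s := {g'}) (p := fun x _ => Commute x g) ?_ ?_ ?_ ?_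
      (Polynomial.aeval_mem_adjoin_singleton F g')
    · rintro x rfl; exact h.commute.symm
    · intro a; exact Algebra.commute_algebraMap_left _ _
    · intro x y _ _ hx hy; exact hx.add_left hy
    · intro x y _ _ hx hy; exact hx.mul_left hy
  have h1 : aeval g (s.1 ^ i) = (aeval g' (r.1 ^ i)) *
      (algebraMap F (Module.End F V) ((r.1.coeff 0)⁻¹ ^ i) * (g ^ r.1.natDegree) ^ i) := by
    rw [hs, starPoly, map_pow, map_mul, aeval_C, aeval_reverse_of_inv h,
      (Algebra.commutes (r.1.coeff 0)⁻¹ (aeval g' r.1 * g ^ r.1.natDegree)), mul_assoc,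
      ← Algebra.commutes (r.1.coeff 0)⁻¹ (g ^ r.1.natDegree), Commute.mul_pow, map_pow,
      Commute.mul_pow, map_pow]
    · exact Algebra.commute_algebraMap_left _ _
    · exact (Algebra.commute_algebraMap_right _ _).mul_right (hc.pow_right _)
  rw [h1, Module.End.mul_eq_comp, LinearMap.range_comp_of_range_eq_top]
  rw [LinearMap.range_eq_top]
  intro v
  refine ⟨algebraMap F (Module.End F V) (r.1.coeff 0 ^ i) ((g' ^ r.1.natDegree) ^ i • v), ?_⟩
  have h3 : (g ^ r.1.natDegree) ^ i * (g' ^ r.1.natDegree) ^ i = 1 := by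
    rw [← pow_mul, ← pow_mul, ← h.commute.mul_pow, h.mul_inv, one_pow]
  have h4 : algebraMap F (Module.End F V) ((r.1.coeff 0)⁻¹ ^ i) *
      algebraMap F (Module.End F V) (r.1.coeff 0 ^ i) = 1 := by
    rw [← map_mul, ← mul_pow, inv_mul_cancel₀ r.coeff_zero_ne_zero, one_pow, map_one]
  have h5 : algebraMap F (Module.End F V) ((r.1.coeff 0)⁻¹ ^ i) * (g ^ r.1.natDegree) ^ i *
      (algebraMap F (Module.End F V) (r.1.coeff 0 ^ i) * (g' ^ r.1.natDegree) ^ i) = 1 := by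
    rw [mul_assoc, ← mul_assoc ((g ^ r.1.natDegree) ^ i), ← Algebra.commutes, mul_assoc, h3, mul_one,
      h4]
  exact LinearMap.congr_fun h5 v

theorem Phi.natDegree_star {r s : Phi F} (hs : s.1 = starPoly r.1) :
    s.1.natDegree = r.1.natDegree := by
  rw [hs, starPoly, natDegree_C_mul (inv_ne_zero r.coeff_zero_ne_zero), reverse_natDegree,
    natTrailingDegree_eq_zero_of_constantCoeff_ne_zero r.coeff_zero_ne_zero, Nat.sub_zero]

theorem HasType.part_star [FiniteDimensional F V] (hB : IsSymplectic B)
    (h : IsIsometryPair B g g') {τ : Phi F →₀ Multiset ℕ+} (hτ : HasType g τ) {r s : Phi F}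
    (hs : s.1 = starPoly r.1) : τ s = τ r := by
  ext i
  have h1 := hτ.count_eq s i
  have h3 := hτ.count_eq r i
  rw [h.finrank_range_star hB hs, h.finrank_range_star hB hs, h.finrank_range_star hB hs, h3,
    Phi.natDegree_star hs] at h1
  exact_mod_cast (mul_left_cancel₀ (by exact_mod_cast r.natDegree_pos.ne') h1).symm

/-- The operator `(g - ε) ^ (2j) * g⁻¹ ^ j` is self-adjoint, so even powers of `g - ε` have even
rank. For odd `i` the multiplicity is the sum of the ranks at the even exponents `i - 1` and `i + 1`
minus twice the rank at `i`. -/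
theorem HasType.even_count [FiniteDimensional F V] (h2 : (2 : F) ≠ 0) (hB : IsSymplectic B)
    (h : IsIsometryPair B g g') {τ : Phi F →₀ Multiset ℕ+} (hτ : HasType g τ) {s : Phi F} {ε : F}
    (hε : ε * ε = 1) (hs : s.1 = X - C ε) {i : ℕ+} (hi : Odd (i : ℕ)) :
    Even ((τ s).count i) := by
  have key : ∀ k : ℕ, Even k → Even (Module.finrank F (LinearMap.range (aeval g (s.1 ^ k)))) := by
    rintro k ⟨j, rfl⟩
    rw [hs, map_pow, map_sub, aeval_X, aeval_C]
    set N := g - algebraMap F (Module.End F V) ε with hN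
    have hgN : Commute g N := (Commute.refl g).sub_right (Algebra.commute_algebraMap_right _ _)
    have hg'N : Commute g' N :=
      h.commute.symm.sub_right (Algebra.commute_algebraMap_right _ _)
    have hr : LinearMap.range (N ^ (j + j)) = LinearMap.range (N ^ (j + j) * g' ^ j) := by
      rw [Module.End.mul_eq_comp, LinearMap.range_comp_of_range_eq_top]
      rw [LinearMap.range_eq_top]
      intro v
      refine ⟨(g ^ j) v, ?_⟩
      rw [← Module.End.mul_apply, ← h.commute.symm.mul_pow, h.inv_mul, one_pow]; rfl
    rw [hr]
    refine hB.even_finrank_range h2 fun x y => ?_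
    have hadj : ∀ (n : ℕ) (x y : V), B ((g' ^ n) x) y = B x ((g ^ n) y) := by
      intro n
      have := h.symm.aeval_adj (X ^ n)
      simpa using this
    have hc : (-(algebraMap F (Module.End F V) ε * g')) ^ (j + j) = g' ^ (j + j) := by
      rw [(Even.add_self j).neg_pow, Commute.mul_pow (Algebra.commute_algebraMap_left _ _),
        ← map_pow, ← two_mul, pow_mul ε, pow_two, hε, one_pow, map_one, one_mul]
    rw [Module.End.mul_apply, h.shift_pow_adj hε, hadj, ← hN, hc]
    simp only [← Module.End.mul_apply]
    congr 2
    rw [← mul_assoc, (hgN.pow_pow j (j + j)).eq, mul_assoc, pow_add g', ← mul_assoc (g ^ j),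
      ← h.commute.mul_pow, h.mul_inv, one_pow, one_mul]
  have h1 := hτ.count_eq s i
  have hdeg : s.1.natDegree = 1 := by rw [hs, natDegree_X_sub_C]
  obtain ⟨a, ha⟩ := key (i - 1) (Nat.Odd.sub_odd hi odd_one)
  obtain ⟨b, hb⟩ := key (i + 1) (hi.add_odd odd_one)
  rw [ha, hb, hdeg] at h1
  have h3 : Even (((τ s).count i : ℕ) : ℤ) := by
    refine ⟨a - Module.finrank F (LinearMap.range (aeval g (s.1 ^ (i : ℕ)))) + b, ?_⟩
    push_cast at h1
    linarith
  exact_mod_cast h3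

end Constraints

/-! ### Labels and modified types of isometries -/

section Labels

variable {F : Type*} [Field F] {V : Type*} [AddCommGroup V] [Module F V]
  {V' : Type*} [AddCommGroup V'] [Module F V']

open Classical in
/-- The abstract version of `hermitianSign`. -/
def signOf (B : LinearMap.BilinForm F V) (g : Module.End F V) (ε : F) (p : Multiset ℕ+) (i : ℕ+) :
    SignType :=
  if Even (i : ℕ) ∧ 0 < p.count i then (if IsPlusTypeOf B g ε i (p.count i) then 1 else -1) else 0

/-- The abstract version of `HasLabel`. -/
def HasLabelOf (B : LinearMap.BilinForm F V) (g : Module.End F V) (σ : SignedMultipartition F) :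
    Prop :=
  HasType g σ.part ∧ (∀ i, σ.signSubOne i = signOf B g 1 (σ.part (Phi.tSubOne F)) i) ∧
    ∀ i, σ.signAddOne i = signOf B g (-1) (σ.part (Phi.tAddOne F)) i

/-- The abstract version of `HasModifiedType`. -/
def HasModifiedTypeOf (B : LinearMap.BilinForm F V) (g : Module.End F V)
    (μ : SymplecticModifiedType F) : Prop :=
  ∃ σ : SignedMultipartition F, HasLabelOf B g σ ∧ σ.modify = μ.1

variable {B : LinearMap.BilinForm F V} {B' : LinearMap.BilinForm F V'} {g g' : Module.End F V}
  {k k' : Module.End F V'}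

theorem HasLabelOf.unique {σ σ' : SignedMultipartition F} (h : HasLabelOf B g σ)
    (h' : HasLabelOf B g σ') : σ = σ' := by
  have hp := h.1.unique h'.1
  refine SignedMultipartition.ext hp ?_ ?_
  · funext i; rw [h.2.1, h'.2.1, hp]
  · funext i; rw [h.2.2, h'.2.2, hp]

theorem HasModifiedTypeOf.unique {μ ν : SymplecticModifiedType F} (h : HasModifiedTypeOf B g μ)
    (h' : HasModifiedTypeOf B g ν) : μ = ν := by
  obtain ⟨σ, hσ, hσμ⟩ := h
  obtain ⟨σ', hσ', hσν⟩ := h'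
  refine Subtype.ext ?_
  rw [← hσμ, ← hσν, hσ.unique hσ']

theorem exists_hasLabelOf [FiniteDimensional F V] (h : IsIsometryPair B g g') :
    ∃ σ, HasLabelOf B g σ := by
  have hinj : Function.Injective g := by
    intro x y hxy
    have := congrArg g' hxy
    rwa [← Module.End.mul_apply, ← Module.End.mul_apply, h.inv_mul] at this
  obtain ⟨τ, hτ⟩ := exists_hasType hinj
  exact ⟨⟨τ, signOf B g 1 (τ (Phi.tSubOne F)), signOf B g (-1) (τ (Phi.tAddOne F))⟩, hτ,
    fun _ => rfl, fun _ => rfl⟩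

theorem count_decrementParts (p : Multiset ℕ+) (i : ℕ+) :
    (decrementParts p).count i = p.count (i + 1) := by
  rw [decrementParts, Multiset.count_map, Multiset.count, Multiset.countP_eq_card_filter,
    Multiset.filter_filter]
  congr 1
  refine Multiset.filter_congr fun j _ => ?_
  constructor
  · rintro ⟨hi, hj⟩
    rw [hi, PNat.sub_add_of_lt hj]
  · rintro rfl
    exact ⟨(PNat.add_sub).symm ▸ rfl, PNat.lt_add_left 1 i⟩

theorem modify_part_tSubOne (σ : SignedMultipartition F) :
    σ.modify.part (Phi.tSubOne F) = decrementParts (σ.part (Phi.tSubOne F)) := by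
  classical
  change Finsupp.update _ _ _ _ = _
  rw [Finsupp.coe_update, Function.update_self]

theorem modify_part_of_ne (σ : SignedMultipartition F) {r : Phi F} (hr : r ≠ Phi.tSubOne F) :
    σ.modify.part r = σ.part r := by
  classical
  change Finsupp.update _ _ _ _ = _
  rw [Finsupp.coe_update, Function.update_of_ne hr]

theorem tSubOne_val : (Phi.tSubOne F).1 = X - C 1 := rfl

theorem tAddOne_val : (Phi.tAddOne F).1 = X - C (-1) := rfl

theorem tAddOne_ne_tSubOne (h2 : (2 : F) ≠ 0) : Phi.tAddOne F ≠ Phi.tSubOne F := by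
  intro h
  have := congrArg (fun s : Phi F => eval 1 s.1) h
  simp only [tSubOne_val, tAddOne_val] at this
  simp [one_add_one_eq_two, h2] at this

theorem starPoly_X_sub_one : starPoly (X - C 1 : F[X]) = X - C 1 := by
  ext n
  rw [starPoly, coeff_C_mul, coeff_reverse, natDegree_X_sub_C]
  rcases n with _ | _ | n
  · rw [revAt_le (Nat.zero_le 1)]
    simp [coeff_X, coeff_one]
  · rw [revAt_le le_rfl]
    simp [coeff_X, coeff_one]
  · rw [revAt_eq_self_of_lt (by omega)]
    simp [coeff_X, coeff_one]

/-- Ensures that changing the partition at `t - 1` alone does not disturb the symmetry `μ(r) =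
μ(r*)`. -/
theorem eq_tSubOne_of_star {r : Phi F} (h : (Phi.tSubOne F).1 = starPoly r.1) :
    r = Phi.tSubOne F := by
  have h0 := r.coeff_zero_ne_zero
  have hdeg : r.1.natDegree = 1 := by
    rw [← Phi.natDegree_star h, tSubOne_val, natDegree_X_sub_C]
  have hr : r.1 = X + C (r.1.coeff 0) := by
    have hm := r.2.1
    exact hm.eq_X_add_C hdeg
  have h1 := congrArg (fun p : F[X] => p.coeff 0) h
  have h3 : starPoly r.1 = C (r.1.coeff 0)⁻¹ * r.1.reverse := rfl
  have h4 : r.1.leadingCoeff = 1 := r.2.1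
  simp only [h3, tSubOne_val, coeff_C_mul, coeff_zero_reverse, h4] at h1
  simp only [coeff_sub, coeff_X_zero, coeff_C_zero, zero_sub, mul_one] at h1
  refine Phi.ext_iff'.mpr (hr.trans ?_)
  rw [← inv_inv (r.1.coeff 0), ← h1, tSubOne_val]
  simp [sub_eq_add_neg, inv_neg]

theorem signOf_ne_zero_iff (B : LinearMap.BilinForm F V) (g : Module.End F V) (ε : F)
    (p : Multiset ℕ+) (i : ℕ+) : signOf B g ε p i ≠ 0 ↔ Even (i : ℕ) ∧ 0 < p.count i := by
  unfold signOf
  split_ifs with h1 h2 <;> simp [h1]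

/-- Subtracting `1` exchanges parities, which turns the symplectic condition at `t - 1` into the
orthogonal one. The parts `1` that disappear are odd and carry no sign. -/
theorem HasLabelOf.exists_modifiedType [FiniteDimensional F V] (h2 : (2 : F) ≠ 0)
    (hB : IsSymplectic B) (h : IsIsometryPair B g g') {σ : SignedMultipartition F}
    (hσ : HasLabelOf B g σ) : ∃ μ : SymplecticModifiedType F, σ.modify = μ.1 := by
  refine ⟨⟨σ.modify, fun r s hs => ?_, ⟨fun i hi => ?_, fun i => ?_⟩, fun i hi => ?_,
    fun i => ?_⟩, rfl⟩
  · by_cases hr : r = Phi.tSubOne F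
    · have : s = Phi.tSubOne F := by
        refine Phi.ext_iff'.mpr (hs.trans ?_)
        rw [hr]
        exact starPoly_X_sub_one
      rw [this, hr]
    · have hs' : s ≠ Phi.tSubOne F := by
        rintro rfl
        exact hr (eq_tSubOne_of_star hs)
      rw [modify_part_of_ne σ hr, modify_part_of_ne σ hs', hσ.1.part_star hB h hs]
  · rw [modify_part_tSubOne, count_decrementParts]
    refine hσ.1.even_count h2 hB h (one_mul 1) tSubOne_val ?_
    rw [PNat.add_coe]
    exact hi.add_one
  · rw [modify_part_tSubOne, count_decrementParts]
    change σ.signSubOne (i + 1) ≠ 0 ↔ _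
    rw [hσ.2.1, signOf_ne_zero_iff, PNat.add_coe, PNat.one_coe, Nat.even_add_one,
      Nat.not_even_iff_odd]
  · rw [modify_part_of_ne σ (tAddOne_ne_tSubOne h2)]
    exact hσ.1.even_count h2 hB h (by ring) tAddOne_val hi
  · rw [modify_part_of_ne σ (tAddOne_ne_tSubOne h2)]
    change σ.signAddOne i ≠ 0 ↔ _
    rw [hσ.2.2, signOf_ne_zero_iff]

theorem exists_hasModifiedTypeOf [FiniteDimensional F V] (h2 : (2 : F) ≠ 0)
    (hB : IsSymplectic B) (h : IsIsometryPair B g g') : ∃ μ, HasModifiedTypeOf B g μ := by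
  obtain ⟨σ, hσ⟩ := exists_hasLabelOf h
  obtain ⟨μ, hμ⟩ := hσ.exists_modifiedType h2 hB h
  exact ⟨μ, σ, hσ, hμ⟩

theorem aeval_apply_of_intertwining (f : V ≃ₗ[F] V') (hf : ∀ v, f (g v) = k (f v)) (y : F[X])
    (v : V) : f (aeval g y v) = aeval k y (f v) := by
  induction y using Polynomial.induction_on generalizing v with
  | C a => simp [Module.algebraMap_end_apply]
  | add p q hp hq => simp [hp, hq]
  | monomial n a ih =>
    have e1 : aeval g (C a * X ^ (n + 1)) v = aeval g (C a * X ^ n) (g v) := by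
      rw [pow_succ, ← mul_assoc, map_mul _ _ X, aeval_X, Module.End.mul_apply]
    have e2 : aeval k (C a * X ^ (n + 1)) (f v) = aeval k (C a * X ^ n) (k (f v)) := by
      rw [pow_succ, ← mul_assoc, map_mul _ _ X, aeval_X, Module.End.mul_apply]
    rw [e1, e2, ih, hf]

theorem HasType.map {τ : Phi F →₀ Multiset ℕ+} (h : HasType g τ) (f : V ≃ₗ[F] V')
    (hf : ∀ v, f (g v) = k (f v)) : HasType k τ := by
  obtain ⟨n, r, e, x, hx, hc⟩ := h.exists_generates
  have hs : ∀ y : Fin n → F[X], ∑ j, aeval k (y j) (f (x j)) = f (∑ j, aeval g (y j) (x j)) := by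
    intro y
    simp only [map_sum, aeval_apply_of_intertwining f hf]
  have : Generates k (fun j => f (x j)) (fun j => (r j).1 ^ (e j : ℕ)) := by
    refine ⟨fun v => ?_, fun y => ?_⟩
    · obtain ⟨y, hy⟩ := hx.surj (f.symm v)
      exact ⟨y, by rw [hs, hy, LinearEquiv.apply_symm_apply]⟩
    · rw [hs, LinearEquiv.map_eq_zero_iff, hx.ker_iff]
  exact ⟨n, r, e, this.equiv, hc⟩

theorem IsPlusTypeOf.map {ε : F} {i m : ℕ} (h : IsPlusTypeOf B g ε i m) (f : V ≃ₗ[F] V')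
    (hf : ∀ v, f (g v) = k (f v)) (hfB : ∀ x y, B' (f x) (f y) = B x y) :
    IsPlusTypeOf B' k ε i m := by
  obtain ⟨w, hw, hG⟩ := h
  have hN : ∀ (i : ℕ) v, ((k - algebraMap F (Module.End F V') ε) ^ i) (f v) =
      f (((g - algebraMap F (Module.End F V) ε) ^ i) v) := by
    intro i v
    have := aeval_apply_of_intertwining f hf ((X - C ε) ^ i) v
    simpa using this.symm
  refine ⟨fun a => f (w a), fun a => by rw [hN, hw, map_zero], fun a b => ?_⟩
  rw [hN, hfB, hG]

theorem signOf_eq_of_isometry (f : V ≃ₗ[F] V') (hf : ∀ v, f (g v) = k (f v))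
    (hfB : ∀ x y, B' (f x) (f y) = B x y) (ε : F) (p : Multiset ℕ+) (i : ℕ+) :
    signOf B g ε p i = signOf B' k ε p i := by
  have : IsPlusTypeOf B g ε i (p.count i) ↔ IsPlusTypeOf B' k ε i (p.count i) :=
    ⟨fun h => h.map f hf hfB, fun h => h.map f.symm
      (fun v => by rw [LinearEquiv.symm_apply_eq, hf, LinearEquiv.apply_symm_apply])
      (fun x y => by rw [← hfB]; simp)⟩
  unfold signOf
  split_ifs <;> simp_all

theorem HasModifiedTypeOf.map {μ : SymplecticModifiedType F} (h : HasModifiedTypeOf B g μ)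
    (f : V ≃ₗ[F] V') (hf : ∀ v, f (g v) = k (f v)) (hfB : ∀ x y, B' (f x) (f y) = B x y) :
    HasModifiedTypeOf B' k μ := by
  obtain ⟨σ, hσ, hσμ⟩ := h
  exact ⟨σ, ⟨hσ.1.map f hf, fun i => by rw [hσ.2.1, signOf_eq_of_isometry f hf hfB],
    fun i => by rw [hσ.2.2, signOf_eq_of_isometry f hf hfB]⟩, hσμ⟩

theorem decrementParts_sum (p : Multiset ℕ+) :
    (p.map (fun i : ℕ+ => (i : ℕ))).sum =
      ((decrementParts p).map (fun i : ℕ+ => (i : ℕ) + 1)).sum + p.count 1 := by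
  have hp : p = p.filter (fun i => 1 < i) + Multiset.replicate (p.count 1) 1 := by
    nth_rewrite 1 [← Multiset.filter_add_not (fun i => 1 < i) p]
    congr 1
    rw [← Multiset.filter_eq']
    refine Multiset.filter_congr fun i _ => ?_
    rw [not_lt]
    exact ⟨fun h => le_antisymm h one_le, fun h => h.le⟩
  nth_rewrite 1 [hp]
  rw [Multiset.map_add, Multiset.sum_add, decrementParts, Multiset.map_map]
  congr 1
  · congr 1
    refine Multiset.map_congr rfl fun i hi => ?_
    have h1 : (1 : ℕ+) < i := (Multiset.mem_filter.mp hi).2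
    have : ((i - 1 + 1 : ℕ+) : ℕ) = i := by rw [PNat.sub_add_of_lt h1]
    rw [Function.comp_apply, ← this, PNat.add_coe, PNat.one_coe]
  · simp

/-- The modified type forgets only the number of parts `1` at `t - 1`, and the dimension of the
space gives it back. -/
theorem HasLabelOf.eq_of_modify_eq [FiniteDimensional F V] [FiniteDimensional F V']
    {σ σ' : SignedMultipartition F} (h : HasLabelOf B g σ) (h' : HasLabelOf B' k σ')
    (hd : Module.finrank F V = Module.finrank F V') (hσ : σ.modify = σ'.modify) :
    σ = σ' := by
  classical
  have hne : ∀ r, r ≠ Phi.tSubOne F → σ.part r = σ'.part r := fun r hr => by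
    rw [← modify_part_of_ne σ hr, hσ, modify_part_of_ne σ' hr]
  have hdec : decrementParts (σ.part (Phi.tSubOne F)) = decrementParts (σ'.part (Phi.tSubOne F)) := by
    rw [← modify_part_tSubOne, hσ, modify_part_tSubOne]
  have herase : σ.part.erase (Phi.tSubOne F) = σ'.part.erase (Phi.tSubOne F) := by
    ext1 r
    by_cases hr : r = Phi.tSubOne F
    · rw [hr, Finsupp.erase_same, Finsupp.erase_same]
    · rw [Finsupp.erase_ne hr, Finsupp.erase_ne hr, hne r hr]
  have hone : (σ.part (Phi.tSubOne F)).count 1 = (σ'.part (Phi.tSubOne F)).count 1 := by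
    have h1 := h.1.finrank_eq
    have h3 := h'.1.finrank_eq
    rw [← Finsupp.add_sum_erase' _ (Phi.tSubOne F) _ (by simp)] at h1 h3
    rw [herase, hd, h3] at h1
    have h4 := Nat.add_right_cancel h1
    rw [tSubOne_val, natDegree_X_sub_C, one_mul, one_mul, decrementParts_sum, decrementParts_sum,
      hdec] at h4
    exact (Nat.add_left_cancel h4).symm
  have hpart : σ.part = σ'.part := by
    ext r i
    by_cases hr : r = Phi.tSubOne F
    · subst hr
      rcases eq_or_ne i 1 with rfl | hi
      · exact hone
      · obtain ⟨j, rfl⟩ := PNat.exists_eq_succ_of_ne_one hi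
        rw [← count_decrementParts, hdec, count_decrementParts]
    · rw [hne r hr]
  refine SignedMultipartition.ext hpart ?_ ?_
  · funext i
    rcases eq_or_ne i 1 with rfl | hi
    · rw [h.2.1, h'.2.1]
      simp [signOf]
    · obtain ⟨j, rfl⟩ := PNat.exists_eq_succ_of_ne_one hi
      exact congrFun (congrArg SignedMultipartition.signSubOne hσ) j
  · exact (congrArg SignedMultipartition.signAddOne hσ :
      σ.modify.signAddOne = σ'.modify.signAddOne)

end Labels

/-! ### Conjugacy by modified type, and stability under identity summands -/

section Classification

variable {F : Type*} [Field F] {V : Type*} [AddCommGroup V] [Module F V]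
  {V' : Type*} [AddCommGroup V'] [Module F V']
  {B : LinearMap.BilinForm F V} {B' : LinearMap.BilinForm F V'} {g g' : Module.End F V}
  {k k' : Module.End F V'}

theorem HasType.exists_common_generators {τ : Phi F →₀ Multiset ℕ+} (h : HasType g τ)
    (h' : HasType k τ) :
    ∃ (n : ℕ) (r : Fin n → Phi F) (e : Fin n → ℕ+) (x : Fin n → V) (x' : Fin n → V'),
      Generates g x (fun j => (r j).1 ^ (e j : ℕ)) ∧
      Generates k x' (fun j => (r j).1 ^ (e j : ℕ)) ∧
      ∀ (s : Phi F) (i : ℕ+), (τ s).count i = Nat.card {j : Fin n // r j = s ∧ e j = i} := by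
  obtain ⟨n, r, e, x, hx, hc⟩ := h.exists_generates
  obtain ⟨n', r', e', x', hx', hc'⟩ := h'.exists_generates
  have key : ∀ c : Phi F × ℕ+, Nonempty ({j : Fin n // (r j, e j) = c} ≃
      {j : Fin n' // (r' j, e' j) = c}) := by
    rintro ⟨s, i⟩
    simp only [Prod.mk.injEq]
    exact ⟨(Finite.card_eq.mp ((hc s i).symm.trans (hc' s i))).some⟩
  let σ : Fin n ≃ Fin n' := Equiv.ofFiberEquiv (f := fun j => (r j, e j))
    (g := fun j => (r' j, e' j)) fun c => (key c).some
  have hσ : ∀ j, (r' (σ j), e' (σ j)) = (r j, e j) := fun j =>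
    Equiv.ofFiberEquiv_map (f := fun j => (r j, e j)) (g := fun j => (r' j, e' j)) _ j
  refine ⟨n, r, e, x, fun j => x' (σ j), hx, ?_, hc⟩
  have h1 := hx'.reindex σ
  have h2 : (fun j => (r' (σ j)).1 ^ (e' (σ j) : ℕ)) = fun j => (r j).1 ^ (e j : ℕ) := by
    funext j
    obtain ⟨h3, h4⟩ := Prod.mk.inj (hσ j)
    rw [h4]
    exact congrArg (fun s : Phi F => s.1 ^ (e j : ℕ)) h3
  exact h2 ▸ h1

theorem signOf_eq_iff {p : Multiset ℕ+} {ε : F} {i : ℕ+} (hi : Even (i : ℕ))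
    (h : signOf B g ε p i = signOf B' k ε p i) :
    IsPlusTypeOf B g ε i (p.count i) ↔ IsPlusTypeOf B' k ε i (p.count i) := by
  rcases Nat.eq_zero_or_pos (p.count i) with h0 | h0
  -- No sign is recorded for an absent part size, but then the empty family shows plus type on both
  -- sides.
  · rw [h0]
    exact ⟨fun _ => ⟨Fin.elim0, fun a => a.elim0, fun a => a.elim0⟩,
      fun _ => ⟨Fin.elim0, fun a => a.elim0, fun a => a.elim0⟩⟩
  · unfold signOf at h
    have hc : Even (i : ℕ) ∧ 0 < p.count i := ⟨hi, h0⟩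
    rw [if_pos hc, if_pos hc] at h
    by_cases h1 : IsPlusTypeOf B g ε i (p.count i) <;>
      by_cases h2 : IsPlusTypeOf B' k ε i (p.count i) <;>
      simp only [h1, h2, if_true, if_false] at h ⊢ <;> exact absurd h (by decide)

/-- Two isometries of symplectic spaces of the same dimension and of the same modified type are
conjugate. -/
theorem HasModifiedTypeOf.exists_intertwining [Finite F] [FiniteDimensional F V]
    [FiniteDimensional F V'] (h2 : (2 : F) ≠ 0) (hB : IsSymplectic B) (hB' : IsSymplectic B')
    (hg : IsIsometryPair B g g') (hk : IsIsometryPair B' k k')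
    (hd : Module.finrank F V = Module.finrank F V') {μ : SymplecticModifiedType F}
    (h : HasModifiedTypeOf B g μ) (h' : HasModifiedTypeOf B' k μ) :
    ∃ f : V ≃ₗ[F] V', (∀ u v, B' (f u) (f v) = B u v) ∧ ∀ v, f (g v) = k (f v) := by
  classical
  obtain ⟨σ, hσ, hσμ⟩ := h
  obtain ⟨σ', hσ', hσμ'⟩ := h'
  obtain rfl : σ = σ' := hσ.eq_of_modify_eq hσ' hd (hσμ.trans hσμ'.symm)
  obtain ⟨n, r, e, x, x', hx, hx', hc⟩ := hσ.1.exists_common_generators hσ'.1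
  refine exists_intertwining_isometry h2 hB hB' hg hk hx hx' fun ε s i hε hs hi => ?_
  have hcard : Fintype.card {j : Fin n // (r j, e j) = (s, i)} = (σ.part s).count i := by
    rw [hc, Nat.card_eq_fintype_card]
    exact Fintype.card_congr (Equiv.subtypeEquivRight fun j => Prod.mk_inj)
  have hcard' : ∀ m, m = (σ.part s).count i →
      (IsPlusTypeOf B g ε i m ↔ IsPlusTypeOf B' k ε i m) := by
    rintro _ rfl
    refine signOf_eq_iff hi ?_
    rcases mul_self_eq_one_iff.mp hε with rfl | rfl
    · obtain rfl : s = Phi.tSubOne F := Phi.ext_iff'.mpr hs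
      rw [← hσ.2.1, hσ'.2.1]
    · obtain rfl : s = Phi.tAddOne F := Phi.ext_iff'.mpr hs
      rw [← hσ.2.2, hσ'.2.2]
  exact hcard' _ (by rw [← hcard])

/-- The orthogonal sum of two bilinear forms. -/
def prodForm (B : LinearMap.BilinForm F V) (B' : LinearMap.BilinForm F V') :
    LinearMap.BilinForm F (V × V') :=
  B.compl₁₂ (LinearMap.fst F V V') (LinearMap.fst F V V') +
    B'.compl₁₂ (LinearMap.snd F V V') (LinearMap.snd F V V')

theorem prodForm_apply (x y : V × V') : prodForm B B' x y = B x.1 y.1 + B' x.2 y.2 := rfl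

theorem IsSymplectic.prodForm (hB : IsSymplectic B) (hB' : IsSymplectic B') :
    IsSymplectic (prodForm B B') := by
  refine ⟨fun x => by rw [prodForm_apply, hB.alt, hB'.alt, add_zero], fun x hx => ?_⟩
  refine Prod.ext (hB.nondeg _ fun y => ?_) (hB'.nondeg _ fun y => ?_)
  · simpa [prodForm_apply] using hx (y, 0)
  · simpa [prodForm_apply] using hx (0, y)

theorem IsIsometryPair.prodMap (h : IsIsometryPair B g g') (h' : IsIsometryPair B' k k') :
    IsIsometryPair (SpCentre.prodForm B B') (g.prodMap k) (g'.prodMap k') := by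
  refine ⟨fun x y => ?_, ?_, ?_⟩
  · simp [prodForm_apply, h.isom, h'.isom]
  · exact LinearMap.ext fun x => Prod.ext (LinearMap.congr_fun h.mul_inv x.1)
      (LinearMap.congr_fun h'.mul_inv x.2)
  · exact LinearMap.ext fun x => Prod.ext (LinearMap.congr_fun h.inv_mul x.1)
      (LinearMap.congr_fun h'.inv_mul x.2)

theorem IsIsometryPair.one (B : LinearMap.BilinForm F V) : IsIsometryPair B 1 1 :=
  ⟨fun _ _ => rfl, one_mul 1, one_mul 1⟩

theorem aeval_prodMap (p : F[X]) : aeval (g.prodMap k) p = (aeval g p).prodMap (aeval k p) := by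
  have h1 := aeval_algHom_apply (LinearMap.prodMapAlgHom F V V') (g, k) p
  have h2 : aeval (g, k) p = (aeval g p, aeval k p) := Prod.ext
    (aeval_algHom_apply (AlgHom.fst F (Module.End F V) (Module.End F V')) (g, k) p).symm
    (aeval_algHom_apply (AlgHom.snd F (Module.End F V) (Module.End F V')) (g, k) p).symm
  rw [h2] at h1
  exact h1

theorem finrank_range_prodMap [FiniteDimensional F V] [FiniteDimensional F V'] :
    Module.finrank F (LinearMap.range (g.prodMap k)) =
      Module.finrank F (LinearMap.range g) + Module.finrank F (LinearMap.range k) := by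
  have e : LinearMap.range (g.prodMap k) ≃ₗ[F] LinearMap.range g × LinearMap.range k :=
    (LinearEquiv.ofEq _ _ (LinearMap.range_prodMap g k)).trans
      { toFun := fun x => (⟨x.1.1, x.2.1⟩, ⟨x.1.2, x.2.2⟩)
        invFun := fun x => ⟨(x.1, x.2), x.1.2, x.2.2⟩
        map_add' := fun _ _ => rfl
        map_smul' := fun _ _ => rfl }
  rw [e.finrank_eq, Module.finrank_prod]

open Classical in
theorem finrank_range_aeval_one (p : F[X]) :
    Module.finrank F (LinearMap.range (aeval (1 : Module.End F V') p)) =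
      if p.eval 1 = 0 then 0 else Module.finrank F V' := by
  have : aeval (1 : Module.End F V') p = algebraMap F _ (p.eval 1) := by
    rw [← map_one (algebraMap F (Module.End F V')), aeval_algebraMap_apply_eq_algebraMap_eval]
  rw [this]
  split_ifs with h
  · rw [h, map_zero, LinearMap.range_zero, finrank_bot]
  · rw [LinearMap.range_eq_top.mpr, finrank_top]
    intro v
    exact ⟨(p.eval 1)⁻¹ • v, by rw [Module.algebraMap_end_apply, smul_inv_smul₀ h]⟩

theorem Phi.eval_one_ne_zero {s : Phi F} (hs : s ≠ Phi.tSubOne F) : s.1.eval 1 ≠ 0 := by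
  intro h
  refine hs (Phi.ext_iff'.mpr ?_)
  have h1 : X - C 1 ∣ s.1 := dvd_iff_isRoot.mpr h
  exact (eq_of_monic_of_associated (monic_X_sub_C 1) s.2.1
    ((irreducible_X_sub_C 1).associated_of_dvd s.2.2.1 h1)).symm

/-- On the identity summand `s ^ j` acts by the scalar `s(1) ^ j`, of rank independent of `j` if `s
≠ t - 1`, and zero for `j > 0` if `s = t - 1`. In either case the contribution to the ranks at `i -
1`, `i`, `i + 1` is constant and cancels in the second difference; for `s = t - 1` this needs `i >
1`. -/
theorem HasType.count_prodMap_one [FiniteDimensional F V] [FiniteDimensional F V']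
    {τ τ' : Phi F →₀ Multiset ℕ+} (h : HasType g τ)
    (h' : HasType (g.prodMap (1 : Module.End F V')) τ') {s : Phi F} {i : ℕ+}
    (hs : s ≠ Phi.tSubOne F ∨ 1 < i) : (τ' s).count i = (τ s).count i := by
  classical
  have h1 := h.count_eq s i
  have h3 := h'.count_eq s i
  have hone : ∀ j : ℕ, s ≠ Phi.tSubOne F ∨ 0 < j →
      Module.finrank F (LinearMap.range (aeval (1 : Module.End F V') (s.1 ^ j))) =
        if s = Phi.tSubOne F then 0 else Module.finrank F V' := by
    intro j hj
    rw [finrank_range_aeval_one, eval_pow]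
    by_cases hs' : s = Phi.tSubOne F
    · rw [if_pos hs', if_pos]
      have h0 : s.1.eval 1 = 0 := by
        rw [hs', tSubOne_val]
        simp
      rw [h0, zero_pow (hj.resolve_left (not_not_intro hs')).ne']
    · rw [if_neg hs', if_neg (pow_ne_zero _ (Phi.eval_one_ne_zero hs'))]
  have hi : s ≠ Phi.tSubOne F ∨ 0 < (i : ℕ) - 1 := hs.imp_right fun hi => by
    have : (1 : ℕ) < i := hi
    omega
  rw [aeval_prodMap, aeval_prodMap, aeval_prodMap, finrank_range_prodMap, finrank_range_prodMap,
    finrank_range_prodMap, hone _ hi, hone _ (hs.imp_right fun _ => i.pos),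
    hone _ (hs.imp_right fun _ => Nat.succ_pos _)] at h3
  push_cast at h3
  have h4 : (s.1.natDegree : ℤ) * (τ' s).count i = s.1.natDegree * (τ s).count i := by
    rw [← h1, ← h3]
    ring
  exact_mod_cast mul_left_cancel₀ (by exact_mod_cast s.natDegree_pos.ne') h4

/-- On the second summand `g - ε` acts by the scalar `1 - ε`. A vector killed by its power `i` is
also killed by its power `i - 1` there, provided that `i - 1 > 0`, so the second components do not
contribute to the form. -/
theorem isPlusTypeOf_prodMap_one_iff {ε : F} {i m : ℕ} (hi : 2 ≤ i) :
    IsPlusTypeOf (prodForm B B') (g.prodMap 1) ε i m ↔ IsPlusTypeOf B g ε i m := by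
  have hpow : ∀ (j : ℕ) (x : V × V'),
      ((g.prodMap (1 : Module.End F V') - algebraMap F (Module.End F (V × V')) ε) ^ j) x =
        (((g - algebraMap F (Module.End F V) ε) ^ j) x.1, (1 - ε) ^ j • x.2) := by
    intro j
    induction j with
    | zero => intro x; simp
    | succ j ih =>
      intro x
      rw [pow_succ, Module.End.mul_apply, ih, pow_succ, Module.End.mul_apply]
      refine Prod.ext rfl ?_
      change (1 - ε) ^ j • (x.2 - ε • x.2) = _
      rw [pow_succ, mul_smul, sub_smul, one_smul]
  constructor
  · rintro ⟨w, hw, hG⟩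
    have h1 : ∀ a, (1 - ε) ^ (i - 1) • (w a).2 = 0 := by
      intro a
      have := congrArg Prod.snd (hw a)
      rw [hpow] at this
      rcases smul_eq_zero.mp this with h0 | h0
      · rw [eq_zero_of_pow_eq_zero h0, zero_pow (by omega), zero_smul]
      · rw [h0, smul_zero]
    refine ⟨fun a => (w a).1, fun a => ?_, fun a b => ?_⟩
    · have := congrArg Prod.fst (hw a)
      rwa [hpow] at this
    · rw [← hG, prodForm_apply, hpow, h1, map_zero, add_zero]
  · rintro ⟨w, hw, hG⟩
    refine ⟨fun a => (w a, 0), fun a => ?_, fun a b => ?_⟩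
    · rw [hpow, hw, smul_zero]; rfl
    · rw [prodForm_apply, hpow, hG, smul_zero, map_zero, add_zero]

/-- An identity summand only adds parts `1` at `t - 1`, which the modified type discards. This is
what makes types comparable between different dimensions. -/
theorem HasModifiedTypeOf.prodMap_one [FiniteDimensional F V] [FiniteDimensional F V']
    (h2 : (2 : F) ≠ 0) (hg : IsIsometryPair B g g') {μ : SymplecticModifiedType F}
    (h : HasModifiedTypeOf B g μ) (B' : LinearMap.BilinForm F V') :
    HasModifiedTypeOf (prodForm B B') (g.prodMap 1) μ := by
  obtain ⟨σ, hσ, hσμ⟩ := h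
  obtain ⟨σ', hσ'⟩ := exists_hasLabelOf (hg.prodMap (IsIsometryPair.one B'))
  refine ⟨σ', hσ', ?_⟩
  rw [← hσμ]
  have hc : ∀ (s : Phi F) (i : ℕ+), s ≠ Phi.tSubOne F ∨ 1 < i →
      (σ'.part s).count i = (σ.part s).count i := fun s i hs => hσ.1.count_prodMap_one hσ'.1 hs
  have hsign : ∀ (ε : F) (s : Phi F) (i : ℕ+), s ≠ Phi.tSubOne F ∨ 1 < i →
      signOf (prodForm B B') (g.prodMap 1) ε (σ'.part s) i = signOf B g ε (σ.part s) i := by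
    intro ε s i hs
    unfold signOf
    rw [hc s i hs]
    by_cases hi : Even (i : ℕ)
    · have hi2 : 2 ≤ (i : ℕ) := by
        obtain ⟨j, hj⟩ := hi
        have := i.pos
        omega
      have := isPlusTypeOf_prodMap_one_iff (B := B) (B' := B') (g := g) (ε := ε)
        (m := (σ.part s).count i) hi2
      split_ifs <;> simp_all
    · rw [if_neg fun h => hi h.1, if_neg fun h => hi h.1]
  refine SignedMultipartition.ext ?_ ?_ ?_
  · ext r i
    by_cases hr : r = Phi.tSubOne F
    · rw [hr, modify_part_tSubOne, modify_part_tSubOne, count_decrementParts, count_decrementParts,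
        hc _ _ (Or.inr (PNat.lt_add_left 1 i))]
    · rw [modify_part_of_ne _ hr, modify_part_of_ne _ hr, hc _ _ (Or.inl hr)]
  · funext i
    change σ'.signSubOne (i + 1) = σ.signSubOne (i + 1)
    rw [hσ'.2.1, hσ.2.1, hsign _ _ _ (Or.inr (PNat.lt_add_left 1 i))]
  · funext i
    change σ'.signAddOne i = σ.signAddOne i
    rw [hσ'.2.2, hσ.2.2, hsign _ _ _ (Or.inl (tAddOne_ne_tSubOne h2))]

theorem HasModifiedTypeOf.one_prodMap [FiniteDimensional F V] [FiniteDimensional F V']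
    (h2 : (2 : F) ≠ 0) (hg : IsIsometryPair B g g') {μ : SymplecticModifiedType F}
    (h : HasModifiedTypeOf B g μ) (B' : LinearMap.BilinForm F V') :
    HasModifiedTypeOf (prodForm B' B) (LinearMap.prodMap 1 g) μ :=
  (h.prodMap_one h2 hg B').map (LinearEquiv.prodComm F V V') (fun _ => rfl)
    fun x y => by simp [prodForm_apply, add_comm]

end Classification

/-! ### Isometries as matrices relative to a family of vectors -/

section Transvections

variable {F : Type*} [Field F] {V : Type*} [AddCommGroup V] [Module F V]
  {V' : Type*} [AddCommGroup V'] [Module F V']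
  {B : LinearMap.BilinForm F V} {B' : LinearMap.BilinForm F V'} {g g' : Module.End F V}
  {k k' : Module.End F V'} {ι κ : Type*} [Fintype ι] [Fintype κ]

/-- The linear map `x ↦ (B (w i) x)_i`. -/
def pairing (B : LinearMap.BilinForm F V) (w : ι → V) : V →ₗ[F] (ι → F) :=
  LinearMap.pi fun i => B (w i)

/-- The Gram matrix of a family of vectors. -/
def gram (B : LinearMap.BilinForm F V) (w : ι → V) : Matrix ι ι F :=
  Matrix.of fun i j => B (w i) (w j)

/-- The linear map `x ↦ x + ∑ i j, A i j * B (w j) x • w i`. -/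
def transv (B : LinearMap.BilinForm F V) (w : ι → V) (A : Matrix ι ι F) : Module.End F V :=
  1 + Fintype.linearCombination F w ∘ₗ A.mulVecLin ∘ₗ pairing B w

theorem transv_apply (w : ι → V) (A : Matrix ι ι F) (x : V) :
    transv B w A x = x + Fintype.linearCombination F w (A.mulVec (pairing B w x)) := rfl

theorem transv_sub_one (w : ι → V) (A : Matrix ι ι F) :
    transv B w A - 1 = Fintype.linearCombination F w ∘ₗ A.mulVecLin ∘ₗ pairing B w := by
  rw [transv, add_sub_cancel_left]

theorem pairing_linearCombination (w : ι → V) (c : ι → F) :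
    pairing B w (Fintype.linearCombination F w c) = (gram B w).mulVec c := by
  funext i
  simp [pairing, gram, Fintype.linearCombination_apply, Matrix.mulVec, dotProduct, mul_comm]

/-- The pairing of a combination of the `w i` with the family is given by the Gram matrix, so
products of such operators are governed by matrices without reference to the ambient space. -/
theorem transv_mul_transv (w : ι → V) (A A' : Matrix ι ι F) :
    transv B w A * transv B w A' = transv B w (A + A' + A * gram B w * A') := by
  refine LinearMap.ext fun x => ?_
  rw [Module.End.mul_apply, transv_apply, transv_apply, transv_apply, map_add (pairing B w),
    pairing_linearCombination, Matrix.mulVec_add, Matrix.add_mulVec, Matrix.add_mulVec, map_add,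
    map_add, map_add, ← Matrix.mulVec_mulVec, ← Matrix.mulVec_mulVec]
  abel

theorem linearCombination_injective {w : ι → V} (hw : LinearIndependent F w) :
    Function.Injective (Fintype.linearCombination F w) :=
  linearIndependent_iff_injective_fintypeLinearCombination.mp hw

theorem IsSymplectic.pairing_range [FiniteDimensional F V] (hB : IsSymplectic B) {w : ι → V}
    (hw : LinearIndependent F w) : LinearMap.range (pairing B w) = ⊤ :=
  LinearMap.range_eq_top.mpr (hB.pairing_surjective hw)

theorem IsSymplectic.transv_injective [FiniteDimensional F V] (hB : IsSymplectic B) {w : ι → V}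
    (hw : LinearIndependent F w) {A A' : Matrix ι ι F} (h : transv B w A = transv B w A') :
    A = A' := by
  refine Matrix.mulVec_injective (funext fun c => ?_)
  obtain ⟨x, rfl⟩ := hB.pairing_surjective hw c
  exact linearCombination_injective hw (add_left_cancel (LinearMap.congr_fun h x))

theorem IsSymplectic.range_transv_sub_one [FiniteDimensional F V] (hB : IsSymplectic B) {w : ι → V}
    (hw : LinearIndependent F w) (A : Matrix ι ι F) :
    LinearMap.range (transv B w A - 1) =
      (LinearMap.range A.mulVecLin).map (Fintype.linearCombination F w) := by
  rw [transv_sub_one, LinearMap.range_comp, LinearMap.range_comp, hB.pairing_range hw,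
    LinearMap.range_eq_map]

theorem transv_intertwining {w : ι → V} {w' : ι → V'} (f : V →ₗ[F] V')
    (hf : ∀ x y, B' (f x) (f y) = B x y) (hw : ∀ i, f (w i) = w' i) (A : Matrix ι ι F) (x : V) :
    f (transv B w A x) = transv B' w' A (f x) := by
  have h1 : pairing B' w' (f x) = pairing B w x := funext fun i => by
    change B' (w' i) (f x) = B (w i) x
    rw [← hw, hf]
  rw [transv_apply, transv_apply, h1, map_add, Fintype.linearCombination_apply,
    Fintype.linearCombination_apply, map_sum]
  simp only [map_smul, hw]

theorem transv_prodForm_inl (B' : LinearMap.BilinForm F V') (w : ι → V) (A : Matrix ι ι F) :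
    transv (prodForm B B') (fun i => ((w i, 0) : V × V')) A = (transv B w A).prodMap 1 := by
  refine LinearMap.ext fun x => ?_
  have h1 : pairing (prodForm B B') (fun i => ((w i, 0) : V × V')) x = pairing B w x.1 :=
    funext fun i => by
      change prodForm B B' (w i, 0) x = B (w i) x.1
      rw [prodForm_apply, map_zero, LinearMap.zero_apply, add_zero]
  rw [transv_apply, h1, LinearMap.prodMap_apply, transv_apply, Fintype.linearCombination_apply,
    Fintype.linearCombination_apply]
  refine Prod.ext ?_ ?_
  · simp [Prod.fst_sum]
  · simp [Prod.snd_sum]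

theorem transv_prodForm_inr (B : LinearMap.BilinForm F V) (w : ι → V') (A : Matrix ι ι F) :
    transv (prodForm B B') (fun i => ((0, w i) : V × V')) A =
      LinearMap.prodMap 1 (transv B' w A) := by
  refine LinearMap.ext fun x => ?_
  have h1 : pairing (prodForm B B') (fun i => ((0, w i) : V × V')) x = pairing B' w x.2 :=
    funext fun i => by
      change prodForm B B' (0, w i) x = B' (w i) x.2
      rw [prodForm_apply, map_zero, LinearMap.zero_apply, zero_add]
  rw [transv_apply, h1, LinearMap.prodMap_apply, transv_apply, Fintype.linearCombination_apply,
    Fintype.linearCombination_apply]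
  refine Prod.ext ?_ ?_
  · simp [Prod.fst_sum]
  · simp [Prod.snd_sum]

/-- The matrix `A`, with rows and columns indexed by `ι`, transported along a map `ι → κ`. -/
def padMatrix [DecidableEq κ] (e : ι → κ) (A : Matrix ι ι F) : Matrix κ κ F :=
  (Matrix.of fun k i => if k = e i then (1 : F) else 0) * A *
    (Matrix.of fun i k => if k = e i then (1 : F) else 0)

theorem transv_comp [DecidableEq κ] (e : ι → κ) (w : κ → V) (A : Matrix ι ι F) :
    transv B (w ∘ e) A = transv B w (padMatrix e A) := by
  refine LinearMap.ext fun x => ?_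
  rw [transv_apply, transv_apply, padMatrix, ← Matrix.mulVec_mulVec, ← Matrix.mulVec_mulVec]
  have h1 : (Matrix.of fun (i : ι) (k : κ) => if k = e i then (1 : F) else 0).mulVec
      (pairing B w x) = pairing B (w ∘ e) x := by
    funext i
    simp [Matrix.mulVec, dotProduct, pairing]
  have h2 : ∀ c : ι → F, Fintype.linearCombination F w
      ((Matrix.of fun (k : κ) (i : ι) => if k = e i then (1 : F) else 0).mulVec c) =
      Fintype.linearCombination F (w ∘ e) c := by
    intro c
    simp only [Fintype.linearCombination_apply, Matrix.mulVec, dotProduct, Matrix.of_apply,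
      Finset.sum_smul, Function.comp_apply]
    rw [Finset.sum_comm]
    refine Finset.sum_congr rfl fun i _ => ?_
    simp [ite_smul]
  rw [h1, h2]

theorem IsSymplectic.exists_isIsometryPair [FiniteDimensional F V] (hB : IsSymplectic B)
    (hg : ∀ x y, B (g x) (g y) = B x y) : ∃ g', IsIsometryPair B g g' := by
  have hinj : Function.Injective g := by
    rw [injective_iff_map_eq_zero]
    intro x hx
    exact hB.nondeg x fun y => by rw [← hg, hx, map_zero, LinearMap.zero_apply]
  let e := LinearEquiv.ofInjectiveEndo g hinj
  exact ⟨e.symm.toLinearMap, hg, LinearMap.ext fun x => e.apply_symm_apply x,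
    LinearMap.ext fun x => e.symm_apply_apply x⟩

/-- An isometry fixes the orthogonal complement of the range of `g - 1`. Hence each coordinate of
`(g - 1) x` in the family `w` vanishes on the common kernel of the functionals `B (w j)` and is a
combination of them. -/
theorem IsIsometryPair.exists_eq_transv [FiniteDimensional F V] (hB : IsSymplectic B)
    (hg : IsIsometryPair B g g') {w : ι → V} (hw : LinearIndependent F w)
    (hr : LinearMap.range (g - 1) ≤ Submodule.span F (Set.range w)) :
    ∃ A, g = transv B w A := by
  let e := LinearEquiv.ofInjective _ (linearCombination_injective hw)
  have hmem : ∀ x, (g - 1) x ∈ LinearMap.range (Fintype.linearCombination F w) := fun x => by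
    rw [Fintype.range_linearCombination]
    exact hr ⟨x, rfl⟩
  let c : V →ₗ[F] (ι → F) := e.symm.toLinearMap ∘ₗ (g - 1).codRestrict _ hmem
  have hc : ∀ x, Fintype.linearCombination F w (c x) = g x - x := fun x =>
    congrArg Subtype.val (e.apply_symm_apply ⟨(g - 1) x, hmem x⟩)
  have hperp : ∀ x, (∀ i, B (w i) x = 0) → g x = x := by
    intro x hx
    have hspan : ∀ v ∈ Submodule.span F (Set.range w), B x v = 0 := by
      intro v hv
      induction hv using Submodule.span_induction with
      | mem v hv =>
        obtain ⟨i, rfl⟩ := hv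
        rw [hB.neg, hx, neg_zero]
      | zero => rw [map_zero]
      | add u v _ _ hu hv => rw [map_add, hu, hv, add_zero]
      | smul a v _ hv => rw [map_smul, hv, smul_zero]
    rw [← sub_eq_zero]
    refine hB.nondeg _ fun y => ?_
    have h1 : g (g' y) = y := LinearMap.congr_fun hg.mul_inv y
    have h2 := hspan _ (hr ⟨g' y, rfl⟩)
    rw [LinearMap.sub_apply, Module.End.one_apply, map_sub, h1] at h2
    rw [map_sub, LinearMap.sub_apply, ← h1, hg.isom, h1, ← neg_sub, h2, neg_zero]
  have hspan : ∀ i, ∃ a : ι → F, ∀ x, c x i = ∑ j, a j * B (w j) x := by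
    intro i
    have h1 : LinearMap.proj i ∘ₗ c ∈ Submodule.span F (Set.range fun j => B (w j)) := by
      refine mem_span_of_iInf_ker_le_ker fun x hx => ?_
      rw [Submodule.mem_iInf] at hx
      have h2 : c x = 0 := linearCombination_injective hw (by
        rw [hc, hperp x hx, sub_self, map_zero])
      rw [LinearMap.mem_ker, LinearMap.comp_apply, h2, map_zero]
    obtain ⟨a, ha⟩ := (Submodule.mem_span_range_iff_exists_fun F).mp h1
    refine ⟨a, fun x => ?_⟩
    have := LinearMap.congr_fun ha x
    rw [LinearMap.comp_apply, LinearMap.proj_apply] at this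
    rw [← this, LinearMap.sum_apply]
    rfl
  choose a ha using hspan
  refine ⟨Matrix.of a, LinearMap.ext fun x => ?_⟩
  have h1 : (Matrix.of a).mulVec (pairing B w x) = c x := funext fun i => (ha i x).symm
  rw [transv_apply, h1, hc, add_sub_cancel]

/-- `g` is an isometry of modified type `μ`. -/
def IsIsometryOfType (B : LinearMap.BilinForm F V) (μ : SymplecticModifiedType F)
    (g : Module.End F V) : Prop :=
  (∃ g', IsIsometryPair B g g') ∧ HasModifiedTypeOf B g μ

/-- By Witt's theorem an isometry of `V ⊥ V'` takes each `(w i, 0)` to `(0, w' i)`. It conjugates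
`transv B w A ⊕ 1` to `1 ⊕ transv B' w' A`, and identity summands do not affect the type. -/
theorem IsIsometryOfType.transv_congr [Finite F] [FiniteDimensional F V] [FiniteDimensional F V']
    (h2 : (2 : F) ≠ 0) (hB : IsSymplectic B) (hB' : IsSymplectic B') {s : ℕ} {w : Fin s → V}
    {w' : Fin s → V'} (hw : LinearIndependent F w) (hw' : LinearIndependent F w')
    (hG : gram B w = gram B' w') {A : Matrix (Fin s) (Fin s) F} {μ : SymplecticModifiedType F}
    (h : IsIsometryOfType B μ (transv B w A)) : IsIsometryOfType B' μ (transv B' w' A) := by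
  obtain ⟨⟨g', hg⟩, hμ⟩ := h
  have hP := hB.prodForm hB'
  obtain ⟨f, hf, hfw⟩ := hP.exists_isometry hP rfl
    (w := fun i => ((w i, 0) : V × V')) (w' := fun i => ((0, w' i) : V × V'))
    (hw.map' (LinearMap.inl F V V') (LinearMap.ker_eq_bot.mpr LinearMap.inl_injective))
    (hw'.map' (LinearMap.inr F V V') (LinearMap.ker_eq_bot.mpr LinearMap.inr_injective))
    (fun i j => by
      have : B (w i) (w j) = B' (w' i) (w' j) := congrFun (congrFun hG i) j
      simp [prodForm_apply, this])
  have hint := transv_intertwining (B := prodForm B B') (B' := prodForm B B') f.toLinearMap hf hfw A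
  rw [transv_prodForm_inl, transv_prodForm_inr] at hint
  have hiso : ∀ x y, B' (transv B' w' A x) (transv B' w' A y) = B' x y := by
    have h1 : ∀ x y, prodForm B B' (f.toLinearMap x) (f.toLinearMap y) = prodForm B B' x y := hf
    intro x y
    obtain ⟨p, hp⟩ := f.surjective (0, x)
    obtain ⟨r, hr⟩ := f.surjective (0, y)
    have e1 := h1 ((transv B w A).prodMap 1 p) ((transv B w A).prodMap 1 r)
    have e2 := e1.trans (((hg.prodMap (IsIsometryPair.one B')).isom p r).trans (h1 p r).symm)
    rw [hint, hint, LinearEquiv.coe_coe, hp, hr] at e2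
    simpa [prodForm_apply] using e2
  obtain ⟨k', hk⟩ := hB'.exists_isIsometryPair hiso
  refine ⟨⟨k', hk⟩, ?_⟩
  obtain ⟨ν, hν⟩ := exists_hasModifiedTypeOf h2 hB' hk
  have e1 := (hμ.prodMap_one h2 hg B').map f hint hf
  exact (e1.unique (hν.one_prodMap h2 hk B)) ▸ hν

/-- After adding identity summands, both isometries live on `V ⊥ V'` and have the same type, so they
are conjugate there. The conjugating isometry takes the range of `transv B u Γ - 1` into `V'`, and
with it the whole normal form. -/
theorem IsIsometryOfType.exists_transv [Finite F] [FiniteDimensional F V] [FiniteDimensional F V']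
    (h2 : (2 : F) ≠ 0) (hB : IsSymplectic B) (hB' : IsSymplectic B') {μ : SymplecticModifiedType F}
    {u : ι → V} {Γ : Matrix ι ι F} (hu : LinearIndependent F u)
    (hr : LinearMap.range (transv B u Γ - 1) = Submodule.span F (Set.range u))
    (h : IsIsometryOfType B μ (transv B u Γ)) (hk : IsIsometryOfType B' μ k) :
    ∃ u' : ι → V', LinearIndependent F u' ∧ gram B' u' = gram B u ∧ k = transv B' u' Γ ∧
      LinearMap.range (k - 1) = Submodule.span F (Set.range u') := by
  obtain ⟨⟨g', hg⟩, hμ⟩ := h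
  obtain ⟨⟨k', hk'⟩, hkμ⟩ := hk
  have hP := hB.prodForm hB'
  obtain ⟨f, hf, hfg⟩ := (hμ.prodMap_one h2 hg B').exists_intertwining h2 hP hP
    (hg.prodMap (IsIsometryPair.one B')) ((IsIsometryPair.one B).prodMap hk') rfl
    (hkμ.one_prodMap h2 hk' B)
  have h1 : ∀ i, (f (u i, 0)).1 = 0 := by
    intro i
    have : u i ∈ LinearMap.range (transv B u Γ - 1) := by
      rw [hr]; exact Submodule.subset_span ⟨i, rfl⟩
    obtain ⟨x, hx⟩ := this
    have h3 := congrArg Prod.fst (hfg (x, 0))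
    have h4 : ((u i, 0) : V × V') =
        (transv B u Γ).prodMap (1 : Module.End F V') (x, 0) - (x, 0) :=
      Prod.ext hx.symm (sub_self (0 : V')).symm
    rw [h4, map_sub, Prod.fst_sub, h3]
    exact sub_self _
  have h5 : ∀ i, f (u i, 0) = (0, (f (u i, 0)).2) := fun i => Prod.ext (h1 i) rfl
  have hli : LinearIndependent F fun i => ((u i, 0) : V × V') :=
    hu.map' (LinearMap.inl F V V') (LinearMap.ker_eq_bot.mpr LinearMap.inl_injective)
  have hli' : LinearIndependent F fun i => (f (u i, 0)).2 := by
    have := hli.map' f.toLinearMap (LinearMap.ker_eq_bot.mpr f.injective)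
    have h6 : (f.toLinearMap ∘ fun i => ((u i, 0) : V × V')) =
      LinearMap.inr F V V' ∘ fun i => (f (u i, 0)).2 := funext h5
    rw [h6] at this
    exact this.of_comp _
  have hgram : gram B' (fun i => (f (u i, 0)).2) = gram B u := by
    funext i j
    have := hf (u i, 0) (u j, 0)
    rw [h5 i, h5 j] at this
    simpa [prodForm_apply, gram] using this
  have hkt : k = transv B' (fun i => (f (u i, 0)).2) Γ := by
    have hint := transv_intertwining (B := prodForm B B') (B' := prodForm B B') f.toLinearMap hf
      h5 Γ
    rw [transv_prodForm_inl, transv_prodForm_inr] at hint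
    refine LinearMap.ext fun y => ?_
    obtain ⟨p, hp⟩ := f.surjective (0, y)
    have h7 := hint p
    rw [LinearEquiv.coe_coe, hfg, hp] at h7
    exact congrArg Prod.snd h7
  refine ⟨_, hli', hgram, hkt, ?_⟩
  rw [hB.range_transv_sub_one hu, ← Fintype.range_linearCombination,
    LinearMap.range_eq_map (Fintype.linearCombination F u)] at hr
  have hΓ := Submodule.map_injective_of_injective (linearCombination_injective hu) hr
  rw [hkt, hB'.range_transv_sub_one hli', hΓ, ← LinearMap.range_eq_map,
    Fintype.range_linearCombination]

end Transvections

/-! ### Counting extensions of independent families -/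

section Extensions

theorem natCard_snoc {R : Type*} [CommSemiring R] {V : Type*} [Finite V] {s : ℕ}
    {P : (Fin s → V) → Prop} {P' : (Fin (s + 1) → V) → Prop} {Q : (Fin s → V) → V → Prop}
    (hP : ∀ w x, P' (Fin.snoc w x) ↔ P w ∧ Q w x) (c : R)
    (hc : ∀ w, P w → (Nat.card {x // Q w x} : R) = c) :
    (Nat.card {w // P' w} : R) = Nat.card {w // P w} * c := by
  let f : (Σ w : {w // P w}, {x // Q w.1 x}) → {w // P' w} := fun w =>
    ⟨Fin.snoc w.1.1 w.2.1, (hP _ _).mpr ⟨w.1.2, w.2.2⟩⟩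
  have hf : Function.Bijective f := by
    refine ⟨?_, fun w => ?_⟩
    · rintro ⟨⟨w, hw⟩, x, hx⟩ ⟨⟨w', hw'⟩, x', hx'⟩ h
      have h1 : (Fin.snoc w x : Fin (s + 1) → V) = Fin.snoc w' x' := congrArg Subtype.val h
      obtain ⟨rfl, rfl⟩ := Fin.snoc_injective2 h1
      rfl
    · have h := (hP (Fin.init w.1) (w.1 (Fin.last s))).mp ((Fin.snoc_init_self w.1).symm ▸ w.2)
      exact ⟨⟨⟨_, h.1⟩, _, h.2⟩, Subtype.ext (Fin.snoc_init_self w.1)⟩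
  have := Fintype.ofFinite {w // P w}
  rw [← Nat.card_eq_of_bijective f hf, Nat.card_sigma, Nat.cast_sum,
    Finset.sum_congr rfl fun w _ => hc w.1 w.2, Finset.sum_const, nsmul_eq_mul,
    Nat.card_eq_fintype_card, Finset.card_univ]

theorem gram_snoc_eq_iff {F V : Type*} [Field F] [AddCommGroup V] [Module F V]
    {B : LinearMap.BilinForm F V} (hB : IsSymplectic B) {s : ℕ}
    (G : Matrix (Fin (s + 1)) (Fin (s + 1)) F) (w : Fin s → V) (x : V) :
    gram B (Fin.snoc w x : Fin (s + 1) → V) = G ↔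
      (gram B w = G.submatrix Fin.castSucc Fin.castSucc ∧
        ∀ i, B (w i) x = G (Fin.castSucc i) (Fin.last s)) ∧
      G (Fin.last s) (Fin.last s) = 0 ∧
        ∀ i, G (Fin.last s) (Fin.castSucc i) = -G (Fin.castSucc i) (Fin.last s) := by
  constructor
  · rintro rfl
    refine ⟨⟨?_, fun i => ?_⟩, ?_, fun i => ?_⟩
    · ext i j
      simp [gram]
    · simp [gram]
    · simp [gram, hB.alt]
    · simp [gram, hB.neg (w i) x]
  · rintro ⟨⟨h1, h3⟩, h4, h5⟩
    ext i j
    refine Fin.lastCases ?_ (fun i => ?_) i <;> refine Fin.lastCases ?_ (fun j => ?_) j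
    · simp [gram, hB.alt, h4]
    · simp [gram, hB.neg (w j) x, h3, h5]
    · simp [gram, h3]
    · simpa [gram] using congrFun (congrFun h1 i) j

/-- The number of ways to extend `d` independent vectors of a space of dimension `d + m` to a
sequence of `d + j` independent vectors. -/
def extensionCount (q : ℚ) (d m j : ℕ) : ℚ := ∏ i ∈ Finset.range j, (q ^ (d + m) - q ^ (d + i))

theorem extensionCount_ne_zero {q : ℚ} (hq : 1 < q) (d m : ℕ) : extensionCount q d m m ≠ 0 := by
  refine Finset.prod_ne_zero_iff.mpr fun i hi => sub_ne_zero.mpr fun h => ?_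
  have := pow_right_injective₀ (zero_lt_one.trans hq) hq.ne' h
  have := Finset.mem_range.mp hi
  omega

theorem snoc_comp_castAdd {V : Type*} {d m : ℕ} (w : Fin (d + m) → V) (x : V) :
    (Fin.snoc w x : Fin (d + m + 1) → V) ∘ Fin.castAdd (m + 1) = w ∘ Fin.castAdd m := by
  funext i
  exact Fin.snoc_castSucc (α := fun _ => V) x w (Fin.castAdd m i)

variable {F : Type*} [Field F] [Finite F] {V : Type*} [AddCommGroup V] [Module F V]
  [FiniteDimensional F V]

theorem natCard_extensions_mem {d m : ℕ} {u : Fin d → V} (hu : LinearIndependent F u)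
    {U : Submodule F V} (hU : Module.finrank F U = d + m) (huU : ∀ i, u i ∈ U) {j : ℕ}
    (hj : j ≤ m) :
    (Nat.card {w : Fin (d + j) → V // w ∘ Fin.castAdd j = u ∧ LinearIndependent F w ∧
      ∀ i, w i ∈ U} : ℚ) = extensionCount (Nat.card F) d m j := by
  have : Finite V := Module.finite_of_finite F
  induction j with
  | zero =>
    have : Unique {w : Fin (d + 0) → V // w ∘ Fin.castAdd 0 = u ∧ LinearIndependent F w ∧
        ∀ i, w i ∈ U} :=
      { default := ⟨u, rfl, hu, huU⟩
        uniq := fun w => Subtype.ext w.2.1 }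
    rw [Nat.card_unique, extensionCount, Finset.prod_range_zero, Nat.cast_one]
  | succ j ih =>
    rw [extensionCount, Finset.prod_range_succ, ← extensionCount, ← ih (by omega)]
    refine natCard_snoc (s := d + j)
      (P := fun w => w ∘ Fin.castAdd j = u ∧ LinearIndependent F w ∧ ∀ i, w i ∈ U)
      (Q := fun w x => x ∈ U ∧ x ∉ Submodule.span F (Set.range w)) (fun w x => ?_) _
      fun w hw => ?_
    · rw [snoc_comp_castAdd, linearIndependent_finSnoc]
      have h1 : (∀ i, (Fin.snoc w x : Fin (d + j + 1) → V) i ∈ U) ↔ (∀ i, w i ∈ U) ∧ x ∈ U := by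
        rw [Fin.forall_fin_succ']
        simp only [Fin.snoc_castSucc, Fin.snoc_last]
      change (_ ∧ _ ∧ ∀ i : Fin (d + j + 1), _) ↔ _
      rw [h1]
      tauto
    · have hle : Submodule.span F (Set.range w) ≤ U :=
        Submodule.span_le.mpr (Set.range_subset_iff.mpr hw.2.2)
      have h1 : Nat.card {x // x ∈ U ∧ x ∉ Submodule.span F (Set.range w)} =
          ((U : Set V) \ (Submodule.span F (Set.range w) : Submodule F V)).ncard := rfl
      have h3 : ∀ W : Submodule F V, (W : Set V).ncard = Nat.card F ^ Module.finrank F W :=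
        fun W => by
          rw [← Module.natCard_eq_pow_finrank (K := F) (V := W)]; rfl
      rw [h1, Set.ncard_sdiff hle, h3, h3, hU, finrank_span_eq_card hw.2.1, Fintype.card_fin,
        Nat.cast_sub (Nat.pow_le_pow_right Nat.card_pos (by omega))]
      push_cast
      rfl

theorem natCard_extensions_span {d m : ℕ} {u : Fin d → V} (hu : LinearIndependent F u)
    {U : Submodule F V} (huU : ∀ i, u i ∈ U) :
    (Nat.card {w : Fin (d + m) → V // w ∘ Fin.castAdd m = u ∧ LinearIndependent F w ∧
      Submodule.span F (Set.range w) = U} : ℚ) =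
      if Module.finrank F U = d + m then extensionCount (Nat.card F) d m m else 0 := by
  split_ifs with hU
  · rw [← natCard_extensions_mem hu hU huU le_rfl]
    congr 1
    refine Nat.card_congr (Equiv.subtypeEquivRight fun w => and_congr_right fun _ =>
      and_congr_right fun hw => ⟨fun h i => h ▸ Submodule.subset_span ⟨i, rfl⟩, fun h => ?_⟩)
    refine Submodule.eq_of_le_of_finrank_eq
      (Submodule.span_le.mpr (Set.range_subset_iff.mpr h)) ?_
    rw [hU, finrank_span_eq_card hw, Fintype.card_fin]
  · have : IsEmpty {w : Fin (d + m) → V // w ∘ Fin.castAdd m = u ∧ LinearIndependent F w ∧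
        Submodule.span F (Set.range w) = U} := ⟨fun w => hU (by
      rw [← w.2.2.2, finrank_span_eq_card w.2.2.1, Fintype.card_fin])⟩
    rw [Nat.card_of_isEmpty, Nat.cast_zero]

end Extensions

variable {F : Type u} [Field F] [Finite F]

/-- The number of independent families with a given Gram matrix that extend a given family is a
polynomial in the size of the symplectic space. -/
theorem exists_extension_polynomial {d : ℕ} (G₀ : Matrix (Fin d) (Fin d) F) (m : ℕ)
    (G : Matrix (Fin (d + m)) (Fin (d + m)) F) :
    ∃ E : ℚ[X], ∀ (V : Type u) [AddCommGroup V] [Module F V] [FiniteDimensional F V]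
      (B : LinearMap.BilinForm F V), IsSymplectic B → ∀ u : Fin d → V, LinearIndependent F u →
      gram B u = G₀ →
      (Nat.card {w : Fin (d + m) → V // w ∘ Fin.castAdd m = u ∧ LinearIndependent F w ∧
        gram B w = G} : ℚ) = E.eval (Nat.card V : ℚ) := by
  classical
  induction m with
  | zero =>
    refine ⟨C (if G₀ = G then 1 else 0), fun V _ _ _ B hB u hu hG => ?_⟩
    rw [eval_C]
    split_ifs with h
    · have : Unique {w : Fin (d + 0) → V // w ∘ Fin.castAdd 0 = u ∧ LinearIndependent F w ∧
          gram B w = G} :=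
        { default := ⟨u, rfl, hu, hG.trans h⟩
          uniq := fun w => Subtype.ext w.2.1 }
      rw [Nat.card_unique, Nat.cast_one]
    · have : IsEmpty {w : Fin (d + 0) → V // w ∘ Fin.castAdd 0 = u ∧ LinearIndependent F w ∧
          gram B w = G} := ⟨fun w => h (by
        have h1 : w.1 = u := w.2.1
        rw [← hG, ← h1]
        exact w.2.2.2)⟩
      rw [Nat.card_of_isEmpty, Nat.cast_zero]
  | succ m ih =>
    by_cases hG : G (Fin.last (d + m)) (Fin.last (d + m)) = 0 ∧
        ∀ i, G (Fin.last (d + m)) (Fin.castSucc i) = -G (Fin.castSucc i) (Fin.last (d + m))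
    · obtain ⟨E, hE⟩ := ih (G.submatrix Fin.castSucc Fin.castSucc)
      -- `N` counts the vectors of the span with the prescribed products, a number read off from `G`
      -- alone. By `card_extension`, each admissible family has `|V| / q ^ (d + m) - N` extensions
      -- by one vector.
      let N := Nat.card {y : Fin (d + m) → F // ∀ i, ∑ j, y j *
        G (Fin.castSucc i) (Fin.castSucc j) = G (Fin.castSucc i) (Fin.last (d + m))}
      refine ⟨E * (C ((Nat.card F : ℚ) ^ (d + m))⁻¹ * X - C (N : ℚ)),
        fun V _ _ _ B hB u hu hGu => ?_⟩
      have : Finite V := Module.finite_of_finite F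
      rw [eval_mul, ← hE V B hB u hu hGu]
      refine natCard_snoc (s := d + m) (P := fun w => w ∘ Fin.castAdd m = u ∧
        LinearIndependent F w ∧ gram B w = G.submatrix Fin.castSucc Fin.castSucc)
        (Q := fun w x => (∀ i, B (w i) x = G (Fin.castSucc i) (Fin.last (d + m))) ∧
          x ∉ Submodule.span F (Set.range w)) (fun w x => ?_) _ fun w hw => ?_
      · rw [snoc_comp_castAdd, linearIndependent_finSnoc, gram_snoc_eq_iff hB]
        tauto
      · have h1 := hB.card_extension hw.2.1 fun i => G (Fin.castSucc i) (Fin.last (d + m))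
        have h3 : ∀ i j, B (w i) (w j) = G (Fin.castSucc i) (Fin.castSucc j) := fun i j =>
          congrFun (congrFun hw.2.2 i) j
        simp only [h3, Nat.card_fin] at h1
        have hq : (Nat.card F : ℚ) ≠ 0 := by exact_mod_cast Nat.card_pos.ne'
        rw [eval_sub, eval_mul, eval_C, eval_X, eval_C, ← h1]
        push_cast
        rw [inv_mul_eq_div, mul_div_cancel_right₀ _ (pow_ne_zero _ hq)]
        exact (add_sub_cancel_right _ _).symm
    -- A Gram matrix whose last row and column violate the alternating condition is never attained.
    · refine ⟨0, fun V _ _ _ B hB u hu hGu => ?_⟩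
      have : IsEmpty {w : Fin (d + (m + 1)) → V // w ∘ Fin.castAdd (m + 1) = u ∧
          LinearIndependent F w ∧ gram B w = G} := ⟨fun w => hG (by
        have h1 := w.2.2.2
        rw [← Fin.snoc_init_self w.1] at h1
        exact ((gram_snoc_eq_iff hB G _ _).mp h1).2)⟩
      rw [Nat.card_of_isEmpty, Nat.cast_zero, eval_zero]

theorem range_mul_sub_one_le {F V : Type*} [Field F] [AddCommGroup V] [Module F V]
    (a b : Module.End F V) :
    LinearMap.range (a * b - 1) ≤ LinearMap.range (a - 1) ⊔ LinearMap.range (b - 1) := by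
  rintro _ ⟨x, rfl⟩
  have : (a * b - 1) x = (a - 1) (b x) + (b - 1) x := by
    simp
  rw [this]
  exact Submodule.add_mem_sup ⟨_, rfl⟩ ⟨_, rfl⟩

/-! ### The rank of `g - 1` depends only on the modified type -/

section Ranks

variable {F : Type*} [Field F] {V : Type*} [AddCommGroup V] [Module F V] [FiniteDimensional F V]
  {V' : Type*} [AddCommGroup V'] [Module F V'] [FiniteDimensional F V']
  {B : LinearMap.BilinForm F V} {B' : LinearMap.BilinForm F V'} {g : Module.End F V}
  {k : Module.End F V'}

theorem IsIsometryPair.exists_basis_transv (hB : IsSymplectic B) {g' : Module.End F V}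
    (hg : IsIsometryPair B g g') :
    ∃ (u : Fin (Module.finrank F (LinearMap.range (g - 1))) → V)
      (Γ : Matrix (Fin (Module.finrank F (LinearMap.range (g - 1))))
        (Fin (Module.finrank F (LinearMap.range (g - 1)))) F),
      LinearIndependent F u ∧ g = transv B u Γ ∧
        LinearMap.range (g - 1) = Submodule.span F (Set.range u) := by
  let b := Module.finBasis F (LinearMap.range (g - 1))
  have hu : LinearIndependent F fun i => (b i : V) :=
    b.linearIndependent.map' _ (Submodule.ker_subtype _)
  have hr : LinearMap.range (g - 1) = Submodule.span F (Set.range fun i => (b i : V)) := by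
    have := congrArg (Submodule.map (LinearMap.range (g - 1)).subtype) b.span_eq
    rw [Submodule.map_span, Submodule.map_top, Submodule.range_subtype, ← Set.range_comp] at this
    exact this.symm
  obtain ⟨Γ, hΓ⟩ := hg.exists_eq_transv hB hu hr.le
  exact ⟨_, Γ, hu, hΓ, hr⟩

theorem IsIsometryOfType.finrank_range_eq [Finite F] (h2 : (2 : F) ≠ 0) (hB : IsSymplectic B)
    (hB' : IsSymplectic B') {μ : SymplecticModifiedType F} (h : IsIsometryOfType B μ g)
    (hk : IsIsometryOfType B' μ k) :
    Module.finrank F (LinearMap.range (g - 1)) = Module.finrank F (LinearMap.range (k - 1)) := by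
  obtain ⟨g', hg⟩ := h.1
  obtain ⟨u, Γ, hu, hΓ, hr⟩ := hg.exists_basis_transv hB
  obtain ⟨u', hu', -, -, hr'⟩ := IsIsometryOfType.exists_transv h2 hB hB' hu (hΓ ▸ hr) (hΓ ▸ h) hk
  rw [hr', finrank_span_eq_card hu', Fintype.card_fin]

end Ranks

/-! ### Counting factorizations -/

variable {F : Type u} [Field F] [Finite F]

theorem exists_rank (h2 : (2 : F) ≠ 0) (μ : SymplecticModifiedType F) :
    ∃ d, ∀ (V : Type u) [AddCommGroup V] [Module F V] [FiniteDimensional F V]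
      (B : LinearMap.BilinForm F V), IsSymplectic B → ∀ g, IsIsometryOfType B μ g →
      Module.finrank F (LinearMap.range (g - 1)) = d := by
  by_cases h : ∃ (V : Type u) (_ : AddCommGroup V) (_ : Module F V) (_ : FiniteDimensional F V)
      (B : LinearMap.BilinForm F V), IsSymplectic B ∧ ∃ g, IsIsometryOfType B μ g
  · obtain ⟨V', _, _, _, B', hB', k, hk⟩ := h
    exact ⟨_, fun V _ _ _ B hB g hg => hg.finrank_range_eq h2 hB hB' hk⟩
  · exact ⟨0, fun V _ _ _ B hB g hg => absurd ⟨V, _, _, ‹_›, B, hB, g, hg⟩ h⟩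

/-- The pairs of isometries of given modified types with a given product. -/
def factorizations {V : Type*} [AddCommGroup V] [Module F V] (B : LinearMap.BilinForm F V)
    (μ ν : SymplecticModifiedType F) (g : Module.End F V) :
    Set (Module.End F V × Module.End F V) :=
  {p | IsIsometryOfType B μ p.1 ∧ IsIsometryOfType B ν p.2 ∧ p.1 * p.2 = g}

/-- The matrix form of a factorization of an isometry: `G` is the Gram matrix of a basis of a
subspace, `A` and `A'` are the matrices of the two factors, and `M` is the matrix of the product. -/
def IsMatrixFactorization (μ ν : SymplecticModifiedType F) {s : ℕ} (M : Matrix (Fin s) (Fin s) F)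
    (G A A' : Matrix (Fin s) (Fin s) F) : Prop :=
  (∃ (V : Type u) (_ : AddCommGroup V) (_ : Module F V) (_ : FiniteDimensional F V)
    (B : LinearMap.BilinForm F V) (w : Fin s → V), IsSymplectic B ∧ LinearIndependent F w ∧
    gram B w = G ∧ IsIsometryOfType B μ (transv B w A) ∧ IsIsometryOfType B ν (transv B w A')) ∧
  A + A' + A * G * A' = M ∧ LinearMap.range A.mulVecLin ⊔ LinearMap.range A'.mulVecLin = ⊤

/-- `IsMatrixFactorization` asks for one space realizing the data. By `transv_congr` any other
independent family with the same Gram matrix realizes them too, so the set of triples does not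
depend on the space. -/
theorem isMatrixFactorization_iff (h2 : (2 : F) ≠ 0) {V : Type u} [AddCommGroup V] [Module F V]
    [FiniteDimensional F V] {B : LinearMap.BilinForm F V} (hB : IsSymplectic B) {s : ℕ}
    {w : Fin s → V} (hw : LinearIndependent F w) (μ ν : SymplecticModifiedType F)
    (M A A' : Matrix (Fin s) (Fin s) F) :
    IsMatrixFactorization μ ν M (gram B w) A A' ↔
      (transv B w A, transv B w A') ∈ factorizations B μ ν (transv B w M) ∧
      Submodule.span F (Set.range w) = LinearMap.range (transv B w A - 1) ⊔
        LinearMap.range (transv B w A' - 1) := by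
  have hspan : LinearMap.range A.mulVecLin ⊔ LinearMap.range A'.mulVecLin = ⊤ ↔
      Submodule.span F (Set.range w) = LinearMap.range (transv B w A - 1) ⊔
        LinearMap.range (transv B w A' - 1) := by
    rw [hB.range_transv_sub_one hw, hB.range_transv_sub_one hw, ← Submodule.map_sup,
      ← Fintype.range_linearCombination, LinearMap.range_eq_map (Fintype.linearCombination F w),
      (Submodule.map_injective_of_injective (linearCombination_injective hw)).eq_iff, eq_comm]
  have hmul : A + A' + A * gram B w * A' = M ↔
      transv B w A * transv B w A' = transv B w M := by
    rw [transv_mul_transv]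
    exact ⟨fun h => h ▸ rfl, fun h => hB.transv_injective hw h⟩
  constructor
  · rintro ⟨⟨V', _, _, _, B', w', hB', hw', hG, hA, hA'⟩, hM, hs⟩
    exact ⟨⟨hA.transv_congr h2 hB' hB hw' hw hG, hA'.transv_congr h2 hB' hB hw' hw hG,
      hmul.mp hM⟩, hspan.mp hs⟩
  · rintro ⟨⟨hA, hA', hM⟩, hs⟩
    exact ⟨⟨V, _, _, ‹_›, B, w, hB, hw, rfl, hA, hA'⟩, hmul.mpr hM, hspan.mpr hs⟩

/-- A factorization together with a basis of the span of the ranges of `a - 1`, `b - 1` is the same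
as a matrix factorization. -/
theorem natCard_based_factorizations (h2 : (2 : F) ≠ 0) {V : Type u} [AddCommGroup V] [Module F V]
    [FiniteDimensional F V] {B : LinearMap.BilinForm F V} (hB : IsSymplectic B) {d m : ℕ}
    {u : Fin d → V} (Γ : Matrix (Fin d) (Fin d) F) (μ ν : SymplecticModifiedType F) :
    Nat.card (Σ p : factorizations B μ ν (transv B u Γ),
      {w : Fin (d + m) → V // w ∘ Fin.castAdd m = u ∧ LinearIndependent F w ∧
        Submodule.span F (Set.range w) =
          LinearMap.range (p.1.1 - 1) ⊔ LinearMap.range (p.1.2 - 1)}) =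
    Nat.card (Σ G : {G : Matrix (Fin (d + m)) (Fin (d + m)) F × Matrix (Fin (d + m)) (Fin (d + m)) F
        × Matrix (Fin (d + m)) (Fin (d + m)) F //
        IsMatrixFactorization μ ν (padMatrix (Fin.castAdd m) Γ) G.1 G.2.1 G.2.2},
      {w : Fin (d + m) → V // w ∘ Fin.castAdd m = u ∧ LinearIndependent F w ∧
        gram B w = G.1.1}) := by
  symm
  -- `padMatrix` appears because the product `transv B u Γ` is rewritten in the longer family `w`
  -- extending `u`.
  have key : ∀ (G A A' : Matrix (Fin (d + m)) (Fin (d + m)) F) (w : Fin (d + m) → V),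
      w ∘ Fin.castAdd m = u → LinearIndependent F w → gram B w = G →
      (IsMatrixFactorization μ ν (padMatrix (Fin.castAdd m) Γ) G A A' ↔
        (transv B w A, transv B w A') ∈ factorizations B μ ν (transv B u Γ) ∧
        Submodule.span F (Set.range w) = LinearMap.range (transv B w A - 1) ⊔
        LinearMap.range (transv B w A' - 1)) := by
    rintro _ A A' w rfl hw rfl
    rw [isMatrixFactorization_iff h2 hB hw, transv_comp]
  refine Nat.card_eq_of_bijective (fun x =>
    ⟨⟨(transv B x.2.1 x.1.1.2.1, transv B x.2.1 x.1.1.2.2),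
      ((key _ _ _ _ x.2.2.1 x.2.2.2.1 x.2.2.2.2).mp x.1.2).1⟩, x.2.1, x.2.2.1, x.2.2.2.1,
      ((key _ _ _ _ x.2.2.1 x.2.2.2.1 x.2.2.2.2).mp x.1.2).2⟩) ⟨?_, ?_⟩
  · rintro ⟨⟨⟨G, A, A'⟩, hG⟩, w, hwu, hw, hwG⟩ ⟨⟨⟨G₁, A₁, A₁'⟩, hG₁⟩, w₁, hwu₁, hw₁, hwG₁⟩ h
    obtain rfl : w = w₁ := congrArg (fun y => y.2.1) h
    have hA := congrArg (fun y => y.1.1) h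
    obtain ⟨hA, hA'⟩ := Prod.mk.inj hA
    obtain rfl := hB.transv_injective hw hA
    obtain rfl := hB.transv_injective hw hA'
    obtain rfl : G = G₁ := hwG.symm.trans hwG₁
    rfl
  · rintro ⟨⟨⟨a, b⟩, hab⟩, w, hwu, hw, hs⟩
    dsimp only at hs
    obtain ⟨⟨a', ha⟩, -⟩ := hab.1
    obtain ⟨⟨b', hb⟩, -⟩ := hab.2.1
    -- Since `w` spans both ranges, each factor has a matrix with respect to `w`.
    obtain ⟨A, rfl⟩ := ha.exists_eq_transv hB hw (le_sup_left.trans hs.ge)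
    obtain ⟨A', rfl⟩ := hb.exists_eq_transv hB hw (le_sup_right.trans hs.ge)
    exact ⟨⟨⟨(gram B w, A, A'), (key _ A A' w hwu hw rfl).mpr ⟨hab, hs⟩⟩, w, hwu, hw, rfl⟩, rfl⟩

/-- The dimension of the span of the ranges of `a - 1` and `b - 1` is bounded in terms of the
modified types of `a` and `b`. -/
theorem exists_rank_bound (h2 : (2 : F) ≠ 0) (μ ν : SymplecticModifiedType F) :
    ∃ K, ∀ (V : Type u) [AddCommGroup V] [Module F V] [FiniteDimensional F V]
      (B : LinearMap.BilinForm F V), IsSymplectic B → ∀ a b, IsIsometryOfType B μ a →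
      IsIsometryOfType B ν b →
      Module.finrank F (LinearMap.range (a - 1) ⊔ LinearMap.range (b - 1) : Submodule F V) ≤ K := by
  obtain ⟨d, hd⟩ := exists_rank h2 μ
  obtain ⟨d', hd'⟩ := exists_rank h2 ν
  refine ⟨d + d', fun V _ _ _ B hB a b ha hb => ?_⟩
  rw [← hd V B hB a ha, ← hd' V B hB b hb]
  exact Submodule.finrank_add_le_finrank_add_finrank _ _

/-- The number of factorizations of an isometry of a given modified type into isometries of given
modified types is a polynomial in the size of the symplectic space. -/
theorem exists_factorization_polynomial (h2 : (2 : F) ≠ 0) (μ ν κ : SymplecticModifiedType F) :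
    ∃ P : ℚ[X], ∀ (V : Type u) [AddCommGroup V] [Module F V] [FiniteDimensional F V]
      (B : LinearMap.BilinForm F V), IsSymplectic B → ∀ g, IsIsometryOfType B κ g →
      (Nat.card (factorizations B μ ν g) : ℚ) = P.eval (Nat.card V : ℚ) := by
  classical
  by_cases h : ∃ (V : Type u) (_ : AddCommGroup V) (_ : Module F V) (_ : FiniteDimensional F V)
      (B : LinearMap.BilinForm F V), IsSymplectic B ∧ ∃ g, IsIsometryOfType B κ g
  swap
  · exact ⟨0, fun V _ _ _ B hB g hg => absurd ⟨V, _, _, ‹_›, B, hB, g, hg⟩ h⟩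
  -- One realization of `κ` fixes `d`, `Γ` and the Gram matrix of `u₀`; every other isometry of type
  -- `κ` has the same normal form, whatever the space.
  obtain ⟨V₀, _, _, _, B₀, hB₀, g₀, hg₀⟩ := h
  obtain ⟨d, u₀, Γ, hu₀, hΓ, hr₀⟩ : ∃ (d : ℕ) (u₀ : Fin d → V₀) (Γ : Matrix (Fin d) (Fin d) F),
      LinearIndependent F u₀ ∧ g₀ = transv B₀ u₀ Γ ∧
        LinearMap.range (g₀ - 1) = Submodule.span F (Set.range u₀) :=
    ⟨_, hg₀.1.choose_spec.exists_basis_transv hB₀⟩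
  obtain ⟨K, hK⟩ := exists_rank_bound h2 μ ν
  choose E hE using fun m => exists_extension_polynomial (gram B₀ u₀) m
  have := Fintype.ofFinite F
  -- `P m` counts pairs of a factorization with `dim U = d + m` and a basis of `U` extending `u`.
  -- Each such `U` has `γ m` bases of this kind, so `P m / γ m` counts the factorizations
  -- themselves.
  let P : ℕ → ℚ[X] := fun m => ∑ G : {G : Matrix (Fin (d + m)) (Fin (d + m)) F ×
    Matrix (Fin (d + m)) (Fin (d + m)) F × Matrix (Fin (d + m)) (Fin (d + m)) F //
    IsMatrixFactorization μ ν (padMatrix (Fin.castAdd m) Γ) G.1 G.2.1 G.2.2}, E m G.1.1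
  let γ : ℕ → ℚ := fun m => extensionCount (Nat.card F) d m m
  refine ⟨∑ m ∈ Finset.range (K + 1), C (γ m)⁻¹ * P m, fun V _ _ _ B hB g hg => ?_⟩
  have : Finite V := Module.finite_of_finite F
  have : Finite (Module.End F V) := Finite.of_injective (fun f : Module.End F V => (f : V → V))
    DFunLike.coe_injective
  obtain ⟨u, hu, hGu, hgu, hru⟩ :=
    IsIsometryOfType.exists_transv h2 hB₀ hB hu₀ (hΓ ▸ hr₀) (hΓ ▸ hg₀) hg
  subst hgu
  let U : factorizations B μ ν (transv B u Γ) → Submodule F V := fun p =>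
    LinearMap.range (p.1.1 - 1) ⊔ LinearMap.range (p.1.2 - 1)
  have huU : ∀ p i, u i ∈ U p := by
    intro p i
    have h1 : u i ∈ LinearMap.range (transv B u Γ - 1) := by
      rw [hru]
      exact Submodule.subset_span ⟨i, rfl⟩
    rw [← p.2.2.2] at h1
    exact range_mul_sub_one_le _ _ h1
  have hUd : ∀ p, d ≤ Module.finrank F (U p) := by
    intro p
    have h1 := Submodule.finrank_mono (Submodule.span_le.mpr (Set.range_subset_iff.mpr (huU p)))
    rwa [finrank_span_eq_card hu, Fintype.card_fin] at h1
  have hUK : ∀ p, Module.finrank F (U p) ≤ K := fun p => hK V B hB _ _ p.2.1 p.2.2.1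
  have := Fintype.ofFinite (factorizations B μ ν (transv B u Γ))
  have hP : ∀ m, (P m).eval (Nat.card V : ℚ) =
      ∑ p : factorizations B μ ν (transv B u Γ), if Module.finrank F (U p) = d + m then γ m else 0 := by
    intro m
    have h1 := natCard_based_factorizations h2 hB (m := m) (u := u) Γ μ ν
    rw [Nat.card_sigma, Nat.card_sigma] at h1
    rw [eval_finsetSum]
    rw [Finset.sum_congr rfl fun G _ => (hE m G.1.1 V B hB u hu hGu).symm, ← Nat.cast_sum, ← h1,
      Nat.cast_sum]
    exact Finset.sum_congr rfl fun p _ => natCard_extensions_span hu (huU p)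
  rw [eval_finsetSum]
  simp only [eval_mul, eval_C, hP, Finset.mul_sum]
  rw [Finset.sum_comm, Nat.card_eq_fintype_card, ← Finset.card_univ, Finset.card_eq_sum_ones,
    Nat.cast_sum]
  refine Finset.sum_congr rfl fun p _ => ?_
  -- Every factorization is counted for exactly one `m`, and the bound `K` keeps that `m` in the
  -- range of summation.
  have hm : Module.finrank F (U p) = d + (Module.finrank F (U p) - d) := by
    have := hUd p
    omega
  rw [Finset.sum_eq_single (Module.finrank F (U p) - d)]
  · rw [if_pos hm, inv_mul_cancel₀, Nat.cast_one]
    exact extensionCount_ne_zero (by exact_mod_cast Finite.one_lt_card) _ _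
  · intro m _ hm'
    rw [if_neg (by omega), mul_zero]
  · intro h1
    have := hUK p
    exact absurd (Finset.mem_range.mpr (by omega)) h1

/-! ### From integers at large powers to quantum integer-valued polynomials -/

section Integrality

theorem zpow_mem_adjoin (Q : ℚ) (n : ℤ) : Q ^ n ∈ Algebra.adjoin ℤ ({Q, Q⁻¹} : Set ℚ) := by
  obtain ⟨k, rfl | rfl⟩ := n.eq_nat_or_neg
  · rw [zpow_natCast]
    exact pow_mem (Algebra.subset_adjoin (by simp)) k
  · rw [zpow_neg, zpow_natCast, ← inv_pow]
    exact pow_mem (Algebra.subset_adjoin (by simp)) k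

theorem exists_aeval_sub_eq (A : Subalgebra ℤ ℚ) (R : ℤ[X]) {x y : ℚ} (hx : x ∈ A) (hy : y ∈ A) :
    ∃ c ∈ A, aeval x R - aeval y R = (x - y) * c := by
  obtain ⟨c, hc⟩ := sub_dvd_eval_sub (⟨x, hx⟩ : A) ⟨y, hy⟩ (R.map (algebraMap ℤ A))
  refine ⟨c, c.2, ?_⟩
  rw [eval_map_algebraMap, eval_map_algebraMap] at hc
  have h1 := congrArg A.val hc
  rw [map_sub, map_mul, map_sub, ← aeval_algHom_apply, ← aeval_algHom_apply] at h1
  exact h1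

/-- The powers of `b` are eventually periodic modulo `D`. -/
theorem exists_dvd_pow_sub_pow (b : ℤ) {D : ℤ} (hD : D ≠ 0) :
    ∃ a M : ℕ, 0 < M ∧ D ∣ b ^ (a + M) - b ^ a := by
  have : NeZero D.natAbs := ⟨Int.natAbs_ne_zero.mpr hD⟩
  obtain ⟨i, j, hij, h⟩ := Finite.exists_ne_map_eq_of_infinite fun n : ℕ => (b : ZMod D.natAbs) ^ n
  have key : ∀ i j : ℕ, i < j → (b : ZMod D.natAbs) ^ i = (b : ZMod D.natAbs) ^ j →
      ∃ a M : ℕ, 0 < M ∧ D ∣ b ^ (a + M) - b ^ a := by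
    intro i j hij h
    refine ⟨i, j - i, Nat.sub_pos_of_lt hij, ?_⟩
    rw [Nat.add_sub_of_le hij.le, ← Int.natAbs_dvd, ← ZMod.intCast_zmod_eq_zero_iff_dvd]
    push_cast
    rw [h, sub_self]
  rcases hij.lt_or_gt with hlt | hlt
  · exact key i j hlt h
  · exact key j i hlt h.symm

theorem exists_int_multiple (P : ℚ[X]) :
    ∃ (D : ℤ) (R : ℤ[X]), D ≠ 0 ∧ ∀ x : ℚ, aeval x R = D * P.eval x := by
  obtain ⟨b, hb, h⟩ := IsLocalization.integerNormalization_spec (nonZeroDivisors ℤ) P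
  refine ⟨b, IsLocalization.integerNormalization (nonZeroDivisors ℤ) P,
    nonZeroDivisors.ne_zero hb, fun x => ?_⟩
  rw [← eval_map_algebraMap, h, eval_smul, zsmul_eq_mul]

/-- A polynomial with integral values at almost all powers of `b` has values in `ℤ[b, b⁻¹]` at all
powers of `b`. -/
theorem eval_zpow_mem_adjoin {b : ℤ} (hb : b ≠ 0) {P : ℚ[X]} {n₀ : ℕ}
    (hP : ∀ n : ℕ, n₀ ≤ n → ∃ z : ℤ, P.eval ((b : ℚ) ^ n) = z) (n : ℤ) :
    P.eval ((b : ℚ) ^ n) ∈ Algebra.adjoin ℤ ({(b : ℚ), (b : ℚ)⁻¹} : Set ℚ) := by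
  set A := Algebra.adjoin ℤ ({(b : ℚ), (b : ℚ)⁻¹} : Set ℚ) with hA
  have hbQ : (b : ℚ) ≠ 0 := by exact_mod_cast hb
  -- Here `R = D * P` has integer coefficients. The exponent `n` is compared with `N = n + M * t ≥
  -- n₀`, where `P` is integral. Inside `A`, the difference `R (b ^ N) - R (b ^ n)` is divisible by
  -- `b ^ N - b ^ n`, hence by `b ^ M - 1`, hence by `D`, because `D` divides `b ^ a * (b ^ M - 1)`
  -- and `b` is a unit of `A`. Cancelling `D` shows that `P (b ^ n)` differs from an integer by an
  -- element of `A`.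
  obtain ⟨D, R, hD, hR⟩ := exists_int_multiple P
  have hDQ : (D : ℚ) ≠ 0 := by exact_mod_cast hD
  obtain ⟨a, M, hM, z, hz⟩ := exists_dvd_pow_sub_pow b hD
  obtain ⟨t, ht⟩ : ∃ t : ℕ, (n₀ : ℤ) ≤ n + M * t := by
    refine ⟨(n₀ - n).toNat, ?_⟩
    have h1 := Int.self_le_toNat ((n₀ : ℤ) - n)
    have h3 : ((n₀ : ℤ) - n).toNat ≤ (M : ℤ) * ((n₀ : ℤ) - n).toNat :=
      le_mul_of_one_le_left (Int.natCast_nonneg _) (by exact_mod_cast hM)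
    linarith
  obtain ⟨N, hN⟩ := Int.eq_ofNat_of_zero_le ((Int.natCast_nonneg n₀).trans ht)
  obtain ⟨v, hv⟩ := hP N (by rw [hN] at ht; exact_mod_cast ht)
  obtain ⟨c, hc, hcR⟩ := exists_aeval_sub_eq A R (zpow_mem_adjoin (b : ℚ) N)
    (zpow_mem_adjoin (b : ℚ) n)
  rw [hR, hR, zpow_natCast, hv] at hcR
  obtain ⟨e, he⟩ := sub_dvd_pow_sub_pow ((b : ℤ) ^ M) 1 t
  rw [one_pow, ← pow_mul] at he
  have hzQ : (b : ℚ) ^ M - 1 = D * z * (b : ℚ) ^ (-a : ℤ) := by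
    have : (b : ℚ) ^ (a + M) - (b : ℚ) ^ a = D * z := by exact_mod_cast hz
    rw [← this, zpow_neg, zpow_natCast, pow_add]
    field_simp
  have heQ : (b : ℚ) ^ (M * t) - 1 = ((b : ℚ) ^ M - 1) * e := by exact_mod_cast he
  have hNQ : (b : ℚ) ^ N = (b : ℚ) ^ n * (b : ℚ) ^ (M * t) := by
    rw [← zpow_natCast, ← zpow_natCast, ← zpow_add₀ hbQ]
    congr 1
    push_cast
    exact hN.symm
  have hval : P.eval ((b : ℚ) ^ n) = v - (b : ℚ) ^ n * (z * (b : ℚ) ^ (-a : ℤ) * e) * c := by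
    refine mul_left_cancel₀ hDQ ?_
    have h1 : (b : ℚ) ^ N - (b : ℚ) ^ n = (b : ℚ) ^ n * ((b : ℚ) ^ (M * t) - 1) := by
      rw [hNQ]; ring
    rw [h1, heQ, hzQ] at hcR
    linear_combination -hcR
  have hint : ∀ x : ℤ, (x : ℚ) ∈ A := fun x => A.algebraMap_mem x
  rw [hval]
  exact sub_mem (hint v) (mul_mem (mul_mem (zpow_mem_adjoin _ _)
    (mul_mem (mul_mem (hint z) (zpow_mem_adjoin _ _)) (hint e))) hc)

/-- The polynomial in the quantum integer `[n]_Q` obtained from a polynomial in `Q ^ n`. -/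
def toQuantum (Q : ℚ) (P : ℚ[X]) : ℚ[X] := P.comp (1 + C (Q - 1) * X)

theorem eval_toQuantum {Q : ℚ} (hQ : Q ≠ 1) (P : ℚ[X]) (n : ℤ) :
    (toQuantum Q P).eval (qInt Q n) = P.eval (Q ^ n) := by
  rw [toQuantum, eval_comp, eval_add, eval_one, eval_mul, eval_C, eval_X, qInt,
    mul_div_cancel₀ _ (sub_ne_zero.mpr hQ), add_sub_cancel]

theorem toQuantum_mem {b : ℤ} (hb : 1 < b) {P : ℚ[X]} {n₀ : ℕ}
    (hP : ∀ n : ℕ, n₀ ≤ n → ∃ z : ℤ, P.eval ((b : ℚ) ^ n) = z) :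
    toQuantum b P ∈ quantumIntValued b := fun n => by
  rw [eval_toQuantum (by exact_mod_cast hb.ne')]
  exact eval_zpow_mem_adjoin (by omega) hP n

end Integrality

/-! ### The standard symplectic spaces -/

section StandardSpace

variable (F : Type u) [Field F]

/-- `stdForm` as a bilinear form. -/
def stdBilin (n : ℕ) : LinearMap.BilinForm F (Fin n ⊕ Fin n → F) :=
  LinearMap.mk₂ F stdForm
    (fun x y z => by
      rw [stdForm, stdForm, stdForm, ← Finset.sum_add_distrib]
      exact Finset.sum_congr rfl fun i _ => by simp only [Pi.add_apply]; ring)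
    (fun c x y => by
      rw [stdForm, stdForm, smul_eq_mul, Finset.mul_sum]
      exact Finset.sum_congr rfl fun i _ => by simp only [Pi.smul_apply, smul_eq_mul]; ring)
    (fun x y z => by
      rw [stdForm, stdForm, stdForm, ← Finset.sum_add_distrib]
      exact Finset.sum_congr rfl fun i _ => by simp only [Pi.add_apply]; ring)
    (fun c x y => by
      rw [stdForm, stdForm, smul_eq_mul, Finset.mul_sum]
      exact Finset.sum_congr rfl fun i _ => by simp only [Pi.smul_apply, smul_eq_mul]; ring)

theorem stdBilin_apply {n : ℕ} (x y : Fin n ⊕ Fin n → F) : stdBilin F n x y = stdForm x y := rfl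

theorem isSymplectic_stdBilin (n : ℕ) : IsSymplectic (stdBilin F n) := by
  refine ⟨fun x => ?_, fun x hx => ?_⟩
  · rw [stdBilin_apply, stdForm]
    exact Finset.sum_eq_zero fun i _ => by ring
  · funext j
    rcases j with i | i
    · have := hx (Pi.single (Sum.inr i) 1)
      simpa [stdBilin_apply, stdForm, Pi.single_apply] using this
    · have := hx (Pi.single (Sum.inl i) 1)
      simpa [stdBilin_apply, stdForm, Pi.single_apply] using this

variable {F} [Finite F]

/-- Identity summands are added, and Witt's theorem for empty families identifies the orthogonal sum
of standard spaces with a standard space. -/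
theorem exists_isIsometryOfType_of_le (h2 : (2 : F) ≠ 0) {μ : SymplecticModifiedType F} {n n' : ℕ}
    (hn : n ≤ n') (h : ∃ g, IsIsometryOfType (stdBilin F n) μ g) :
    ∃ g, IsIsometryOfType (stdBilin F n') μ g := by
  obtain ⟨g, ⟨g', hg⟩, hμ⟩ := h
  obtain ⟨m, rfl⟩ := Nat.exists_eq_add_of_le hn
  obtain ⟨f, hf, -⟩ := ((isSymplectic_stdBilin F n).prodForm (isSymplectic_stdBilin F m)).exists_isometry
    (isSymplectic_stdBilin F (n + m)) (by simp; ring) (s := 0) (w := Fin.elim0) (w' := Fin.elim0)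
    (linearIndependent_empty_type) (linearIndependent_empty_type) (fun i => i.elim0)
  have h1 := hμ.prodMap_one h2 hg (stdBilin F m)
  refine ⟨f.toLinearMap ∘ₗ (g.prodMap 1) ∘ₗ f.symm.toLinearMap, ?_, h1.map f (fun v => by simp) hf⟩
  refine (isSymplectic_stdBilin F (n + m)).exists_isIsometryPair fun x y => ?_
  have h3 := (hg.prodMap (IsIsometryPair.one (stdBilin F m))).isom (f.symm x) (f.symm y)
  rw [← hf, ← hf] at h3
  simpa using h3

/-- Only finitely many modified types are realized by isometries `g` for which `g - 1` has bounded
rank. -/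
theorem finite_setOf_rank_le (h2 : (2 : F) ≠ 0) (K : ℕ) :
    {μ : SymplecticModifiedType F | ∃ (V : Type u) (_ : AddCommGroup V) (_ : Module F V)
      (_ : FiniteDimensional F V) (B : LinearMap.BilinForm F V) (g : Module.End F V),
      IsSymplectic B ∧ IsIsometryOfType B μ g ∧
        Module.finrank F (LinearMap.range (g - 1)) ≤ K}.Finite := by
  -- Each type is encoded by the rank, a Gram matrix and a matrix over the finite field, and by
  -- `transv_congr` these finitely many data determine the type.
  have key : ∀ μ : {μ : SymplecticModifiedType F | ∃ (V : Type u) (_ : AddCommGroup V)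
      (_ : Module F V) (_ : FiniteDimensional F V) (B : LinearMap.BilinForm F V)
      (g : Module.End F V), IsSymplectic B ∧ IsIsometryOfType B μ g ∧
        Module.finrank F (LinearMap.range (g - 1)) ≤ K},
      ∃ x : Σ d : Fin (K + 1), Matrix (Fin d) (Fin d) F × Matrix (Fin d) (Fin d) F,
        ∃ (V : Type u) (_ : AddCommGroup V) (_ : Module F V) (_ : FiniteDimensional F V)
          (B : LinearMap.BilinForm F V) (u : Fin x.1 → V), IsSymplectic B ∧
          LinearIndependent F u ∧ gram B u = x.2.1 ∧ IsIsometryOfType B μ.1 (transv B u x.2.2) := by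
    rintro ⟨μ, V, _, _, _, B, g, hB, hg, hK⟩
    obtain ⟨u, Γ, hu, hΓ, -⟩ := hg.1.choose_spec.exists_basis_transv hB
    exact ⟨⟨⟨_, Nat.lt_succ_of_le hK⟩, gram B u, Γ⟩, V, _, _, ‹_›, B, u, hB, hu, rfl, hΓ ▸ hg⟩
  choose f hf using key
  refine Set.finite_coe_iff.mp (Finite.of_injective f fun μ ν h => Subtype.ext ?_)
  obtain ⟨V, _, _, _, B, u, hB, hu, hG, hμ⟩ := hf μ
  obtain ⟨V', _, _, _, B', u', hB', hu', hG', hν⟩ := hf ν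
  generalize f μ = x at *
  generalize f ν = y at *
  subst h
  exact (hμ.transv_congr h2 hB hB' hu hu' (hG.trans hG'.symm)).2.unique hν.2

end StandardSpace

/-! ### Translation between symplectic matrices and isometries -/

section Matrices

variable {F : Type u} [Field F] {n : ℕ}

theorem stdForm_eq_neg_dotProduct (x y : Fin n ⊕ Fin n → F) :
    stdForm x y = -(x ⬝ᵥ (Matrix.J (Fin n) F).mulVec y) := by
  simp [stdForm, Matrix.J, Matrix.fromBlocks_mulVec, dotProduct, Matrix.neg_mulVec,
    Finset.sum_sub_distrib]
  ring

theorem mem_symplecticGroup_iff_stdForm (A : Matrix (Fin n ⊕ Fin n) (Fin n ⊕ Fin n) F) :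
    A ∈ Matrix.symplecticGroup (Fin n) F ↔
      ∀ x y, stdForm (A.mulVec x) (A.mulVec y) = stdForm x y := by
  have h1 : ∀ x y, stdForm (A.mulVec x) (A.mulVec y) =
      -(x ⬝ᵥ (A.transpose * Matrix.J (Fin n) F * A).mulVec y) := by
    intro x y
    rw [stdForm_eq_neg_dotProduct, ← Matrix.mulVec_mulVec, ← Matrix.mulVec_mulVec,
      Matrix.dotProduct_mulVec x, Matrix.vecMul_transpose]
  rw [SymplecticGroup.mem_iff']
  simp only [h1, stdForm_eq_neg_dotProduct, neg_inj]
  refine ⟨fun h x y => by rw [h], fun h => Matrix.mulVec_injective (funext fun y => ?_)⟩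
  exact dotProduct_eq _ _ fun x => by rw [dotProduct_comm, h, dotProduct_comm]

theorem toLin'_sub_pow (A : Matrix (Fin n ⊕ Fin n) (Fin n ⊕ Fin n) F) (ε : F) (i : ℕ) :
    (Matrix.toLin' A - algebraMap F (Module.End F (Fin n ⊕ Fin n → F)) ε) ^ i =
      Matrix.toLin' ((A - Matrix.scalar _ ε) ^ i) := by
  have h1 := map_pow (Matrix.toLinAlgEquiv' (R := F) (n := Fin n ⊕ Fin n)) (A - Matrix.scalar _ ε) i
  have h3 : Matrix.scalar (Fin n ⊕ Fin n) ε = algebraMap F _ ε := rfl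
  rw [map_sub, h3, AlgEquiv.commutes] at h1
  exact h1.symm

theorem isPlusTypeOf_toLin'_iff (A : Matrix (Fin n ⊕ Fin n) (Fin n ⊕ Fin n) F) (ε : F) (i m : ℕ) :
    IsPlusTypeOf (stdBilin F n) (Matrix.toLin' A) ε i m ↔ IsPlusType A ε i m := by
  unfold IsPlusTypeOf IsPlusType
  simp only [toLin'_sub_pow, Matrix.toLin'_apply, stdBilin_apply]

theorem signOf_toLin' (A : Matrix (Fin n ⊕ Fin n) (Fin n ⊕ Fin n) F) (ε : F) (p : Multiset ℕ+)
    (i : ℕ+) : signOf (stdBilin F n) (Matrix.toLin' A) ε p i = hermitianSign A ε p i := by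
  have := isPlusTypeOf_toLin'_iff A ε i (p.count i)
  unfold signOf hermitianSign
  split_ifs <;> simp_all

theorem exists_isIsometryPair_toLin' (g : Matrix.symplecticGroup (Fin n) F) :
    ∃ g', IsIsometryPair (stdBilin F n) (Matrix.toLin' g.1) g' :=
  (isSymplectic_stdBilin F n).exists_isIsometryPair
    ((mem_symplecticGroup_iff_stdForm g.1).mp g.2)

theorem hasModifiedType_iff (g : Matrix.symplecticGroup (Fin n) F) (μ : SymplecticModifiedType F) :
    HasModifiedType g μ ↔ IsIsometryOfType (stdBilin F n) μ (Matrix.toLin' g.1) := by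
  have h1 : ∀ σ, HasLabel g σ ↔ HasLabelOf (stdBilin F n) (Matrix.toLin' g.1) σ := by
    intro σ
    unfold HasLabel HasLabelOf
    simp only [signOf_toLin']
  unfold HasModifiedType IsIsometryOfType HasModifiedTypeOf
  simp only [h1]
  exact ⟨fun h => ⟨exists_isIsometryPair_toLin' g, h⟩, fun h => h.2⟩

theorem existsUnique_hasModifiedType (h2 : (2 : F) ≠ 0) (g : Matrix.symplecticGroup (Fin n) F) :
    ∃! μ, HasModifiedType g μ := by
  simp only [hasModifiedType_iff]
  obtain ⟨g', hg⟩ := exists_isIsometryPair_toLin' g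
  obtain ⟨μ, hμ⟩ := exists_hasModifiedTypeOf h2 (isSymplectic_stdBilin F n) hg
  exact ⟨μ, ⟨⟨g', hg⟩, hμ⟩, fun ν hν => hν.2.unique hμ⟩

theorem exists_toLin'_eq {f : Module.End F (Fin n ⊕ Fin n → F)}
    (hf : ∀ x y, stdBilin F n (f x) (f y) = stdBilin F n x y) :
    ∃ h : Matrix.symplecticGroup (Fin n) F, Matrix.toLin' h.1 = f := by
  refine ⟨⟨LinearMap.toMatrix' f, ?_⟩, Matrix.toLin'_toMatrix' f⟩
  rw [mem_symplecticGroup_iff_stdForm]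
  intro x y
  rw [← Matrix.toLin'_apply, ← Matrix.toLin'_apply, Matrix.toLin'_toMatrix']
  exact hf x y

/-- The modified type determines the conjugacy class, and is invariant under conjugation. -/
theorem hasModifiedType_iff_isConj [Finite F] (h2 : (2 : F) ≠ 0)
    {g k : Matrix.symplecticGroup (Fin n) F} {μ : SymplecticModifiedType F}
    (hg : HasModifiedType g μ) : HasModifiedType k μ ↔ IsConj g k := by
  rw [hasModifiedType_iff] at hg ⊢
  have hB := isSymplectic_stdBilin F n
  constructor
  · intro hk
    obtain ⟨f, hf, hfg⟩ := hg.2.exists_intertwining h2 hB hB hg.1.choose_spec hk.1.choose_spec rfl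
      hk.2
    obtain ⟨h, hh⟩ := exists_toLin'_eq (f := f.toLinearMap) hf
    rw [isConj_iff]
    refine ⟨h, mul_inv_eq_of_eq_mul (Subtype.ext ?_)⟩
    refine Matrix.toLin'.injective (LinearMap.ext fun v => ?_)
    change Matrix.toLin' (h.1 * g.1) v = Matrix.toLin' (k.1 * h.1) v
    rw [Matrix.toLin'_mul, Matrix.toLin'_mul, hh]
    exact hfg v
  · intro hc
    obtain ⟨h, rfl⟩ := isConj_iff.mp hc
    refine ⟨exists_isIsometryPair_toLin' _, ?_⟩
    obtain ⟨h', hh⟩ := exists_isIsometryPair_toLin' h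
    let f : (Fin n ⊕ Fin n → F) ≃ₗ[F] (Fin n ⊕ Fin n → F) :=
      LinearEquiv.ofLinearMap (Matrix.toLin' h.1) h' hh.mul_inv hh.inv_mul
    refine hg.2.map f (fun v => ?_) hh.isom
    change Matrix.toLin' h.1 (Matrix.toLin' g.1 v) =
      Matrix.toLin' (h * g * h⁻¹).1 (Matrix.toLin' h.1 v)
    rw [← LinearMap.comp_apply, ← LinearMap.comp_apply, ← Matrix.toLin'_mul, ← Matrix.toLin'_mul]
    have : h * g = h * g * h⁻¹ * h := by group
    have h3 : h.1 * g.1 = (h * g * h⁻¹).1 * h.1 := congrArg Subtype.val this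
    rw [h3]

theorem natCard_factorizations (g : Matrix.symplecticGroup (Fin n) F)
    (μ ν : SymplecticModifiedType F) :
    Nat.card (factorizations (stdBilin F n) μ ν (Matrix.toLin' g.1)) =
      Nat.card {p : Matrix.symplecticGroup (Fin n) F × Matrix.symplecticGroup (Fin n) F //
        HasModifiedType p.1 μ ∧ HasModifiedType p.2 ν ∧ p.1 * p.2 = g} := by
  symm
  have hinj : ∀ a b : Matrix.symplecticGroup (Fin n) F,
      Matrix.toLin' a.1 = Matrix.toLin' b.1 → a = b :=
    fun a b h => Subtype.ext (Matrix.toLin'.injective h)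
  have hmul : ∀ a b : Matrix.symplecticGroup (Fin n) F,
      Matrix.toLin' (a * b).1 = Matrix.toLin' a.1 * Matrix.toLin' b.1 :=
    fun a b => Matrix.toLin'_mul a.1 b.1
  refine Nat.card_eq_of_bijective (fun p => ⟨(Matrix.toLin' p.1.1.1, Matrix.toLin' p.1.2.1),
    (hasModifiedType_iff _ _).mp p.2.1, (hasModifiedType_iff _ _).mp p.2.2.1,
    (hmul _ _).symm.trans (congrArg (fun h : Matrix.symplecticGroup (Fin n) F =>
      Matrix.toLin' h.1) p.2.2.2)⟩) ⟨?_, ?_⟩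
  · rintro ⟨⟨a, b⟩, h⟩ ⟨⟨a', b'⟩, h'⟩ heq
    obtain ⟨h1, h3⟩ := Prod.mk.inj (congrArg Subtype.val heq)
    obtain rfl := hinj _ _ h1
    obtain rfl := hinj _ _ h3
    rfl
  · rintro ⟨⟨a, b⟩, ha, hb, hab⟩
    obtain ⟨a, rfl⟩ := exists_toLin'_eq ha.1.choose_spec.isom
    obtain ⟨b, rfl⟩ := exists_toLin'_eq hb.1.choose_spec.isom
    exact ⟨⟨(a, b), (hasModifiedType_iff _ _).mpr ha, (hasModifiedType_iff _ _).mpr hb,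
      hinj _ _ ((hmul a b).trans hab)⟩, rfl⟩

end Matrices

/-! ### The structure constants -/

section StructureConstants

variable {F : Type u} [Field F] [Fintype F]

theorem exists_structure_constants (h2 : (2 : F) ≠ 0) (μ ν : SymplecticModifiedType F) :
    ∃ r : SymplecticModifiedType F →₀ quantumIntValued ((Fintype.card F : ℚ) ^ 2),
      ∀ (n : ℕ) (κ : SymplecticModifiedType F) (g : Module.End F (Fin n ⊕ Fin n → F)),
        IsIsometryOfType (stdBilin F n) κ g →
        (Nat.card (factorizations (stdBilin F n) μ ν g) : ℚ) =
          (r κ : ℚ[X]).eval (qInt ((Fintype.card F : ℚ) ^ 2) n) := by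
  classical
  choose P hP using fun κ => exists_factorization_polynomial h2 μ ν κ
  let b : ℤ := (Fintype.card F : ℤ) ^ 2
  have hb : 1 < b := one_lt_pow₀ (by exact_mod_cast Fintype.one_lt_card) two_ne_zero
  have hbQ : (b : ℚ) = (Fintype.card F : ℚ) ^ 2 := by simp [b]
  have hcard : ∀ n : ℕ, (Nat.card (Fin n ⊕ Fin n → F) : ℚ) = (b : ℚ) ^ n := by
    intro n
    rw [hbQ, Nat.card_eq_fintype_card, Fintype.card_fun, Fintype.card_sum, Fintype.card_fin,
      ← pow_mul, two_mul, Nat.cast_pow]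
  have hP' : ∀ (n : ℕ) (κ : SymplecticModifiedType F) (g : Module.End F (Fin n ⊕ Fin n → F)),
      IsIsometryOfType (stdBilin F n) κ g →
      (Nat.card (factorizations (stdBilin F n) μ ν g) : ℚ) = (P κ).eval ((b : ℚ) ^ n) := by
    intro n κ g hg
    rw [← hcard]
    exact hP κ _ _ (isSymplectic_stdBilin F n) g hg
  have hmem : ∀ κ, (∃ n, ∃ g, IsIsometryOfType (stdBilin F n) κ g) →
      toQuantum ((Fintype.card F : ℚ) ^ 2) (P κ) ∈ quantumIntValued ((Fintype.card F : ℚ) ^ 2) := by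
    rintro κ ⟨n₀, hn₀⟩
    rw [← hbQ]
    -- Once `κ` occurs in dimension `2 n₀` it occurs in all larger ones, so there the values of `P
    -- κ` are cardinalities.
    refine toQuantum_mem hb (n₀ := n₀) fun n hn => ?_
    obtain ⟨g, hg⟩ := exists_isIsometryOfType_of_le h2 hn hn₀
    exact ⟨Nat.card (factorizations (stdBilin F n) μ ν g), by rw [← hP' n κ g hg]; norm_cast⟩
  -- For a type that occurs in no dimension the polynomial is arbitrary and integrality could fail;
  -- the value `0` is harmless, since the class sums vanish.
  let r : SymplecticModifiedType F → quantumIntValued ((Fintype.card F : ℚ) ^ 2) := fun κ =>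
    if h : ∃ n, ∃ g, IsIsometryOfType (stdBilin F n) κ g then ⟨_, hmem κ h⟩ else 0
  have hfin : (Function.support r).Finite := by
    obtain ⟨K, hK⟩ := exists_rank_bound h2 μ ν
    refine (finite_setOf_rank_le h2 K).subset fun κ hκ => ?_
    have hreal : ∃ n, ∃ g, IsIsometryOfType (stdBilin F n) κ g := by
      by_contra h
      exact hκ (dif_neg h)
    -- A nonzero polynomial cannot vanish at all large powers of `b`, so some isometry of type `κ`
    -- is a product of isometries of types `μ` and `ν`. This bounds the rank of `g - 1` by `K`, and
    -- only finitely many types remain.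
    have hPκ : P κ ≠ 0 := by
      intro h
      refine hκ ((dif_pos hreal).trans (Subtype.ext ?_))
      change toQuantum _ (P κ) = 0
      rw [h, toQuantum, zero_comp]
    obtain ⟨n₀, hn₀⟩ := hreal
    obtain ⟨n, hn, hne⟩ : ∃ n, n₀ ≤ n ∧ (P κ).eval ((b : ℚ) ^ n) ≠ 0 := by
      by_contra! h
      refine hPκ (eq_zero_of_infinite_isRoot _ (Set.infinite_of_injective_forall_mem
        (f := fun n : ℕ => (b : ℚ) ^ (n₀ + n)) (fun i j hij => ?_) fun n => h _ (by omega)))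
      have := pow_right_injective₀ (by exact_mod_cast zero_lt_one.trans hb)
        (by exact_mod_cast hb.ne') hij
      omega
    obtain ⟨g, hg⟩ := exists_isIsometryOfType_of_le h2 hn hn₀
    rw [← hP' n κ g hg] at hne
    have hne' : Nat.card (factorizations (stdBilin F n) μ ν g) ≠ 0 := by exact_mod_cast hne
    obtain ⟨⟨⟨a, b⟩, ha, hb, hab⟩⟩ := (Nat.card_ne_zero.mp hne').1
    refine ⟨_, _, _, inferInstance, stdBilin F n, g, isSymplectic_stdBilin F n, hg, ?_⟩
    rw [← hab]
    exact (Submodule.finrank_mono (range_mul_sub_one_le a b)).trans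
      (hK _ _ (isSymplectic_stdBilin F n) a b ha hb)
  refine ⟨Finsupp.ofSupportFinite r hfin, fun n κ g hg => ?_⟩
  have h1 : (r κ : ℚ[X]) = toQuantum ((Fintype.card F : ℚ) ^ 2) (P κ) :=
    congrArg Subtype.val (dif_pos ⟨n, g, hg⟩)
  rw [Finsupp.ofSupportFinite_coe, h1, eval_toQuantum, hP' n κ g hg, hbQ, zpow_natCast]
  rw [← hbQ]
  exact_mod_cast hb.ne'

end StructureConstants

theorem coeff_toRat {F : Type*} [Field F] {n : ℕ}
    (z : MonoidAlgebra ℤ (Matrix.symplecticGroup (Fin n) F))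
    (g : Matrix.symplecticGroup (Fin n) F) : (toRat F n z).coeff g = z.coeff g := by
  simp [toRat]

/-! ### Class sums and the centre of the group ring -/

section Centre

variable {F : Type u} [Field F] [Fintype F] {n : ℕ}

open Classical in
theorem coeff_classSum (μ : SymplecticModifiedType F) (g : Matrix.symplecticGroup (Fin n) F) :
    (classSum F n μ).coeff g = if HasModifiedType g μ then 1 else 0 := by
  rw [classSum, MonoidAlgebra.coeff_sum, Finsupp.finsetSum_apply]
  simp only [MonoidAlgebra.of_apply, MonoidAlgebra.coeff_single, Finsupp.single_apply]
  rw [Finset.sum_ite_eq']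
  simp

theorem coeff_classSum_mul (μ ν : SymplecticModifiedType F)
    (g : Matrix.symplecticGroup (Fin n) F) :
    (classSum F n μ * classSum F n ν).coeff g =
      (Nat.card (factorizations (stdBilin F n) μ ν (Matrix.toLin' g.1)) : ℤ) := by
  classical
  rw [MonoidAlgebra.coeff_mul_antidiag _ _ g (Finset.univ.filter fun p => p.1 * p.2 = g)
    (by simp), natCard_factorizations, Nat.card_eq_fintype_card, Fintype.card_subtype,
    Finset.card_filter, Finset.sum_filter, Nat.cast_sum]
  refine Finset.sum_congr rfl fun p _ => ?_
  rw [coeff_classSum, coeff_classSum]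
  by_cases h1 : HasModifiedType p.1 μ <;> by_cases h3 : HasModifiedType p.2 ν <;>
    by_cases h4 : p.1 * p.2 = g <;> simp [h1, h3, h4]

/-- Every element has only one modified type, so distinct class sums have disjoint supports. -/
theorem linearIndependent_classSum (h2 : (2 : F) ≠ 0) :
    LinearIndependent ℤ (fun μ : {μ : SymplecticModifiedType F // classSum F n μ ≠ 0} =>
      classSum F n μ.1) := by
  classical
  rw [linearIndependent_iff']
  intro s c hc μ hμ
  obtain ⟨g, hg⟩ : ∃ g : Matrix.symplecticGroup (Fin n) F, HasModifiedType g μ.1 := by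
    by_contra! h
    refine μ.2 (MonoidAlgebra.coeff_injective (Finsupp.ext fun g => ?_))
    rw [coeff_classSum, if_neg (h g)]
    rfl
  have h1 := congrArg (fun x : MonoidAlgebra ℤ _ => x.coeff g) hc
  simp only [MonoidAlgebra.coeff_sum, Finsupp.finsetSum_apply, MonoidAlgebra.coeff_smul_apply,
    coeff_classSum, MonoidAlgebra.coeff_zero, Finsupp.zero_apply] at h1
  rw [Finset.sum_eq_single_of_mem μ hμ] at h1
  · simpa [hg] using h1
  · intro ν _ hν
    rw [if_neg, smul_zero]
    intro h
    exact hν (Subtype.ext ((existsUnique_hasModifiedType h2 g).unique h hg))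

theorem mem_center_monoidAlgebra_iff {G : Type*} [Group G] (z : MonoidAlgebra ℤ G) :
    z ∈ Subalgebra.center ℤ (MonoidAlgebra ℤ G) ↔ ∀ g k : G, IsConj g k →
      z.coeff g = z.coeff k := by
  rw [Subalgebra.mem_center_iff]
  constructor
  · intro h g k hgk
    obtain ⟨c, rfl⟩ := isConj_iff.mp hgk
    have h1 := congrArg (fun x : MonoidAlgebra ℤ G => x.coeff (c * g)) (h (MonoidAlgebra.single c 1))
    simp only [MonoidAlgebra.coeff_single_mul_apply, MonoidAlgebra.coeff_mul_single_apply, one_mul,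
      mul_one, inv_mul_cancel_left] at h1
    exact h1
  · intro h b
    induction b using MonoidAlgebra.induction_linear with
    | zero => rw [zero_mul, mul_zero]
    | add x y hx hy => rw [add_mul, mul_add, hx, hy]
    | single g r =>
      refine MonoidAlgebra.coeff_injective (Finsupp.ext fun k => ?_)
      rw [MonoidAlgebra.coeff_single_mul_apply, MonoidAlgebra.coeff_mul_single_apply, mul_comm r]
      congr 1
      exact h _ _ (isConj_iff.mpr ⟨g, by group⟩)

/-- Central elements are those constant on conjugacy classes, and the modified types cut the group
into exactly these classes. -/
theorem span_classSum (h2 : (2 : F) ≠ 0) :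
    Submodule.span ℤ (Set.range (classSum F n)) = Subalgebra.toSubmodule (Subalgebra.center ℤ
      (MonoidAlgebra ℤ (Matrix.symplecticGroup (Fin n) F))) := by
  classical
  refine le_antisymm (Submodule.span_le.mpr ?_) fun z hz => ?_
  · rintro _ ⟨μ, rfl⟩
    rw [SetLike.mem_coe, Subalgebra.mem_toSubmodule, mem_center_monoidAlgebra_iff]
    intro g k hgk
    rw [coeff_classSum, coeff_classSum]
    congr 1
    exact propext ⟨fun h => (hasModifiedType_iff_isConj h2 h).mpr hgk,
      fun h => (hasModifiedType_iff_isConj h2 h).mpr hgk.symm⟩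
  · rw [Subalgebra.mem_toSubmodule, mem_center_monoidAlgebra_iff] at hz
    choose τ hτ hτ' using fun g : Matrix.symplecticGroup (Fin n) F =>
      existsUnique_hasModifiedType h2 g
    have hsum : z = ∑ μ ∈ Finset.univ.image τ,
        (if h : ∃ g : Matrix.symplecticGroup (Fin n) F, HasModifiedType g μ
          then z.coeff h.choose else 0) • classSum F n μ := by
      refine MonoidAlgebra.coeff_injective (Finsupp.ext fun g => ?_)
      simp only [MonoidAlgebra.coeff_sum, Finsupp.finsetSum_apply, MonoidAlgebra.coeff_smul_apply,
        coeff_classSum]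
      rw [Finset.sum_eq_single_of_mem (τ g) (Finset.mem_image_of_mem _ (Finset.mem_univ g))]
      · have h : ∃ g : Matrix.symplecticGroup (Fin n) F, HasModifiedType g (τ g) := ⟨g, hτ g⟩
        have hex : ∃ k : Matrix.symplecticGroup (Fin n) F, HasModifiedType k (τ g) := ⟨g, hτ g⟩
        rw [dif_pos hex, if_pos (hτ g), smul_eq_mul, mul_one]
        exact hz _ _ ((hasModifiedType_iff_isConj h2 (hτ g)).mp hex.choose_spec)
      · intro μ _ hμ
        rw [if_neg fun h => hμ (hτ' g μ h), smul_zero]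
    rw [hsum]
    exact Submodule.sum_mem _ fun μ _ => Submodule.smul_mem _ _ (Submodule.subset_span ⟨μ, rfl⟩)

end Centre

end SpCentre
end

theorem theorem8p5 (F : Type*) [Field F] [Fintype F] (hq : Odd (Fintype.card F)) :
    (∀ n : ℕ,
      LinearIndependent ℤ
        (fun μ : {μ : SpCentre.SymplecticModifiedType F // SpCentre.classSum F n μ ≠ 0} =>
          SpCentre.classSum F n μ.1) ∧
      Submodule.span ℤ (Set.range (SpCentre.classSum F n)) =
        Subalgebra.toSubmodule (Subalgebra.center ℤ
          (MonoidAlgebra ℤ (Matrix.symplecticGroup (Fin n) F)))) ∧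
    ∃ r : SpCentre.SymplecticModifiedType F → SpCentre.SymplecticModifiedType F →
        (SpCentre.SymplecticModifiedType F →₀
          SpCentre.quantumIntValued ((Fintype.card F : ℚ) ^ 2)),
      ∀ (n : ℕ) (μ ν : SpCentre.SymplecticModifiedType F),
        SpCentre.toRat F n (SpCentre.classSum F n μ * SpCentre.classSum F n ν) =
          (r μ ν).sum fun κ f =>
            (f : Polynomial ℚ).eval (SpCentre.qInt ((Fintype.card F : ℚ) ^ 2) n) •
              SpCentre.toRat F n (SpCentre.classSum F n κ) := by
  classical
  have h2 : (2 : F) ≠ 0 := by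
    intro h
    have := CharTwo.of_one_ne_zero_of_two_eq_zero (one_ne_zero (α := F)) h
    have h1 := FiniteField.even_card_of_char_two (ringChar.eq F 2)
    exact Nat.not_even_iff_odd.mpr hq (Nat.even_iff.mpr h1)
  refine ⟨fun n => ⟨SpCentre.linearIndependent_classSum h2, SpCentre.span_classSum h2⟩, ?_⟩
  choose r hr using SpCentre.exists_structure_constants (F := F) h2
  refine ⟨r, fun n μ ν => MonoidAlgebra.coeff_injective (Finsupp.ext fun g => ?_)⟩
  -- Coefficients at `g` are compared: on the right only the class sum of the type of `g`
  -- contributes, and on the left stands the number of factorizations of `g`.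
  obtain ⟨κ, hκ, hκ'⟩ := SpCentre.existsUnique_hasModifiedType h2 g
  rw [SpCentre.coeff_toRat, SpCentre.coeff_classSum_mul, Int.cast_natCast,
    hr μ ν n κ _ ((SpCentre.hasModifiedType_iff g κ).mp hκ), Finsupp.sum, MonoidAlgebra.coeff_sum,
    Finsupp.finsetSum_apply, Finset.sum_eq_single κ]
  · rw [MonoidAlgebra.coeff_smul_apply, SpCentre.coeff_toRat, SpCentre.coeff_classSum, if_pos hκ,
      Int.cast_one, smul_eq_mul, mul_one]
  · intro κ' _ hne
    rw [MonoidAlgebra.coeff_smul_apply, SpCentre.coeff_toRat, SpCentre.coeff_classSum,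
      if_neg fun h => hne (hκ' κ' h), Int.cast_zero, smul_zero]
  · intro h
    rw [Finsupp.notMem_support_iff.mp h, ZeroMemClass.coe_zero, Polynomial.eval_zero, zero_smul]
    rfl
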